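/- Let $\mathcal M$ be an $n$-dimensional smooth (Hausdorff) manifold with a smooth torsion-free connection $\nabla$, let $\Phi$ be a smooth real-valued function on an open set $U\subset\mathcal M$, and let $p\in U$ be a nondegenerate critical point of $\Phi$. Then there are an open neighborhood $\Omega\subset U$ of $p$ (which can be taken inside any prescribed neighborhood of $p$) and a second-order linear differential operator $\square=\square_{\Phi,\nabla}$ on $\Omega$ with smooth real coefficients such that $$\Bigl(\frac{\partial}{\partial t}-\frac i2\,\square\Bigr)\Bigl[t^{-n/2}e^{i t^{-1}(\Phi-\Phi(p))}\Bigr]=0\quad\text{on }\Omega\text{, for all } t>0 .$$ Moreover, on the same set $\Omega$, this persists under small smooth perturbations: there is a neighborhood of $(\Phi,\nabla)$, given by finitely many derivatives on a compact subset of $U$, such that for every smooth function $\Phi'$ on $U$ and every smooth torsion-free connection $\nabla'$ on $\mathcal M$ with $(\Phi',\nabla')$ in this neighborhood, $\Phi'$ has exactly one critical point $p'$ in $\Omega$, it is nondegenerate, and there is a second-order differential operator $\square_{\Phi',\nabla'}$ on $\Omega$ with smooth real coefficients that satisfies the same equation with $\Phi',p'$ in place of $\Phi,p$. The operator depends only on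 the phase and the connection, without any choice of coordinates: both the admissibility of a domain (a diffeomorphism-invariant condition, satisfied by $\Omega$ for $(\Phi,\nabla)$ and all the perturbations above) and the operator on it are intrinsic, in the sense that whenever $F:\Omega_1\to\Omega_2$ is a smooth open embedding between admissible domains carrying the phase and connection on $\Omega_1$ to those on $\Omega_2$, one has $\square_1(f\circ F)=(\square_2 f)\circ F$ for all smooth $f$. It varies smoothly with the phase and the connection: if $(\Phi_s,\nabla_s)$ is a family in the above neighborhood that depends smoothly on a parameter $s$ in an open subset of some $\mathbb R^k$ (jointly smooth in $s$ and the point), then the coefficients of $\square_{\Phi_s,\nabla_s}$ in every chart are jointly smooth in $s$ and the point of $\Omega$. -/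

import Mathlib

open Set Filter Topology
open scoped Manifold ContDiff

universe u

noncomputable section

/-- A smooth torsion-free connection on an `n`-dimensional manifold `M`. -/
structure TorsionFreeConnection (n : ℕ) (M : Type u) [TopologicalSpace M]
    [ChartedSpace (EuclideanSpace ℝ (Fin n)) M] [IsManifold (𝓡 n) ∞ M] where
  /-- the covariant derivative: `cov Y x v` is `∇_v Y` at `x` -/
  cov : CovariantDerivative (𝓡 n) (EuclideanSpace ℝ (Fin n))
    (TangentSpace (𝓡 n) : M → Type _)
  smooth : cov.ContMDiffCovariantDerivative ∞
  torsion_eq_zero : cov.torsion = 0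

/-- `p` is a critical point of `Φ`, and the Hessian of `Φ` at `p` is nondegenerate.
(At a critical point the nondegeneracy does not depend on the chart.) -/
def IsNondegenerateCriticalPoint {n : ℕ} {M : Type u} [TopologicalSpace M]
    [ChartedSpace (EuclideanSpace ℝ (Fin n)) M] (Φ : M → ℝ) (p : M) : Prop :=
  mfderiv (𝓡 n) 𝓘(ℝ, ℝ) Φ p = 0 ∧
    ∀ v : EuclideanSpace ℝ (Fin n),
      (∀ w : EuclideanSpace ℝ (Fin n),
        fderiv ℝ (fderiv ℝ (Φ ∘ (chartAt (EuclideanSpace ℝ (Fin n)) p).symm))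
          (chartAt (EuclideanSpace ℝ (Fin n)) p p) v w = 0) → v = 0

/-- The connection coefficients in the chart `φ`, as a function on the target of the chart:
`∇_V W` in coordinates, where `V` and `W` are the vector fields with constant coordinates
`v` and `w`. -/
def christoffel {n : ℕ} {M : Type u} [TopologicalSpace M]
    [ChartedSpace (EuclideanSpace ℝ (Fin n)) M] [IsManifold (𝓡 n) ∞ M]
    (C : TorsionFreeConnection n M) (φ : OpenPartialHomeomorph M (EuclideanSpace ℝ (Fin n)))
    (v w : EuclideanSpace ℝ (Fin n)) (y : EuclideanSpace ℝ (Fin n)) :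
    EuclideanSpace ℝ (Fin n) :=
  mfderiv (𝓡 n) (𝓡 n) φ (φ.symm y)
    (C.cov (fun x => (mfderiv (𝓡 n) (𝓡 n) φ x).inverse w) (φ.symm y)
      ((mfderiv (𝓡 n) (𝓡 n) φ (φ.symm y)).inverse v))

/-- `(C', Φ')` is `ε`-close to `(C, Φ)` in `C^m` on the set `K`, measured in the chart `φ`.
For compact `K` inside the domain of `φ` these conditions cut out neighbourhoods of `(C, Φ)` in
the topology of locally uniform convergence of all derivatives. -/
def IsCloseOn {n : ℕ} {M : Type u} [TopologicalSpace M]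
    [ChartedSpace (EuclideanSpace ℝ (Fin n)) M] [IsManifold (𝓡 n) ∞ M]
    (φ : OpenPartialHomeomorph M (EuclideanSpace ℝ (Fin n))) (K : Set M) (m : ℕ) (ε : ℝ)
    (C : TorsionFreeConnection n M) (Φ : M → ℝ)
    (C' : TorsionFreeConnection n M) (Φ' : M → ℝ) : Prop :=
  ∀ x ∈ K, ∀ j ≤ m,
    ‖iteratedFDeriv ℝ j (fun y => Φ' (φ.symm y) - Φ (φ.symm y)) (φ x)‖ < ε ∧
    ∀ a b : Fin n,
      ‖iteratedFDeriv ℝ j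
        (fun y =>
          christoffel C' φ (EuclideanSpace.single a 1) (EuclideanSpace.single b 1) y
            - christoffel C φ (EuclideanSpace.single a 1) (EuclideanSpace.single b 1) y)
        (φ x)‖ < ε

/-- The family of connections `C s`, for `s` in the open set `S` of parameters, is smooth: its
coefficients in every chart are jointly smooth in the parameter and the point. -/
def IsSmoothFamilyOfConnections {n k : ℕ} {M : Type u} [TopologicalSpace M]
    [ChartedSpace (EuclideanSpace ℝ (Fin n)) M] [IsManifold (𝓡 n) ∞ M]
    (S : Set (EuclideanSpace ℝ (Fin k)))
    (C : EuclideanSpace ℝ (Fin k) → TorsionFreeConnection n M) : Prop :=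
  ∀ φ ∈ IsManifold.maximalAtlas (𝓡 n) ∞ M, ∀ v w : EuclideanSpace ℝ (Fin n),
    ContDiffOn ℝ ∞
      (fun z : EuclideanSpace ℝ (Fin k) × EuclideanSpace ℝ (Fin n) =>
        christoffel (C z.1) φ v w z.2)
      (S ×ˢ φ.target)

/-- The coordinate expression
`∑ a^{ij} ∂_i ∂_j f + ∑ b^i ∂_i f + c f` at the point `x`, in the chart `φ`. -/
def secondOrderExpr {n : ℕ} {M : Type u} [TopologicalSpace M]
    [ChartedSpace (EuclideanSpace ℝ (Fin n)) M]
    (φ : OpenPartialHomeomorph M (EuclideanSpace ℝ (Fin n)))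
    (a : Fin n → Fin n → ℝ) (b : Fin n → ℝ) (c : ℝ) (f : M → ℂ) (x : M) : ℂ :=
  (∑ i, ∑ j, (a i j : ℂ) *
      fderiv ℝ (fun y => fderiv ℝ (f ∘ φ.symm) y (EuclideanSpace.single j 1)) (φ x)
        (EuclideanSpace.single i 1))
    + (∑ i, (b i : ℂ) * fderiv ℝ (f ∘ φ.symm) (φ x) (EuclideanSpace.single i 1))
    + (c : ℂ) * f x

/-- `L` is, on `Ω`, a linear differential operator of order two with smooth real coefficients. -/
def IsSmoothSecondOrderOperatorOn {n : ℕ} {M : Type u} [TopologicalSpace M]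
    [ChartedSpace (EuclideanSpace ℝ (Fin n)) M] [IsManifold (𝓡 n) ∞ M]
    (Ω : Set M) (L : (M → ℂ) → M → ℂ) : Prop :=
  ∀ φ ∈ IsManifold.maximalAtlas (𝓡 n) ∞ M,
    ∃ (a : M → Fin n → Fin n → ℝ) (b : M → Fin n → ℝ) (c : M → ℝ),
      ContMDiffOn (𝓡 n) 𝓘(ℝ, Fin n → Fin n → ℝ) ∞ a (Ω ∩ φ.source) ∧
      ContMDiffOn (𝓡 n) 𝓘(ℝ, Fin n → ℝ) ∞ b (Ω ∩ φ.source) ∧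
      ContMDiffOn (𝓡 n) 𝓘(ℝ, ℝ) ∞ c (Ω ∩ φ.source) ∧
      ∀ x ∈ Ω ∩ φ.source, ∀ f : M → ℂ, ContMDiffAt (𝓡 n) 𝓘(ℝ, ℂ) ∞ f x →
        L f x = secondOrderExpr φ (a x) (b x) (c x) f x

/-- The family `L s`, for `s` in the open set `S` of parameters, of second-order differential
operators on `Ω` is smooth: the coefficients are jointly smooth in the parameter and the point. -/
def IsSmoothFamilyOfSecondOrderOperatorsOn {n k : ℕ} {M : Type u} [TopologicalSpace M]
    [ChartedSpace (EuclideanSpace ℝ (Fin n)) M] [IsManifold (𝓡 n) ∞ M]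
    (S : Set (EuclideanSpace ℝ (Fin k))) (Ω : Set M)
    (L : EuclideanSpace ℝ (Fin k) → (M → ℂ) → M → ℂ) : Prop :=
  ∀ φ ∈ IsManifold.maximalAtlas (𝓡 n) ∞ M,
    ∃ (a : EuclideanSpace ℝ (Fin k) × M → Fin n → Fin n → ℝ)
      (b : EuclideanSpace ℝ (Fin k) × M → Fin n → ℝ)
      (c : EuclideanSpace ℝ (Fin k) × M → ℝ),
      ContMDiffOn ((𝓡 k).prod (𝓡 n)) 𝓘(ℝ, Fin n → Fin n → ℝ) ∞ a (S ×ˢ (Ω ∩ φ.source)) ∧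
      ContMDiffOn ((𝓡 k).prod (𝓡 n)) 𝓘(ℝ, Fin n → ℝ) ∞ b (S ×ˢ (Ω ∩ φ.source)) ∧
      ContMDiffOn ((𝓡 k).prod (𝓡 n)) 𝓘(ℝ, ℝ) ∞ c (S ×ˢ (Ω ∩ φ.source)) ∧
      ∀ s ∈ S, ∀ x ∈ Ω ∩ φ.source, ∀ f : M → ℂ, ContMDiffAt (𝓡 n) 𝓘(ℝ, ℂ) ∞ f x →
        L s f x = secondOrderExpr φ (a (s, x)) (b (s, x)) (c (s, x)) f x

/-- The function `t^{-n/2} e^{i t⁻¹ (Φ - Φ(p))}`. -/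
def schrodingerWave {M : Type u} (n : ℕ) (Φ : M → ℝ) (p : M) (t : ℝ) (x : M) : ℂ :=
  ((t ^ (-(n : ℝ) / 2) : ℝ) : ℂ) * Complex.exp (Complex.I * ((t⁻¹ * (Φ x - Φ p) : ℝ) : ℂ))

/-- `(∂_t - (i/2) L) [t^{-n/2} e^{i t⁻¹ (Φ - Φ(p))}] = 0` on `Ω`, for all `t > 0`. -/
def SolvesSchrodingerOn {M : Type u} (n : ℕ) (Φ : M → ℝ) (p : M) (Ω : Set M)
    (L : (M → ℂ) → M → ℂ) : Prop :=
  ∀ t : ℝ, 0 < t → ∀ x ∈ Ω,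
    HasDerivAt (fun τ : ℝ => schrodingerWave n Φ p τ x)
      (Complex.I / 2 * L (schrodingerWave n Φ p t) x) t

/-- The local diffeomorphism `F` carries the connection `C` on `Ω` to the connection `C'`:
`dF (∇_v Y) = ∇'_{dF v} Y'` whenever the vector fields `Y` and `Y'` are `F`-related. -/
def PreservesConnectionOn {n : ℕ} {M M' : Type u}
    [TopologicalSpace M] [ChartedSpace (EuclideanSpace ℝ (Fin n)) M] [IsManifold (𝓡 n) ∞ M]
    [TopologicalSpace M'] [ChartedSpace (EuclideanSpace ℝ (Fin n)) M'] [IsManifold (𝓡 n) ∞ M']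
    (C : TorsionFreeConnection n M) (C' : TorsionFreeConnection n M')
    (F : M → M') (Ω : Set M) : Prop :=
  ∀ x ∈ Ω, ∀ (Y : Π z : M, TangentSpace (𝓡 n) z) (Y' : Π z : M', TangentSpace (𝓡 n) z),
    ContMDiffAt (𝓡 n) (𝓡 n).tangent ∞
      (fun z => (⟨z, Y z⟩ : TangentBundle (𝓡 n) M)) x →
    ContMDiffAt (𝓡 n) (𝓡 n).tangent ∞
      (fun z => (⟨z, Y' z⟩ : TangentBundle (𝓡 n) M')) (F x) →
    (∀ᶠ z in 𝓝 x, mfderiv (𝓡 n) (𝓡 n) F z (Y z) = Y' (F z)) →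
    ∀ v : TangentSpace (𝓡 n) x,
      mfderiv (𝓡 n) (𝓡 n) F x (C.cov Y x v)
        = C'.cov Y' (F x) (mfderiv (𝓡 n) (𝓡 n) F x v)

/-- A condition on a Hausdorff manifold with a torsion-free connection, a real function and
a subset. -/
def AdmissibilityRule (n : ℕ) : Type (u + 1) :=
  ∀ (M : Type u) [TopologicalSpace M] [T2Space M]
    [ChartedSpace (EuclideanSpace ℝ (Fin n)) M] [IsManifold (𝓡 n) ∞ M],
    TorsionFreeConnection n M → (M → ℝ) → Set M → Prop

/-- A rule that assigns an operator on functions to a Hausdorff manifold with a torsion-free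
connection, a real function and a subset. -/
def OperatorRule (n : ℕ) : Type (u + 1) :=
  ∀ (M : Type u) [TopologicalSpace M] [T2Space M]
    [ChartedSpace (EuclideanSpace ℝ (Fin n)) M] [IsManifold (𝓡 n) ∞ M],
    TorsionFreeConnection n M → (M → ℝ) → Set M → (M → ℂ) → M → ℂ

/-- `F` maps `Ω` into `Ω'` as a smooth open embedding and carries the phase `Φ` and the connection
`C` on `Ω` to the phase `Φ'` and the connection `C'`. -/
def IsStructureEmbedding {n : ℕ} {M M' : Type u}
    [TopologicalSpace M] [ChartedSpace (EuclideanSpace ℝ (Fin n)) M] [IsManifold (𝓡 n) ∞ M]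
    [TopologicalSpace M'] [ChartedSpace (EuclideanSpace ℝ (Fin n)) M'] [IsManifold (𝓡 n) ∞ M']
    (C : TorsionFreeConnection n M) (Φ : M → ℝ) (Ω : Set M)
    (C' : TorsionFreeConnection n M') (Φ' : M' → ℝ) (Ω' : Set M') (F : M → M') : Prop :=
  IsLocalDiffeomorphOn (𝓡 n) (𝓡 n) ∞ F Ω ∧ InjOn F Ω ∧ MapsTo F Ω Ω' ∧
    (∀ x ∈ Ω, Φ' (F x) = Φ x) ∧ PreservesConnectionOn C C' F Ω

/-- The rules `Adm` and `Box` are intrinsic. Admissibility is invariant under the diffeomorphisms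
`Ω → Ω'` that carry phase and connection to phase and connection, and every open embedding of
admissible domains with this property carries the one operator to the other. This includes
changes of coordinates, the passage to a smaller admissible domain, and changes of the phase and
of the connection outside the domain. -/
def IsIntrinsic {n : ℕ} (Adm : AdmissibilityRule.{u} n) (Box : OperatorRule.{u} n) : Prop :=
  ∀ (M M' : Type u)
    [TopologicalSpace M] [T2Space M]
    [ChartedSpace (EuclideanSpace ℝ (Fin n)) M] [IsManifold (𝓡 n) ∞ M]
    [TopologicalSpace M'] [T2Space M']
    [ChartedSpace (EuclideanSpace ℝ (Fin n)) M'] [IsManifold (𝓡 n) ∞ M']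
    (C : TorsionFreeConnection n M) (C' : TorsionFreeConnection n M')
    (Φ : M → ℝ) (Φ' : M' → ℝ) (Ω : Set M) (Ω' : Set M') (F : M → M'),
    IsOpen Ω → IsOpen Ω' → IsStructureEmbedding C Φ Ω C' Φ' Ω' F → Adm M C Φ Ω →
    (SurjOn F Ω Ω' → Adm M' C' Φ' Ω') ∧
    (Adm M' C' Φ' Ω' →
      ∀ x ∈ Ω, ∀ f : M' → ℂ, ContMDiffAt (𝓡 n) 𝓘(ℝ, ℂ) ∞ f (F x) →
        Box M C Φ Ω (f ∘ F) x = Box M' C' Φ' Ω' f (F x))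

end

/-! Write H for the covariant Hessian ∇dΦ (`covariantHess`). It is invertible near p, so V = H⁻¹dΦ
is a smooth vector field there. V vanishes at p with linear part the identity, hence there are
coordinates z centred at p in which V is the Euler field, that is, H(z)z = dΦ(z). A transition map
between two such coordinate systems commutes with dilations and is differentiable at 0, so it is
linear (`eq_fderiv_zero_of_euler`, `IsFlatChart.exists_linear`). Whatever is built in these
coordinates naturally with respect to linear maps is therefore intrinsic. A domain is called
admissible when it carries such a chart with star-shaped image (`IsFlatChart`).

Let u be the phase in these coordinates. An operator without zeroth-order term, with principal form
a, satisfies the equation as soon as a(du,du) = 2(u - u(0)) and □u = n. Since the derivative of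
u(tz) in t is t H(tz)(z,z), the average A(z) = 2∫ t H(tz) dt satisfies A(z)(z,z) = 2(u(z) - u(0)).
So a(ξ,η) = A(H⁻¹ξ, H⁻¹η) solves the first equation, because H⁻¹du = z. The defect e = n - a(D²u)
vanishes at 0, and e(z) = ∫ De(tz)z dt, so the drift ξ ↦ ∫ De(tz) dt (H⁻¹ξ) supplies exactly what is
missing in the second (`IsFlatModel.flatBox_wave`).

The linearization must be smooth in parameters and defined on one domain for all small
perturbations. Along a ray put x(τ) = c + τw(τ) in τx' = V(x), where c is the zero of V. Taylor's
formula turns this into the regular equation w' = Q(τ,w), w(0) = z, in which Q is the quadratic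
remainder of V divided by τ². It is solved by contraction in C([0,1],E), and the implicit function
theorem there gives smooth dependence, because superposition operators are smooth. The inverse
coordinates are ψ(z) = c + w(1) (`IsEulerFamily.exists_linearization`).

Finally, V is a smooth function of du, D²u and the connection coefficients. Closeness in C⁴
therefore bounds the second derivatives of V uniformly, and these bounds fix a radius that serves
all perturbations (`exists_uniform_radius`, `IsNondegenerateCriticalPoint.exists_stable_domain`). -/

noncomputable section

set_option linter.unusedSectionVars false

/-! ### Smooth dependence on parameters: implicit equations, superposition operators, integrals. -/

section ParametricCalculus

/-- A uniquely solvable smooth equation with invertible partial derivative has a smooth solution. -/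
theorem contDiffOn_of_unique_solution {P X Y : Type*} [NormedAddCommGroup P] [NormedSpace ℝ P]
    [CompleteSpace P] [NormedAddCommGroup X] [NormedSpace ℝ X] [CompleteSpace X]
    [NormedAddCommGroup Y] [NormedSpace ℝ Y] [CompleteSpace Y]
    {O : Set (P × X)} {S : Set P} (hS : IsOpen S) (hO : IsOpen O) {F : P × X → Y}
    (hF : ContDiffOn ℝ ∞ F O) {w : P → X} (hw : ∀ s ∈ S, (s, w s) ∈ O ∧ F (s, w s) = 0)
    (hinv : ∀ s ∈ S, (fderiv ℝ F (s, w s) ∘L .inr ℝ P X).IsInvertible)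
    (huniq : ∀ s ∈ S, ∀ x, (s, x) ∈ O → F (s, x) = 0 → x = w s) :
    ContDiffOn ℝ ∞ w S := by
  intro s hs
  have hFs : ContDiffAt ℝ ∞ F (s, w s) := hF.contDiffAt (hO.mem_nhds (hw s hs).1)
  have hne : (∞ : WithTop ℕ∞) ≠ 0 := by simp
  have h1 := hFs.contDiffAt_implicitFunction hne (hinv s hs)
  refine ContDiffAt.contDiffWithinAt (h1.congr_of_eventuallyEq ?_)
  have h2 := hFs.eventually_apply_implicitFunction hne (hinv s hs)
  have h3 : Tendsto (fun x => (x, hFs.implicitFunction hne (hinv s hs) x)) (𝓝 s) (𝓝 (s, w s)) := by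
    have := hFs.implicitFunction_apply_self hne (hinv s hs)
    have h4 := h1.continuousAt.tendsto
    simp only at this h4
    rw [this] at h4
    exact tendsto_id.prodMk_nhds h4
  filter_upwards [h2, h3.eventually (hO.mem_nhds (hw s hs).1), hS.mem_nhds hs] with x hx hxO hxS
  -- The implicit function solves the equation near s, so uniqueness identifies it with w. No
  -- continuity of w is assumed.
  refine (huniq x hxS _ hxO ?_).symm
  rw [hx, (hw s hs).2]

variable {K : Type*} [TopologicalSpace K] [CompactSpace K]
variable {X Y : Type} [NormedAddCommGroup X] [NormedSpace ℝ X] [NormedAddCommGroup Y]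
  [NormedSpace ℝ Y]

open Classical in
/-- The superposition operator `u ↦ f ∘ u` on continuous functions. -/
def superposition (K : Type*) [TopologicalSpace K] (f : X → Y) (u : C(K, X)) : C(K, Y) :=
  if h : Continuous (f ∘ u) then ⟨f ∘ u, h⟩ else 0

theorem superposition_apply {f : X → Y} {u : C(K, X)} {O : Set X} (hf : ContinuousOn f O)
    (hu : ∀ t, u t ∈ O) (t : K) : superposition K f u t = f (u t) := by
  have h : Continuous (f ∘ u) := hf.comp_continuous u.continuous hu
  simp [superposition, h]

/-- Pointwise application of a continuous family of operators. -/
def pointwiseApply (K : Type*) [TopologicalSpace K] [CompactSpace K] (X Y : Type)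
    [NormedAddCommGroup X] [NormedSpace ℝ X] [NormedAddCommGroup Y] [NormedSpace ℝ Y] :
    C(K, X →L[ℝ] Y) →L[ℝ] C(K, X) →L[ℝ] C(K, Y) :=
  LinearMap.mkContinuous₂
    (LinearMap.mk₂ ℝ (fun (A : C(K, X →L[ℝ] Y)) (u : C(K, X)) =>
      (⟨fun t => A t (u t), by fun_prop⟩ : C(K, Y)))
      (by intros; ext; simp) (by intros; ext; simp) (by intros; ext; simp) (by intros; ext; simp))
    1 (by
      intro A u
      rw [ContinuousMap.norm_le _ (mul_nonneg (by positivity) (norm_nonneg u))]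
      intro t
      simp only [LinearMap.mk₂_apply, ContinuousMap.coe_mk, one_mul]
      exact (A t).le_of_opNorm_le_of_le (A.norm_coe_le_norm t) (u.norm_coe_le_norm t))

@[simp] theorem pointwiseApply_apply (A : C(K, X →L[ℝ] Y)) (u : C(K, X)) (t : K) :
    pointwiseApply K X Y A u t = A t (u t) := rfl

theorem isOpen_setOf_forall_mem {O : Set X} (hO : IsOpen O) :
    IsOpen {u : C(K, X) | ∀ t, u t ∈ O} := by
  have := ContinuousMap.isOpen_setOfPred_mapsTo (X := K) (Y := X) isCompact_univ hO
  simpa [MapsTo] using this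

/-- Compactness of K makes the continuity of f at the points u t uniform in t. -/
theorem continuousOn_superposition {f : X → Y} {O : Set X} (hO : IsOpen O)
    (hf : ContinuousOn f O) :
    ContinuousOn (superposition K f) {u : C(K, X) | ∀ t, u t ∈ O} := by
  intro u hu
  refine ContinuousAt.continuousWithinAt ?_
  rw [Metric.continuousAt_iff']
  intro ε hε
  have key : ∀ t ∈ (univ : Set K), ∀ᶠ z : X × K in 𝓝 (0, t),
      dist (f (u z.2 + z.1)) (f (u z.2)) < ε / 2 := by
    intro t _
    have hc : ContinuousAt f (u t) := hf.continuousAt (hO.mem_nhds (hu t))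
    have h1 : Tendsto (fun z : X × K => u z.2 + z.1) (𝓝 (0, t)) (𝓝 (u t)) := by
      have : Continuous (fun z : X × K => u z.2 + z.1) := by fun_prop
      simpa using this.tendsto (0, t)
    have h2 : Tendsto (fun z : X × K => u z.2) (𝓝 (0, t)) (𝓝 (u t)) := by
      have : Continuous (fun z : X × K => u z.2) := by fun_prop
      simpa using this.tendsto (0, t)
    have := ((hc.tendsto.comp h1).dist (hc.tendsto.comp h2))
    rw [dist_self] at this
    exact this.eventually (gt_mem_nhds (by positivity))
  have h3 := isCompact_univ.eventually_forall_of_forall_eventually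
    (P := fun (x : X) (t : K) => dist (f (u t + x)) (f (u t)) < ε / 2) key
  have h4 : Tendsto (fun v : C(K, X) => v - u) (𝓝 u) (𝓝 0) := by
    have : Continuous (fun v : C(K, X) => v - u) := by fun_prop
    simpa using this.tendsto u
  obtain ⟨δ, hδ, hδ'⟩ := Metric.eventually_nhds_iff.1 h3
  filter_upwards [(isOpen_setOf_forall_mem hO).mem_nhds hu, Metric.ball_mem_nhds u hδ]
    with v hv hvδ
  refine lt_of_le_of_lt ((ContinuousMap.dist_le (by positivity : 0 ≤ ε / 2)).2 fun t => ?_)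
    (half_lt_self hε)
  rw [superposition_apply hf hv, superposition_apply hf hu]
  have := hδ' (y := v t - u t) ?_ t (mem_univ t)
  · simpa using this.le
  · rw [dist_zero_right, ← dist_eq_norm]
    exact lt_of_le_of_lt (ContinuousMap.dist_apply_le_dist t) hvδ

/-- Strict differentiability of f at each u t and continuity of its derivative give a first-order
estimate near u t. Compactness of K makes it uniform in t, hence an estimate in the supremum norm.
-/
theorem hasFDerivAt_superposition {f : X → Y} {O : Set X} (hO : IsOpen O)
    (hf : ContDiffOn ℝ 1 f O) {u : C(K, X)} (hu : ∀ t, u t ∈ O) :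
    HasFDerivAt (superposition K f)
      (pointwiseApply K X Y (superposition K (fderiv ℝ f) u)) u := by
  have hf' : ContinuousOn (fderiv ℝ f) O := hf.continuousOn_fderiv_of_isOpen hO le_rfl
  rw [hasFDerivAt_iff_isLittleO_nhds_zero, Asymptotics.isLittleO_iff]
  intro ε hε
  have key : ∀ t ∈ (univ : Set K), ∀ᶠ z : X × K in 𝓝 (0, t),
      ‖f (u z.2 + z.1) - f (u z.2) - fderiv ℝ f (u z.2) z.1‖ ≤ ε * ‖z.1‖ := by
    intro t _
    have hs : HasStrictFDerivAt f (fderiv ℝ f (u t)) (u t) :=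
      (hf.contDiffAt (hO.mem_nhds (hu t))).hasStrictFDerivAt (by simp)
    have h1 : Tendsto (fun z : X × K => (u z.2 + z.1, u z.2)) (𝓝 (0, t)) (𝓝 (u t, u t)) := by
      have : Continuous (fun z : X × K => (u z.2 + z.1, u z.2)) := by fun_prop
      simpa using this.tendsto (0, t)
    have h2 := h1.eventually ((Asymptotics.isLittleO_iff.1 hs.isLittleO) (half_pos hε))
    have h3 : Tendsto (fun z : X × K => fderiv ℝ f (u z.2)) (𝓝 (0, t))
        (𝓝 (fderiv ℝ f (u t))) := by
      have : Continuous (fun z : X × K => u z.2) := by fun_prop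
      exact (hf'.continuousAt (hO.mem_nhds (hu t))).tendsto.comp (this.tendsto (0, t))
    have h4 := h3.eventually (Metric.ball_mem_nhds _ (half_pos hε))
    filter_upwards [h2, h4] with z hz hz'
    simp only [add_sub_cancel_left] at hz
    have e : f (u z.2 + z.1) - f (u z.2) - fderiv ℝ f (u z.2) z.1
        = (f (u z.2 + z.1) - f (u z.2) - fderiv ℝ f (u t) z.1)
          - (fderiv ℝ f (u z.2) - fderiv ℝ f (u t)) z.1 := by
      simp
    rw [e]
    refine (norm_sub_le _ _).trans ?_
    have h5 : ‖(fderiv ℝ f (u z.2) - fderiv ℝ f (u t)) z.1‖ ≤ ε / 2 * ‖z.1‖ :=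
      ContinuousLinearMap.le_of_opNorm_le _ (by rw [← dist_eq_norm]; exact hz'.le) _
    linarith
  have h3 := isCompact_univ.eventually_forall_of_forall_eventually
    (P := fun (x : X) (t : K) => ‖f (u t + x) - f (u t) - fderiv ℝ f (u t) x‖ ≤ ε * ‖x‖) key
  obtain ⟨δ, hδ, hδ'⟩ := Metric.eventually_nhds_iff.1 h3
  have h6 : ∀ᶠ v : C(K, X) in 𝓝 0, ∀ t, (u + v) t ∈ O := by
    have : Tendsto (fun v : C(K, X) => u + v) (𝓝 0) (𝓝 u) := by
      have : Continuous (fun v : C(K, X) => u + v) := by fun_prop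
      simpa using this.tendsto 0
    exact this.eventually ((isOpen_setOf_forall_mem hO).mem_nhds hu)
  filter_upwards [h6, Metric.ball_mem_nhds (0 : C(K, X)) hδ] with v hv hvδ
  rw [ContinuousMap.norm_le _ (by positivity)]
  intro t
  have hvt : ‖v t‖ ≤ ‖v‖ := v.norm_coe_le_norm t
  have := hδ' (y := v t) (by
    rw [dist_zero_right]; rw [mem_ball_zero_iff] at hvδ; exact hvt.trans_lt hvδ) t (mem_univ t)
  simp only [ContinuousMap.sub_apply, pointwiseApply_apply]
  rw [superposition_apply hf.continuousOn hv, superposition_apply hf.continuousOn hu,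
    superposition_apply hf' hu]
  exact this.trans (by gcongr)

/-- The derivative of a superposition operator is again one, followed by the continuous linear map
`pointwiseApply`. This permits induction on the order; the target space changes at each step, so it
is quantified inside the induction. -/
theorem contDiffOn_superposition {f : X → Y} {O : Set X} (hO : IsOpen O)
    (hf : ContDiffOn ℝ ∞ f O) :
    ContDiffOn ℝ ∞ (superposition K f) {u : C(K, X) | ∀ t, u t ∈ O} := by
  have main : ∀ (m : ℕ) (Y : Type) [NormedAddCommGroup Y] [NormedSpace ℝ Y] (f : X → Y),
      ContDiffOn ℝ ∞ f O → ContDiffOn ℝ m (superposition K f) {u : C(K, X) | ∀ t, u t ∈ O} := by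
    intro m
    induction m with
    | zero =>
      intro Y _ _ f hf
      simpa using continuousOn_superposition hO hf.continuousOn
    | succ m ih =>
      intro Y _ _ f hf
      have hd : ∀ u ∈ {u : C(K, X) | ∀ t, u t ∈ O}, HasFDerivAt (superposition K f)
          (pointwiseApply K X Y (superposition K (fderiv ℝ f) u)) u := fun u hu =>
        hasFDerivAt_superposition hO (hf.of_le (by simp)) hu
      have hf' : ContDiffOn ℝ ∞ (fderiv ℝ f) O := hf.fderiv_of_isOpen hO le_rfl
      rw [Nat.cast_succ]
      rw [contDiffOn_succ_iff_fderiv_of_isOpen (isOpen_setOf_forall_mem hO)]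
      refine ⟨fun u hu => (hd u hu).differentiableAt.differentiableWithinAt, by simp, ?_⟩
      refine ((pointwiseApply K X Y).contDiff.comp_contDiffOn (ih _ _ hf')).congr fun u hu => ?_
      exact (hd u hu).fderiv
  exact contDiffOn_infty.2 fun m => main m Y f hf

/-- The primitive vanishing at `0`, as an operator on continuous functions on the unit interval. -/
def primitive (Y : Type) [NormedAddCommGroup Y] [NormedSpace ℝ Y] :
    C(unitInterval, Y) →L[ℝ] C(unitInterval, Y) :=
  LinearMap.mkContinuous
    { toFun := fun u => ⟨fun s => ∫ t in (0 : ℝ)..s, IccExtend zero_le_one u t, by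
        have h : Continuous (IccExtend (zero_le_one' ℝ) u) := u.continuous.Icc_extend'
        exact (intervalIntegral.continuous_primitive
          (fun a b => h.intervalIntegrable a b) 0).comp continuous_subtype_val⟩
      map_add' := by
        intro u v
        ext s
        have hu : Continuous (IccExtend (zero_le_one' ℝ) u) := u.continuous.Icc_extend'
        have hv : Continuous (IccExtend (zero_le_one' ℝ) v) := v.continuous.Icc_extend'
        simp only [ContinuousMap.coe_mk, ContinuousMap.add_apply]
        rw [← intervalIntegral.integral_add (hu.intervalIntegrable _ _)
          (hv.intervalIntegrable _ _)]
        rfl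
      map_smul' := by
        intro c u
        ext s
        simp only [ContinuousMap.coe_mk, ContinuousMap.smul_apply, RingHom.id_apply]
        rw [← intervalIntegral.integral_smul]
        rfl }
    1 (by
      intro u
      rw [ContinuousMap.norm_le _ (by positivity)]
      intro s
      refine (intervalIntegral.norm_integral_le_of_norm_le_const (C := ‖u‖) fun t _ => ?_).trans ?_
      · exact u.norm_coe_le_norm _
      · have := s.2.1
        have := s.2.2
        rw [sub_zero, abs_of_nonneg s.2.1, one_mul]
        exact mul_le_of_le_one_right (norm_nonneg _) s.2.2)

theorem primitive_apply {u : C(unitInterval, Y)} {f : ℝ → Y}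
    (h : ∀ t : unitInterval, u t = f t) (s : unitInterval) :
    primitive Y u s = ∫ t in (0 : ℝ)..s, f t := by
  refine intervalIntegral.integral_congr fun t ht => ?_
  rw [uIcc_of_le s.2.1] at ht
  have ht' : t ∈ Icc (0 : ℝ) 1 := ⟨ht.1, ht.2.trans s.2.2⟩
  rw [IccExtend_of_mem _ _ ht', h]

theorem norm_primitive_le (u : C(unitInterval, Y)) : ‖primitive Y u‖ ≤ ‖u‖ := by
  have := (primitive Y).le_of_opNorm_le (LinearMap.mkContinuous_norm_le _ zero_le_one _) u
  simpa using this

/-- Smoothness of integrals over the unit interval that depend on a parameter. -/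
theorem contDiffOn_parametric_integral {P : Type} [NormedAddCommGroup P] [NormedSpace ℝ P]
    {O : Set (P × ℝ)} (hO : IsOpen O) {f : P × ℝ → Y} (hf : ContDiffOn ℝ ∞ f O)
    {S : Set P} (hS : ∀ s ∈ S, ∀ t ∈ Icc (0 : ℝ) 1, (s, t) ∈ O) :
    ContDiffOn ℝ ∞ (fun s => ∫ t in (0 : ℝ)..1, f (s, t)) S := by
  -- The integral is the value at 1 of the primitive of t ↦ f (s, t), and this curve is a
  -- superposition along the affine map ι. Smoothness thus follows without differentiating under the
  -- integral sign.
  let ι : P → C(unitInterval, P × ℝ) := fun s => ⟨fun t : unitInterval => (s, (t : ℝ)), by fun_prop⟩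
  have hι : ContDiff ℝ ∞ ι := by
    let A : P →L[ℝ] C(unitInterval, P × ℝ) :=
      LinearMap.mkContinuous
        { toFun := fun s => ContinuousMap.const _ (s, 0)
          map_add' := by intros; ext <;> simp
          map_smul' := by intros; ext <;> simp }
        1 (by
          intro s
          rw [ContinuousMap.norm_le _ (by positivity)]
          intro t
          simp)
    have : ι = fun s => A s + ι 0 := by
      funext s
      ext t <;> simp [ι, A]
    rw [this]
    exact A.contDiff.add contDiff_const
  have h := ((contDiffOn_superposition (K := unitInterval) hO hf).comp
    hι.contDiffOn (s := S) (fun s hs (t : unitInterval) => hS s hs t t.2))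
  have h2 := (ContinuousMap.evalCLM ℝ (1 : unitInterval)).contDiff.comp_contDiffOn
    ((primitive Y).contDiff.comp_contDiffOn h)
  refine h2.congr fun s hs => ?_
  simp only [Function.comp_apply, ContinuousMap.evalCLM_apply]
  rw [primitive_apply (f := fun t => f (s, t))]
  · simp
  · intro t
    exact superposition_apply hf.continuousOn (fun t : unitInterval => hS s hs t t.2) t

end ParametricCalculus

/-! ### Taylor remainders of vector fields and perturbations of the identity. -/

section Linearization

theorem fderiv_partial_snd {P E F : Type*} [NormedAddCommGroup P] [NormedSpace ℝ P]
    [NormedAddCommGroup E] [NormedSpace ℝ E] [NormedAddCommGroup F] [NormedSpace ℝ F]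
    {f : P × E → F} {s : P} {x : E} (hf : DifferentiableAt ℝ f (s, x)) :
    fderiv ℝ (fun y => f (s, y)) x = fderiv ℝ f (s, x) ∘L .inr ℝ P E :=
  (hf.hasFDerivAt.comp x (hasFDerivAt_prodMk_right s x)).fderiv

/-- The partial derivative of a smooth function is jointly smooth. -/
theorem ContDiffOn.partial_fderiv {P E F : Type*} [NormedAddCommGroup P] [NormedSpace ℝ P]
    [NormedAddCommGroup E] [NormedSpace ℝ E] [NormedAddCommGroup F] [NormedSpace ℝ F]
    {f : P × E → F} {O : Set (P × E)} (hO : IsOpen O) (hf : ContDiffOn ℝ ∞ f O) :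
    ContDiffOn ℝ ∞ (fun q : P × E => fderiv ℝ (fun y => f (q.1, y)) q.2) O := by
  have h1 : ContDiffOn ℝ ∞ (fun q => fderiv ℝ f q ∘L ContinuousLinearMap.inr ℝ P E) O :=
    (hf.fderiv_of_isOpen hO le_rfl).clm_comp contDiffOn_const
  refine h1.congr fun q hq => ?_
  exact fderiv_partial_snd ((hf.contDiffAt (hO.mem_nhds hq)).differentiableAt (by simp))

/-- The slice of a jointly smooth function is smooth. -/
theorem ContDiffOn.slice {P E F : Type*} [NormedAddCommGroup P] [NormedSpace ℝ P]
    [NormedAddCommGroup E] [NormedSpace ℝ E] [NormedAddCommGroup F] [NormedSpace ℝ F]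
    {f : P × E → F} {O : Set (P × E)} (hf : ContDiffOn ℝ ∞ f O) {s : P} {B : Set E}
    (hB : ∀ x ∈ B, (s, x) ∈ O) : ContDiffOn ℝ ∞ (fun x => f (s, x)) B :=
  hf.comp (contDiff_const.prodMk contDiff_id).contDiffOn hB

/-- A map close to the identity is locally onto. -/
theorem exists_eq_of_norm_sub_sub_le {X : Type*} [NormedAddCommGroup X] [NormedSpace ℝ X]
    [CompleteSpace X] {f : X → X} {s : Set X} {c ε : ℝ} (hc : 0 ≤ c) (hε : 0 ≤ ε) {b y : X}
    (hf : ∀ x ∈ s, ∀ y ∈ s, ‖f x - f y - (x - y)‖ ≤ c * ‖x - y‖)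
    (hs : Metric.closedBall b ε ⊆ s) (hy : dist y (f b) ≤ (1 - c) * ε) :
    ∃ x ∈ Metric.closedBall b ε, f x = y := by
  lift c to NNReal using hc
  have h : ApproximatesLinearOn f (ContinuousLinearMap.id ℝ X) s c := fun x hx y hy => by
    simpa using hf x hx y hy
  let i : (ContinuousLinearMap.id ℝ X).NonlinearRightInverse :=
    { toFun := id
      nnnorm := 1
      bound' := by simp
      right_inv' := by simp }
  have := h.surjOn_closedBall_of_nonlinearRightInverse i hε hs
  refine this ?_
  simpa [i] using hy

variable {E : Type} [NormedAddCommGroup E] [NormedSpace ℝ E] [CompleteSpace E]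

/-- The quadratic remainder `∫ (1 - t) D²W(c + tτw)(w, w) dt` of a vector field at a zero `c`. -/
def eulerRemainder (W : E → E) (c : E) (τ : ℝ) (w : E) : E :=
  ∫ t in (0 : ℝ)..1, (1 - t) • fderiv ℝ (fderiv ℝ W) (c + (t * τ) • w) w w

/-- This homogeneity makes a rescaled solution of the integral equation a solution for the rescaled
datum. -/
theorem eulerRemainder_smul (W : E → E) (c : E) (τ σ : ℝ) (w : E) :
    eulerRemainder W c σ (τ • w) = τ ^ 2 • eulerRemainder W c (τ * σ) w := by
  simp only [eulerRemainder]
  rw [← intervalIntegral.integral_smul]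
  congr 1
  funext t
  simp only [map_smul, smul_apply, smul_smul]
  rw [show t * σ * τ = t * (τ * σ) by ring]
  congr 1
  ring

theorem eulerRemainder_zero_right (W : E → E) (c : E) (σ : ℝ) :
    eulerRemainder W c σ 0 = 0 := by
  simp [eulerRemainder]

/-- Taylor's formula of second order at c, with (1 - t) DW(c + tτw)(τw) + W(c + tτw) as primitive of
the integrand. The remainder divided by τ² stays regular at τ = 0, which removes the singularity of
τx' = W(x) at the zero of W. -/
theorem sq_smul_eulerRemainder {W : E → E} {c : E} {B : Set E} (hB : IsOpen B)
    (hW : ContDiffOn ℝ ∞ W B) {τ : ℝ} {w : E} (hw : ∀ t ∈ Icc (0 : ℝ) 1, c + (t * τ) • w ∈ B) :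
    τ ^ 2 • eulerRemainder W c τ w = W (c + τ • w) - W c - fderiv ℝ W c (τ • w) := by
  have hl : ∀ t : ℝ, HasDerivAt (fun t : ℝ => c + (t * τ) • w) (τ • w) t := fun t => by
    have := (((hasDerivAt_id t).mul_const τ).smul_const w).const_add c
    simpa using this
  have hW1 : ContDiffOn ℝ ∞ (fderiv ℝ W) B := hW.fderiv_of_isOpen hB le_rfl
  have hW2 : ContDiffOn ℝ ∞ (fderiv ℝ (fderiv ℝ W)) B := hW1.fderiv_of_isOpen hB le_rfl
  have h0 : ∀ t ∈ uIcc (0 : ℝ) 1, HasDerivAt (fun t : ℝ => W (c + (t * τ) • w))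
      (fderiv ℝ W (c + (t * τ) • w) (τ • w)) t := by
    intro t ht
    rw [uIcc_of_le zero_le_one] at ht
    have := ((hW.contDiffAt (hB.mem_nhds (hw t ht))).differentiableAt (by simp)).hasFDerivAt
    exact this.comp_hasDerivAt t (hl t)
  have h1 : ∀ t ∈ uIcc (0 : ℝ) 1,
      HasDerivAt (fun t : ℝ => fderiv ℝ W (c + (t * τ) • w) (τ • w))
      (fderiv ℝ (fderiv ℝ W) (c + (t * τ) • w) (τ • w) (τ • w)) t := by
    intro t ht
    rw [uIcc_of_le zero_le_one] at ht
    have := ((hW1.contDiffAt (hB.mem_nhds (hw t ht))).differentiableAt (by simp)).hasFDerivAt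
    exact (ContinuousLinearMap.apply ℝ E (τ • w)).hasFDerivAt.comp_hasDerivAt t
      (this.comp_hasDerivAt t (hl t))
  have h2 : ∀ t ∈ uIcc (0 : ℝ) 1,
      HasDerivAt (fun t : ℝ => (1 - t) • fderiv ℝ W (c + (t * τ) • w) (τ • w)
        + W (c + (t * τ) • w))
      ((1 - t) • fderiv ℝ (fderiv ℝ W) (c + (t * τ) • w) (τ • w) (τ • w)) t := by
    intro t ht
    have := (((hasDerivAt_id t).const_sub 1).smul (h1 t ht)).add (h0 t ht)
    refine this.congr_deriv ?_
    simp
  have hint : IntervalIntegrable (fun t : ℝ =>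
      (1 - t) • fderiv ℝ (fderiv ℝ W) (c + (t * τ) • w) (τ • w) (τ • w))
      MeasureTheory.volume 0 1 := by
    apply ContinuousOn.intervalIntegrable
    rw [uIcc_of_le zero_le_one]
    have : ContinuousOn (fun t : ℝ => fderiv ℝ (fderiv ℝ W) (c + (t * τ) • w)) (Icc 0 1) :=
      hW2.continuousOn.comp (by fun_prop) hw
    fun_prop
  have h3 := intervalIntegral.integral_eq_sub_of_hasDerivAt h2 hint
  have h4 : ∀ t : ℝ, (1 - t) • fderiv ℝ (fderiv ℝ W) (c + (t * τ) • w) (τ • w) (τ • w)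
      = τ ^ 2 • ((1 - t) • fderiv ℝ (fderiv ℝ W) (c + (t * τ) • w) w w) := by
    intro t
    simp only [map_smul, smul_apply, smul_smul]
    congr 1
    ring
  simp only [h4] at h3
  rw [intervalIntegral.integral_smul] at h3
  rw [eulerRemainder, h3]
  simp
  abel

theorem continuousOn_eulerRemainder {W : E → E} {c : E} {B : Set E} (hB : IsOpen B)
    (hW : ContDiffOn ℝ ∞ W B) {w : E} (hw : ∀ t ∈ Icc (0 : ℝ) 1, c + t • w ∈ B) :
    ContinuousOn (fun τ => eulerRemainder W c τ w) (Icc 0 1) := by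
  have hW2 : ContDiffOn ℝ ∞ (fderiv ℝ (fderiv ℝ W)) B :=
    (hW.fderiv_of_isOpen hB le_rfl).fderiv_of_isOpen hB le_rfl
  have hO : IsOpen {q : ℝ × ℝ | c + (q.2 * q.1) • w ∈ B} :=
    hB.preimage (by fun_prop : Continuous fun q : ℝ × ℝ => c + (q.2 * q.1) • w)
  refine (contDiffOn_parametric_integral
    (f := fun q : ℝ × ℝ => (1 - q.2) • fderiv ℝ (fderiv ℝ W) (c + (q.2 * q.1) • w) w w) hO ?_
    ?_).continuousOn
  · have : ContDiffOn ℝ ∞ (fun q : ℝ × ℝ => fderiv ℝ (fderiv ℝ W) (c + (q.2 * q.1) • w))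
        {q : ℝ × ℝ | c + (q.2 * q.1) • w ∈ B} :=
      hW2.comp (by fun_prop) fun q hq => hq
    have h2 := (this.clm_apply (contDiffOn_const (c := w))).clm_apply (contDiffOn_const (c := w))
    exact (contDiff_const.sub contDiff_snd).contDiffOn.smul h2
  · intro τ hτ t ht
    exact hw _ ⟨mul_nonneg ht.1 hτ.1, mul_le_one₀ ht.2 hτ.1 hτ.2⟩

/-- For τ > 0, Taylor's formula reduces the claim to the mean value inequality for W - id on the
ball of radius τρ, where its derivative is at most Aτρ. The two factors τ cancel the τ² on the left.
The case τ = 0 follows by continuity, so no bound on third derivatives of W enters. -/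
theorem norm_eulerRemainder_sub_le {W : E → E} {c : E} {ρ A : ℝ} (hA : 0 ≤ A)
    (hW : ContDiffOn ℝ ∞ W (Metric.ball c ρ))
    (hWA : ∀ x ∈ Metric.ball c ρ, ‖fderiv ℝ W x - ContinuousLinearMap.id ℝ E‖ ≤ A * ‖x - c‖)
    {w w' : E} (hw : ‖w‖ < ρ) (hw' : ‖w'‖ < ρ) {τ : ℝ} (hτ : τ ∈ Icc (0 : ℝ) 1) :
    ‖eulerRemainder W c τ w - eulerRemainder W c τ w'‖ ≤ A * ρ * ‖w - w'‖ := by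
  have hρ : 0 < ρ := (norm_nonneg w).trans_lt hw
  have hmem : ∀ v : E, ‖v‖ < ρ → ∀ t ∈ Icc (0 : ℝ) 1, c + t • v ∈ Metric.ball c ρ := by
    intro v hv t ht
    rw [mem_ball_iff_norm, add_sub_cancel_left, norm_smul, Real.norm_of_nonneg ht.1]
    exact lt_of_le_of_lt (mul_le_of_le_one_left (norm_nonneg _) ht.2) hv
  have hc : fderiv ℝ W c = ContinuousLinearMap.id ℝ E := by
    have := hWA c (Metric.mem_ball_self hρ)
    rw [sub_self, norm_zero, mul_zero] at this
    exact sub_eq_zero.1 (norm_le_zero_iff.1 this)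
  have hpos : ∀ τ ∈ Ioc (0 : ℝ) 1,
      ‖eulerRemainder W c τ w - eulerRemainder W c τ w'‖ ≤ A * ρ * ‖w - w'‖ := by
    intro τ hτ
    have hm : ∀ v : E, ‖v‖ < ρ → ∀ t ∈ Icc (0 : ℝ) 1, c + (t * τ) • v ∈ Metric.ball c ρ :=
      fun v hv t ht => hmem v hv _ ⟨mul_nonneg ht.1 hτ.1.le, mul_le_one₀ ht.2 hτ.1.le hτ.2⟩
    have e1 := sq_smul_eulerRemainder Metric.isOpen_ball hW (hm w hw)
    have e2 := sq_smul_eulerRemainder Metric.isOpen_ball hW (hm w' hw')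
    have hsub : Metric.ball c (τ * ρ) ⊆ Metric.ball c ρ :=
      Metric.ball_subset_ball (mul_le_of_le_one_left hρ.le hτ.2)
    have hin : ∀ v : E, ‖v‖ < ρ → c + τ • v ∈ Metric.ball c (τ * ρ) := by
      intro v hv
      rw [mem_ball_iff_norm, add_sub_cancel_left, norm_smul, Real.norm_of_nonneg hτ.1.le]
      exact mul_lt_mul_of_pos_left hv hτ.1
    have := (convex_ball c (τ * ρ)).norm_image_sub_le_of_norm_fderiv_le' (𝕜 := ℝ) (f := W)
      (φ := ContinuousLinearMap.id ℝ E) (C := A * (τ * ρ)) (x := c + τ • w') (y := c + τ • w)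
      (fun x hx => (hW.contDiffAt (Metric.isOpen_ball.mem_nhds (hsub hx))).differentiableAt
        (by simp))
      (fun x hx => (hWA x (hsub hx)).trans
        (mul_le_mul_of_nonneg_left (mem_ball_iff_norm.1 hx).le hA)) (hin w' hw') (hin w hw)
    have e3 : τ ^ 2 • (eulerRemainder W c τ w - eulerRemainder W c τ w')
        = W (c + τ • w) - W (c + τ • w')
          - ContinuousLinearMap.id ℝ E (c + τ • w - (c + τ • w')) := by
      rw [smul_sub, e1, e2, hc]
      simp only [ContinuousLinearMap.id_apply]
      abel
    rw [← e3, norm_smul, add_sub_add_left_eq_sub, ← smul_sub, norm_smul, norm_pow,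
      Real.norm_of_nonneg hτ.1.le] at this
    have h2 : τ ^ 2 * ‖eulerRemainder W c τ w - eulerRemainder W c τ w'‖
        ≤ τ ^ 2 * (A * ρ * ‖w - w'‖) := by
      calc _ ≤ _ := this
        _ = _ := by ring
    exact le_of_mul_le_mul_left h2 (by have := hτ.1; positivity)
  have hcont := (continuousOn_eulerRemainder Metric.isOpen_ball hW (hmem w hw)).sub
    (continuousOn_eulerRemainder Metric.isOpen_ball hW (hmem w' hw'))
  have hcl : τ ∈ closure (Ioc (0 : ℝ) 1) := by
    rw [closure_Ioc zero_ne_one]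
    exact hτ
  have hcont' : ContinuousOn (fun τ => ‖eulerRemainder W c τ w - eulerRemainder W c τ w'‖)
      (closure (Ioc (0 : ℝ) 1)) := by
    rw [closure_Ioc zero_ne_one]
    exact hcont.norm
  exact ContinuousWithinAt.closure_le hcl ((hcont' τ hcl).mono subset_closure)
    continuousWithinAt_const hpos

/-- The quadratic remainder depends smoothly on all its arguments. -/
theorem contDiffOn_eulerRemainder {P : Type} [NormedAddCommGroup P] [NormedSpace ℝ P]
    {S : Set P} {B : Set E} (hS : IsOpen S) (hB : IsOpen B) {V : P × E → E}
    (hV : ContDiffOn ℝ ∞ V (S ×ˢ B)) {c : P → E} (hc : ContDiffOn ℝ ∞ c S)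
    {O : Set (P × ℝ × E)}
    (hO : ∀ q ∈ O, q.1 ∈ S ∧ ∀ t ∈ Icc (0 : ℝ) 1, c q.1 + (t * q.2.1) • q.2.2 ∈ B) :
    ContDiffOn ℝ ∞ (fun q : P × ℝ × E =>
      eulerRemainder (fun x => V (q.1, x)) (c q.1) q.2.1 q.2.2) O := by
  have hV2 := (hV.partial_fderiv (hS.prod hB)).partial_fderiv (hS.prod hB)
  let ℓ : (P × ℝ × E) × ℝ → E := fun q => c q.1.1 + (q.2 * q.1.2.1) • q.1.2.2
  have hS' : IsOpen {q : (P × ℝ × E) × ℝ | q.1.1 ∈ S} :=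
    hS.preimage (by fun_prop : Continuous fun q : (P × ℝ × E) × ℝ => q.1.1)
  have hℓ : ContDiffOn ℝ ∞ ℓ {q : (P × ℝ × E) × ℝ | q.1.1 ∈ S} := by
    refine (hc.comp (by fun_prop : ContDiffOn ℝ ∞ (fun q : (P × ℝ × E) × ℝ => q.1.1) _)
      fun q hq => hq).add ?_
    fun_prop
  have hU : IsOpen ({q : (P × ℝ × E) × ℝ | q.1.1 ∈ S} ∩ ℓ ⁻¹' B) :=
    hℓ.continuousOn.isOpen_inter_preimage hS' hB
  refine contDiffOn_parametric_integral (f := fun q : (P × ℝ × E) × ℝ =>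
    (1 - q.2) • fderiv ℝ (fderiv ℝ fun x => V (q.1.1, x)) (ℓ q) q.1.2.2 q.1.2.2) hU ?_ ?_
  · have h1 : ContDiffOn ℝ ∞ (fun q : (P × ℝ × E) × ℝ =>
        fderiv ℝ (fderiv ℝ fun x => V (q.1.1, x)) (ℓ q))
        ({q : (P × ℝ × E) × ℝ | q.1.1 ∈ S} ∩ ℓ ⁻¹' B) :=
      hV2.comp (f := fun q : (P × ℝ × E) × ℝ => (q.1.1, ℓ q))
        ((by fun_prop : ContDiffOn ℝ ∞ (fun q : (P × ℝ × E) × ℝ => q.1.1) _).prodMk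
          (hℓ.mono inter_subset_left)) fun q hq => ⟨hq.1, hq.2⟩
    have h2 : ContDiffOn ℝ ∞ (fun q : (P × ℝ × E) × ℝ => q.1.2.2)
        ({q : (P × ℝ × E) × ℝ | q.1.1 ∈ S} ∩ ℓ ⁻¹' B) := by fun_prop
    exact (contDiff_const.sub contDiff_snd).contDiffOn.smul ((h1.clm_apply h2).clm_apply h2)
  · intro q hq t ht
    exact ⟨(hO q hq).1, (hO q hq).2 t ht⟩

end Linearization

/-! ### The integral equation for the inverse of the linearizing coordinates. -/

section EulerFamilies

variable {P E : Type} [NormedAddCommGroup P] [NormedSpace ℝ P] [CompleteSpace P]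
  [NormedAddCommGroup E] [InnerProductSpace ℝ E] [CompleteSpace E]

/-- A smooth family of vector fields with a zero `c s` near `x₀` at which the linear part is the
identity, with quantitative control of the linear part on a ball. -/
structure IsEulerFamily (S : Set P) (V : P × E → E) (c : P → E) (x₀ : E) (r R A : ℝ) : Prop where
  isOpen : IsOpen S
  pos : 0 < r
  le_radius : 9 * r ≤ R
  nonneg : 0 ≤ A
  small : 32 * A * r ≤ 1
  smooth : ContDiffOn ℝ ∞ V (S ×ˢ Metric.ball x₀ R)
  smooth_zero : ContDiffOn ℝ ∞ c S
  norm_zero_sub_le : ∀ s ∈ S, ‖c s - x₀‖ ≤ r / 8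
  eq_zero : ∀ s ∈ S, V (s, c s) = 0
  norm_fderiv_sub_le : ∀ s ∈ S, ∀ x ∈ Metric.ball x₀ R,
    ‖fderiv ℝ (fun x => V (s, x)) x - ContinuousLinearMap.id ℝ E‖ ≤ A * ‖x - c s‖

/-- The integrand of the integral equation for the inverse of the linearizing coordinates. -/
def eulerIntegrand (V : P × E → E) (c : P → E) (q : P × ℝ × E) : E :=
  eulerRemainder (fun x => V (q.1, x)) (c q.1) q.2.1 q.2.2

/-- The graph `t ↦ (s, t, w t)`. -/
def graphCurve (q : P × C(unitInterval, E)) : C(unitInterval, P × ℝ × E) :=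
  ⟨fun t => (q.1, (t : ℝ), q.2 t), by fun_prop⟩

theorem contDiff_graphCurve :
    ContDiff ℝ ∞ (graphCurve : P × C(unitInterval, E) → C(unitInterval, P × ℝ × E)) := by
  let A : (P × C(unitInterval, E)) →L[ℝ] C(unitInterval, P × ℝ × E) :=
    LinearMap.mkContinuous
      { toFun := fun q => ⟨fun t => (q.1, 0, q.2 t), by fun_prop⟩
        map_add' := by intros; ext <;> simp
        map_smul' := by intros; ext <;> simp }
      1 (by
        intro q
        rw [ContinuousMap.norm_le _ (mul_nonneg zero_le_one (norm_nonneg q))]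
        intro t
        have := q.2.norm_coe_le_norm t
        have h2 := norm_fst_le q
        have h3 := norm_snd_le q
        simp only [LinearMap.coe_mk, AddHom.coe_mk, ContinuousMap.coe_mk, one_mul, norm_prod_le_iff,
          norm_zero]
        exact ⟨h2, norm_nonneg _, this.trans h3⟩)
  have : (graphCurve : P × C(unitInterval, E) → C(unitInterval, P × ℝ × E))
      = fun q => A q + graphCurve 0 := by
    funext q
    ext t <;> simp [graphCurve, A]
  rw [this]
  exact A.contDiff.add contDiff_const

/-- The right-hand side of the integral equation. -/
def picardOperator (V : P × E → E) (c : P → E) (q : P × C(unitInterval, E)) :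
    C(unitInterval, E) :=
  primitive E (superposition unitInterval (eulerIntegrand V c) (graphCurve q))

/-- The domain on which the integral equation is considered. -/
def picardDomain (E : Type) [NormedAddCommGroup E] (S : Set P) (r : ℝ) : Set (P × ℝ × E) :=
  S ×ˢ (Ioo (-2) 2 ×ˢ Metric.ball 0 (4 * r))

namespace IsEulerFamily

variable {S : Set P} {V : P × E → E} {c : P → E} {x₀ : E} {r R A : ℝ}

theorem isOpen_picardDomain (h : IsEulerFamily S V c x₀ r R A) :
    IsOpen (picardDomain E S r) :=
  h.isOpen.prod (isOpen_Ioo.prod Metric.isOpen_ball)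

theorem smooth_eulerIntegrand (h : IsEulerFamily S V c x₀ r R A) :
    ContDiffOn ℝ ∞ (eulerIntegrand V c) (picardDomain E S r) := by
  refine contDiffOn_eulerRemainder h.isOpen Metric.isOpen_ball h.smooth h.smooth_zero ?_
  rintro ⟨s, τ, w⟩ ⟨hs, hτ, hw⟩
  refine ⟨hs, fun t ht => ?_⟩
  simp only [mem_ball_zero_iff, mem_Ioo] at hw hτ
  rw [mem_ball_iff_norm]
  have h1 := h.norm_zero_sub_le s hs
  -- Here |τ| < 2 and ‖w‖ < 4r, so the argument of V stays within r/8 + 8r < 9r ≤ R of x₀. The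
  -- interval (-2, 2) only serves as an open neighbourhood of [0, 1].
  have h2 : ‖(t * τ) • w‖ ≤ 8 * r := by
    rw [norm_smul, norm_mul, Real.norm_of_nonneg ht.1]
    have : ‖τ‖ ≤ 2 := abs_le.2 ⟨hτ.1.le, hτ.2.le⟩
    have h4 : t * ‖τ‖ ≤ 2 := (mul_le_of_le_one_left (norm_nonneg _) ht.2).trans this
    calc t * ‖τ‖ * ‖w‖ ≤ 2 * (4 * r) := by
          apply mul_le_mul h4 hw.le (norm_nonneg _) (by norm_num)
      _ = _ := by ring
  have h3 := h.le_radius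
  have h4 := h.pos
  calc ‖c s + (t * τ) • w - x₀‖ = ‖(c s - x₀) + (t * τ) • w‖ := by congr 1; abel
    _ ≤ r / 8 + 8 * r := (norm_add_le _ _).trans (add_le_add h1 h2)
    _ < R := by linarith

theorem graphCurve_mem (_h : IsEulerFamily S V c x₀ r R A) {s : P} (hs : s ∈ S)
    {w : C(unitInterval, E)} (hw : ∀ t, ‖w t‖ < 4 * r) (t : unitInterval) :
    graphCurve (s, w) t ∈ picardDomain E S r :=
  ⟨hs, ⟨by show (-2 : ℝ) < (t : ℝ); linarith [t.2.1], by show (t : ℝ) < 2; linarith [t.2.2]⟩,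
    mem_ball_zero_iff.2 (hw t)⟩

theorem superposition_eulerIntegrand (h : IsEulerFamily S V c x₀ r R A) {s : P} (hs : s ∈ S)
    {w : C(unitInterval, E)} (hw : ∀ t, ‖w t‖ < 4 * r) (t : unitInterval) :
    superposition unitInterval (eulerIntegrand V c) (graphCurve (s, w)) t
      = eulerRemainder (fun x => V (s, x)) (c s) t (w t) :=
  superposition_apply h.smooth_eulerIntegrand.continuousOn (h.graphCurve_mem hs hw) t

/-- The Lipschitz constant A · 4r is at most 1/8 because 32Ar ≤ 1. -/
theorem norm_eulerRemainder_sub_le (h : IsEulerFamily S V c x₀ r R A) {s : P} (hs : s ∈ S)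
    {w w' : E} (hw : ‖w‖ < 4 * r) (hw' : ‖w'‖ < 4 * r) {τ : ℝ} (hτ : τ ∈ Icc (0 : ℝ) 1) :
    ‖eulerRemainder (fun x => V (s, x)) (c s) τ w - eulerRemainder (fun x => V (s, x)) (c s) τ w'‖
      ≤ 1 / 8 * ‖w - w'‖ := by
  have hsub : Metric.ball (c s) (4 * r) ⊆ Metric.ball x₀ R := by
    apply Metric.ball_subset_ball'
    rw [dist_eq_norm]
    linarith [h.norm_zero_sub_le s hs, h.le_radius, h.pos]
  refine (_root_.norm_eulerRemainder_sub_le h.nonneg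
    (h.smooth.slice fun x hx => ⟨hs, hsub hx⟩)
    (fun x hx => h.norm_fderiv_sub_le s hs x (hsub hx)) hw hw' hτ).trans ?_
  gcongr
  linarith [h.small]

theorem norm_picardOperator_sub_le (h : IsEulerFamily S V c x₀ r R A) {s : P} (hs : s ∈ S)
    {w w' : C(unitInterval, E)} (hw : ∀ t, ‖w t‖ < 4 * r) (hw' : ∀ t, ‖w' t‖ < 4 * r) :
    ‖picardOperator V c (s, w) - picardOperator V c (s, w')‖ ≤ 1 / 8 * ‖w - w'‖ := by
  rw [picardOperator, picardOperator, ← map_sub]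
  refine (norm_primitive_le _).trans ?_
  rw [ContinuousMap.norm_le _ (by positivity)]
  intro t
  rw [ContinuousMap.sub_apply, h.superposition_eulerIntegrand hs hw,
    h.superposition_eulerIntegrand hs hw']
  refine (h.norm_eulerRemainder_sub_le hs (hw t) (hw' t) t.2).trans ?_
  gcongr
  exact (w - w').norm_coe_le_norm t

theorem picardOperator_zero (h : IsEulerFamily S V c x₀ r R A) {s : P} (hs : s ∈ S) :
    picardOperator V c (s, 0) = 0 := by
  have : superposition unitInterval (eulerIntegrand V c) (graphCurve (s, 0)) = 0 := by
    ext t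
    rw [h.superposition_eulerIntegrand hs (by simpa using h.pos)]
    simp [eulerRemainder_zero_right]
  rw [picardOperator, this, map_zero]

/-- The map w ↦ w - `picardOperator` V c (s, w) is a 1/8-perturbation of the identity fixing 0.
Hence it takes on the closed ball of radius 3r every value of norm at most (7/8) · 3r, which exceeds
2r. -/
theorem exists_solution (h : IsEulerFamily S V c x₀ r R A) {s : P} (hs : s ∈ S) {z : E}
    (hz : ‖z‖ < 2 * r) :
    ∃ w : C(unitInterval, E), (∀ t, ‖w t‖ < 4 * r) ∧
      w - ContinuousMap.const _ z - picardOperator V c (s, w) = 0 := by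
  have hr := h.pos
  obtain ⟨w, hw, hw'⟩ := exists_eq_of_norm_sub_sub_le (X := C(unitInterval, E))
    (f := fun w => w - picardOperator V c (s, w)) (s := {w | ∀ t, ‖w t‖ < 4 * r})
    (c := 1 / 8) (ε := 3 * r) (b := 0) (y := ContinuousMap.const _ z) (by norm_num) (by linarith)
    (fun x hx y hy => by
      have := h.norm_picardOperator_sub_le hs hy hx
      rw [norm_sub_rev y x] at this
      refine le_trans (le_of_eq ?_) this
      congr 1
      abel)
    (fun w hw t => by
      rw [mem_closedBall_zero_iff] at hw
      exact ((w.norm_coe_le_norm t).trans hw).trans_lt (by linarith))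
    (by
      rw [h.picardOperator_zero hs, sub_zero, dist_zero_right,
        ContinuousMap.norm_le _ (by linarith)]
      intro t
      simp only [ContinuousMap.const_apply]
      linarith)
  refine ⟨w, fun t => ?_, ?_⟩
  · rw [mem_closedBall_zero_iff] at hw
    exact ((w.norm_coe_le_norm t).trans hw).trans_lt (by linarith)
  · rw [← hw']
    abel

/-- If d denotes the difference to be estimated, the contraction gives ‖d‖ ≤ (‖d‖ + ‖z - z'‖)/8,
whence the factor 1/7. This makes ψ a small perturbation of a translation. -/
theorem norm_solution_sub_le (h : IsEulerFamily S V c x₀ r R A) {s : P} (hs : s ∈ S) {z z' : E}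
    {w w' : C(unitInterval, E)} (hw : ∀ t, ‖w t‖ < 4 * r) (hw' : ∀ t, ‖w' t‖ < 4 * r)
    (e : w - ContinuousMap.const _ z - picardOperator V c (s, w) = 0)
    (e' : w' - ContinuousMap.const _ z' - picardOperator V c (s, w') = 0) :
    ‖(w - w') - ContinuousMap.const _ (z - z')‖ ≤ 1 / 7 * ‖z - z'‖ := by
  have h1 := h.norm_picardOperator_sub_le hs hw hw'
  have h2 : (w - w') - ContinuousMap.const _ (z - z')
      = picardOperator V c (s, w) - picardOperator V c (s, w') := by
    have h3 : (ContinuousMap.const unitInterval (z - z'))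
      = ContinuousMap.const _ z - ContinuousMap.const _ z' := rfl
    rw [h3, ← sub_eq_zero]
    calc _ = (w - ContinuousMap.const _ z - picardOperator V c (s, w))
        - (w' - ContinuousMap.const _ z' - picardOperator V c (s, w')) := by abel
      _ = 0 := by rw [e, e', sub_zero]
  rw [← h2] at h1
  have h4 : ‖w - w'‖ ≤ ‖(w - w') - ContinuousMap.const _ (z - z')‖ + ‖z - z'‖ := by
    calc ‖w - w'‖ = ‖((w - w') - ContinuousMap.const _ (z - z'))
          + ContinuousMap.const _ (z - z')‖ := by congr 1; abel
      _ ≤ _ := (norm_add_le _ _).trans (by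
        gcongr
        rw [ContinuousMap.norm_le _ (norm_nonneg _)]
        intro t
        simp)
  linarith

theorem solution_unique (h : IsEulerFamily S V c x₀ r R A) {s : P} (hs : s ∈ S) {z : E}
    {w w' : C(unitInterval, E)} (hw : ∀ t, ‖w t‖ < 4 * r) (hw' : ∀ t, ‖w' t‖ < 4 * r)
    (e : w - ContinuousMap.const _ z - picardOperator V c (s, w) = 0)
    (e' : w' - ContinuousMap.const _ z - picardOperator V c (s, w') = 0) : w = w' := by
  have h1 := h.norm_solution_sub_le hs hw hw' e e'
  rw [sub_self, norm_zero, mul_zero] at h1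
  have h2 := norm_le_zero_iff.1 h1
  have h3 : (ContinuousMap.const unitInterval (0 : E)) = 0 := rfl
  rw [h3, sub_zero] at h2
  exact sub_eq_zero.1 h2

/-- The solution of the integral equation depends smoothly on the parameter and the datum. -/
theorem exists_smooth_solution (h : IsEulerFamily S V c x₀ r R A) :
    ∃ w : P × E → C(unitInterval, E),
      ContDiffOn ℝ ∞ w (S ×ˢ Metric.ball 0 (2 * r)) ∧
      ∀ s ∈ S, ∀ z : E, ‖z‖ < 2 * r → (∀ t, ‖w (s, z) t‖ < 4 * r) ∧
        w (s, z) - ContinuousMap.const _ z - picardOperator V c (s, w (s, z)) = 0 := by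
  have hex : ∀ q : P × E, ∃ w : C(unitInterval, E), q.1 ∈ S → ‖q.2‖ < 2 * r →
      (∀ t, ‖w t‖ < 4 * r) ∧ w - ContinuousMap.const _ q.2 - picardOperator V c (q.1, w) = 0 := by
    intro q
    by_cases h1 : q.1 ∈ S ∧ ‖q.2‖ < 2 * r
    · obtain ⟨w, hw⟩ := h.exists_solution h1.1 h1.2
      exact ⟨w, fun _ _ => hw⟩
    · exact ⟨0, fun h2 h3 => absurd ⟨h2, h3⟩ h1⟩
  choose w hw using hex
  refine ⟨w, ?_, fun s hs z hz => hw (s, z) hs hz⟩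
  let cst : E →L[ℝ] C(unitInterval, E) :=
    LinearMap.mkContinuous
      { toFun := fun z => ContinuousMap.const _ z
        map_add' := by intros; ext; simp
        map_smul' := by intros; ext; simp }
      1 (by
        intro q
        rw [ContinuousMap.norm_le _ (mul_nonneg zero_le_one (norm_nonneg q))]
        intro t
        simp)
  have hU : IsOpen {u : C(unitInterval, E) | ∀ t, u t ∈ Metric.ball (0 : E) (4 * r)} :=
    isOpen_setOf_forall_mem Metric.isOpen_ball
  let O : Set ((P × E) × C(unitInterval, E)) :=
    (S ×ˢ Metric.ball 0 (2 * r)) ×ˢ {u | ∀ t, u t ∈ Metric.ball (0 : E) (4 * r)}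
  let F : (P × E) × C(unitInterval, E) → C(unitInterval, E) := fun q =>
    q.2 - cst q.1.2 - picardOperator V c (q.1.1, q.2)
  have hO : IsOpen O := (h.isOpen.prod Metric.isOpen_ball).prod hU
  have hF : ContDiffOn ℝ ∞ F O := by
    refine ContDiffOn.sub (ContDiff.contDiffOn (by fun_prop)) ?_
    refine (primitive E).contDiff.comp_contDiffOn ?_
    refine (contDiffOn_superposition h.isOpen_picardDomain h.smooth_eulerIntegrand).comp
      (f := fun q : (P × E) × C(unitInterval, E) => graphCurve (q.1.1, q.2))
      ((contDiff_graphCurve (P := P) (E := E)).comp (ContDiff.prodMk (by fun_prop) (by fun_prop) :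
        ContDiff ℝ ∞ fun q : (P × E) × C(unitInterval, E) => (q.1.1, q.2))).contDiffOn ?_
    intro q hq t
    exact h.graphCurve_mem hq.1.1 (fun t => mem_ball_zero_iff.1 (hq.2 t)) t
  refine contDiffOn_of_unique_solution (h.isOpen.prod Metric.isOpen_ball) hO hF ?_ ?_ ?_
  · rintro ⟨s, z⟩ ⟨hs, hz⟩
    have := hw (s, z) hs (mem_ball_zero_iff.1 hz)
    exact ⟨⟨⟨hs, hz⟩, fun t => mem_ball_zero_iff.2 (this.1 t)⟩, this.2⟩
  · rintro ⟨s, z⟩ ⟨hs, hz⟩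
    have hsol := hw (s, z) hs (mem_ball_zero_iff.1 hz)
    have hmem : ((s, z), w (s, z)) ∈ O := ⟨⟨hs, hz⟩, fun t => mem_ball_zero_iff.2 (hsol.1 t)⟩
    have hd : HasFDerivAt F (fderiv ℝ F ((s, z), w (s, z))) ((s, z), w (s, z)) :=
      ((hF.contDiffAt (hO.mem_nhds hmem)).differentiableAt (by simp)).hasFDerivAt
    set B := fderiv ℝ F ((s, z), w (s, z)) ∘L
      ContinuousLinearMap.inr ℝ (P × E) C(unitInterval, E) with hB
    -- The operator 1 - B is the derivative of a map with Lipschitz constant 1/8, so B is invertible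
    -- by the Neumann series.
    have hd2 : HasFDerivAt (fun u => u - F ((s, z), u)) (1 - B) (w (s, z)) :=
      (hasFDerivAt_id _).sub (hd.comp (w (s, z)) (hasFDerivAt_prodMk_right (s, z) (w (s, z))))
    have hlip : LipschitzOnWith (1 / 8) (fun u => u - F ((s, z), u))
        {u | ∀ t, u t ∈ Metric.ball (0 : E) (4 * r)} := by
      refine LipschitzOnWith.of_dist_le_mul fun u hu v hv => ?_
      have := h.norm_picardOperator_sub_le hs (fun t => mem_ball_zero_iff.1 (hu t))
        (fun t => mem_ball_zero_iff.1 (hv t))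
      rw [dist_eq_norm, dist_eq_norm]
      refine le_trans (le_of_eq ?_) (this.trans_eq (by simp))
      congr 1
      simp only [F]
      abel
    have hnorm := hd2.le_of_lipschitzOn (hU.mem_nhds hmem.2) hlip
    have hlt : ‖1 - B‖ < 1 := hnorm.trans_lt (by norm_num)
    have hunit : IsUnit B := by
      have := isUnit_one_sub_of_norm_lt_one
        (R := C(unitInterval, E) →L[ℝ] C(unitInterval, E)) hlt
      rwa [sub_sub_cancel] at this
    obtain ⟨b, hb⟩ := hunit
    exact ⟨ContinuousLinearEquiv.ofUnit b, hb⟩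
  · rintro ⟨s, z⟩ ⟨hs, hz⟩ u ⟨_, hu⟩ hFu
    have hsol := hw (s, z) hs (mem_ball_zero_iff.1 hz)
    exact h.solution_unique hs (fun t => mem_ball_zero_iff.1 (hu t)) hsol.1 hFu hsol.2

end IsEulerFamily

end EulerFamilies

/-! ### Linearization of the vector fields on a domain independent of the parameter. -/

section EulerLinearization

variable {P E : Type} [NormedAddCommGroup P] [NormedSpace ℝ P] [CompleteSpace P]
  [NormedAddCommGroup E] [InnerProductSpace ℝ E] [CompleteSpace E]

namespace IsEulerFamily

variable {S : Set P} {V : P × E → E} {c : P → E} {x₀ : E} {r R A : ℝ}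

/-- By homogeneity of the remainder, σ ↦ τ w(τσ) solves the equation with datum τz, and uniqueness
identifies it with w'. So the single curve w determines ψ on the whole segment from 0 to z. -/
theorem solution_smul (h : IsEulerFamily S V c x₀ r R A) {s : P} (hs : s ∈ S) {z : E}
    {w : C(unitInterval, E)} (hw : ∀ t, ‖w t‖ < 4 * r)
    (e : w - ContinuousMap.const _ z - picardOperator V c (s, w) = 0) (τ : unitInterval)
    {w' : C(unitInterval, E)} (hw' : ∀ t, ‖w' t‖ < 4 * r)
    (e' : w' - ContinuousMap.const _ ((τ : ℝ) • z) - picardOperator V c (s, w') = 0) :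
    w' 1 = (τ : ℝ) • w τ := by
  let u : C(unitInterval, E) := ⟨fun σ => (τ : ℝ) • w (τ * σ), by fun_prop⟩
  have hu : ∀ t, ‖u t‖ < 4 * r := by
    intro t
    simp only [u, ContinuousMap.coe_mk, norm_smul, Real.norm_of_nonneg τ.2.1]
    exact (mul_le_of_le_one_left (norm_nonneg _) τ.2.2).trans_lt (hw _)
  have hwv : ∀ t, w t = z + picardOperator V c (s, w) t := by
    intro t
    have := congrArg (fun f => f t) (sub_eq_zero.1 e)
    simp only [ContinuousMap.sub_apply, ContinuousMap.const_apply] at this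
    rw [← this]; abel
  let g : ℝ → E := IccExtend zero_le_one
    (superposition unitInterval (eulerIntegrand V c) (graphCurve (s, w)))
  have hg : ∀ t : unitInterval, superposition unitInterval (eulerIntegrand V c)
      (graphCurve (s, w)) t = g t := fun t => (IccExtend_val _ _ t).symm
  have hue : u - ContinuousMap.const _ ((τ : ℝ) • z) - picardOperator V c (s, u) = 0 := by
    ext σ
    have h1 : picardOperator V c (s, u) σ = ∫ η in (0 : ℝ)..σ, (τ : ℝ) ^ 2 • g (τ * η) := by
      refine primitive_apply (fun t => ?_) σ
      rw [h.superposition_eulerIntegrand hs hu]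
      simp only [u, ContinuousMap.coe_mk]
      rw [eulerRemainder_smul]
      congr 1
      have h2 : ((τ : ℝ) * t) = ((τ * t : unitInterval) : ℝ) := rfl
      rw [h2, ← hg, h.superposition_eulerIntegrand hs hw]
    have h3 : picardOperator V c (s, w) (τ * σ) = ∫ η in (0 : ℝ)..(τ * σ), g η :=
      primitive_apply hg (τ * σ)
    have h4 := intervalIntegral.smul_integral_comp_mul_left (a := 0) (b := (σ : ℝ)) g (τ : ℝ)
    simp only [ContinuousMap.sub_apply, ContinuousMap.const_apply, ContinuousMap.zero_apply]
    rw [h1]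
    simp only [u, ContinuousMap.coe_mk]
    rw [hwv, h3, intervalIntegral.integral_smul, pow_two, mul_smul, h4, mul_zero, smul_add]
    abel
  rw [h.solution_unique hs hw' hu e' hue]
  simp [u]

theorem ball_subset (h : IsEulerFamily S V c x₀ r R A) {s : P} (hs : s ∈ S) :
    Metric.ball (c s) (4 * r) ⊆ Metric.ball x₀ R := by
  apply Metric.ball_subset_ball'
  rw [dist_eq_norm]
  linarith [h.norm_zero_sub_le s hs, h.le_radius, h.pos]

/-- By `solution_smul` the curve τ ↦ ψ(τz) equals c + τw(τ). Its derivative at τ = 1 is w(1) + w'(1)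
= w(1) + Q(1, w(1)). Since V(c) = 0 and DV(c) = id, Taylor's formula identifies this with V(c +
w(1)). -/
theorem euler_identity (h : IsEulerFamily S V c x₀ r R A) {s : P} (hs : s ∈ S) {z : E}
    (hz : ‖z‖ < 2 * r) {w : E → C(unitInterval, E)}
    (hw : ∀ z : E, ‖z‖ < 2 * r → (∀ t, ‖w z t‖ < 4 * r) ∧
      w z - ContinuousMap.const _ z - picardOperator V c (s, w z) = 0)
    (hd : DifferentiableAt ℝ (fun z => c s + w z 1) z) :
    fderiv ℝ (fun z => c s + w z 1) z z = V (s, c s + w z 1) := by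
  have hwz := hw z hz
  let g : ℝ → E := IccExtend zero_le_one
    (superposition unitInterval (eulerIntegrand V c) (graphCurve (s, w z)))
  have hgc : Continuous g := (ContinuousMap.continuous _).Icc_extend'
  have hg : ∀ t : unitInterval, superposition unitInterval (eulerIntegrand V c)
      (graphCurve (s, w z)) t = g t := fun t => (IccExtend_val _ _ t).symm
  have hwv : ∀ t : unitInterval, w z t = z + ∫ η in (0 : ℝ)..t, g η := by
    intro t
    have := congrArg (fun f => f t) (sub_eq_zero.1 hwz.2)
    simp only [ContinuousMap.sub_apply, ContinuousMap.const_apply] at this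
    rw [← primitive_apply hg t]
    change w z t = z + picardOperator V c (s, w z) t
    rw [← this]; abel
  have h1 : HasDerivAt (fun τ : ℝ => c s + τ • (z + ∫ η in (0 : ℝ)..τ, g η))
      ((1 : ℝ) • g 1 + (1 : ℝ) • (z + ∫ η in (0 : ℝ)..1, g η)) 1 :=
    ((hasDerivAt_id (1 : ℝ)).smul ((intervalIntegral.integral_hasDerivAt_right
      (hgc.intervalIntegrable _ _) (hgc.stronglyMeasurableAtFilter _ _) hgc.continuousAt).const_add
        z)).const_add (c s)
  have h2 : HasDerivAt (fun τ : ℝ => c s + w (τ • z) 1)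
      (fderiv ℝ (fun z => c s + w z 1) z z) 1 := by
    have hl : HasDerivAt (fun τ : ℝ => τ • z) z 1 := by
      simpa using (hasDerivAt_id (1 : ℝ)).smul_const z
    have := hd.hasFDerivAt
    rw [← one_smul ℝ z] at this
    have h3 := this.comp_hasDerivAt (1 : ℝ) hl
    rw [one_smul] at h3
    exact h3
  have heq : ∀ τ ∈ Icc (0 : ℝ) 1, c s + w (τ • z) 1 = c s + τ • (z + ∫ η in (0 : ℝ)..τ, g η) := by
    intro τ hτ
    have hτz : ‖τ • z‖ < 2 * r := by
      rw [norm_smul, Real.norm_of_nonneg hτ.1]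
      exact (mul_le_of_le_one_left (norm_nonneg _) hτ.2).trans_lt hz
    have := h.solution_smul hs hwz.1 hwz.2 ⟨τ, hτ⟩ (hw _ hτz).1 (hw _ hτz).2
    rw [this, hwv]
  -- The two descriptions of the curve agree only on [0, 1], so their derivatives at the endpoint 1
  -- are compared within that interval.
  have h5 := (uniqueDiffOn_Icc zero_lt_one (1 : ℝ) (right_mem_Icc.2 zero_le_one)).eq_deriv _
    h2.hasDerivWithinAt (h1.hasDerivWithinAt.congr heq (heq 1 (right_mem_Icc.2 zero_le_one)))
  rw [h5, one_smul, one_smul]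
  have hw1 : z + ∫ η in (0 : ℝ)..1, g η = w z 1 := (hwv 1).symm
  have hg1 : g 1 = eulerRemainder (fun x => V (s, x)) (c s) 1 (w z 1) := by
    have := hg 1
    rw [h.superposition_eulerIntegrand hs hwz.1] at this
    exact this.symm
  have hB := h.ball_subset hs
  have hc : fderiv ℝ (fun x => V (s, x)) (c s) = ContinuousLinearMap.id ℝ E := by
    have := h.norm_fderiv_sub_le s hs (c s)
      (hB (Metric.mem_ball_self (by linarith [h.pos])))
    rw [sub_self, norm_zero, mul_zero] at this
    exact sub_eq_zero.1 (norm_le_zero_iff.1 this)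
  have h6 := sq_smul_eulerRemainder (W := fun x => V (s, x)) (c := c s) (τ := 1) (w := w z 1)
    Metric.isOpen_ball
    (h.smooth.slice fun x hx => ⟨hs, hB hx⟩) (fun t ht => by
      rw [mem_ball_iff_norm, add_sub_cancel_left, mul_one, norm_smul, Real.norm_of_nonneg ht.1]
      exact (mul_le_of_le_one_left (norm_nonneg _) ht.2).trans_lt (hwz.1 1))
  rw [one_pow, one_smul, one_smul, h.eq_zero s hs, sub_zero, hc] at h6
  rw [hw1, hg1, h6]
  simp

theorem norm_apply_sub_le (h : IsEulerFamily S V c x₀ r R A) {s : P} (hs : s ∈ S) {x : E}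
    (hx : ‖x - c s‖ < 4 * r) : ‖V (s, x) - (x - c s)‖ ≤ 1 / 8 * ‖x - c s‖ := by
  have hB := h.ball_subset hs
  have hr := h.pos
  have := (convex_ball (c s) (4 * r)).norm_image_sub_le_of_norm_fderiv_le' (𝕜 := ℝ)
    (f := fun x => V (s, x))
    (φ := ContinuousLinearMap.id ℝ E) (C := 1 / 8) (x := c s) (y := x)
    (fun x hx => ((h.smooth.slice fun x hx => ⟨hs, hB hx⟩).contDiffAt
      (Metric.isOpen_ball.mem_nhds hx)).differentiableAt (by simp))
    (fun x hx => by
      refine (h.norm_fderiv_sub_le s hs x (hB hx)).trans ?_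
      have h1 := (mem_ball_iff_norm.1 hx).le
      have := mul_le_mul_of_nonneg_left h1 h.nonneg
      linarith [h.small])
    (Metric.mem_ball_self (by linarith)) (mem_ball_iff_norm.2 hx)
  simpa [h.eq_zero s hs] using this

/-- An Euler-like family of vector fields can be linearized smoothly on a domain that does not
depend on the parameter. -/
theorem exists_linearization (h : IsEulerFamily S V c x₀ r R A) :
    ∃ ψ : P × E → E, ContDiffOn ℝ ∞ ψ (S ×ˢ Metric.ball 0 (2 * r)) ∧ ∀ s ∈ S,
      ψ (s, 0) = c s ∧
      (∀ z ∈ Metric.ball (0 : E) (2 * r), ∀ z' ∈ Metric.ball (0 : E) (2 * r),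
        ‖ψ (s, z) - ψ (s, z') - (z - z')‖ ≤ 1 / 7 * ‖z - z'‖) ∧
      (∀ z ∈ Metric.ball (0 : E) (2 * r),
        fderiv ℝ (fun z => ψ (s, z)) z z = V (s, ψ (s, z))) ∧
      StarConvex ℝ 0 {z ∈ Metric.ball (0 : E) (2 * r) | ψ (s, z) ∈ Metric.ball x₀ r} ∧
      ∀ x ∈ Metric.ball x₀ r, ∃ z ∈ Metric.ball (0 : E) (2 * r), ψ (s, z) = x := by
  obtain ⟨w, hws, hw⟩ := h.exists_smooth_solution
  have hr := h.pos
  let ψ : P × E → E := fun q => c q.1 + w q 1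
  have hψs : ContDiffOn ℝ ∞ ψ (S ×ˢ Metric.ball 0 (2 * r)) :=
    (h.smooth_zero.comp contDiff_fst.contDiffOn fun q hq => hq.1).add
      ((ContinuousMap.evalCLM (M := E) ℝ (1 : unitInterval)).contDiff.comp_contDiffOn hws)
  refine ⟨ψ, hψs, fun s hs => ?_⟩
  have hlip : ∀ z ∈ Metric.ball (0 : E) (2 * r), ∀ z' ∈ Metric.ball (0 : E) (2 * r),
        ‖ψ (s, z) - ψ (s, z') - (z - z')‖ ≤ 1 / 7 * ‖z - z'‖ := by
    intro z hz z' hz'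
    rw [mem_ball_zero_iff] at hz hz'
    obtain ⟨a, b⟩ := hw s hs z hz
    obtain ⟨a', b'⟩ := hw s hs z' hz'
    refine le_trans ?_ (h.norm_solution_sub_le hs a a' b b')
    refine le_trans (le_of_eq ?_) (ContinuousMap.norm_coe_le_norm _ (1 : unitInterval))
    simp [ψ]
  have h0 : ψ (s, 0) = c s := by
    have h00 : ‖(0 : E)‖ < 2 * r := by simpa using hr
    obtain ⟨a, b⟩ := hw s hs 0 h00
    have : w (s, 0) = 0 := h.solution_unique hs a (by simpa using hr) b (by
      rw [h.picardOperator_zero hs]; ext; simp)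
    simp [ψ, this]
  have hdiff : ∀ z ∈ Metric.ball (0 : E) (2 * r),
      DifferentiableAt ℝ (fun z => ψ (s, z)) z := fun z hz =>
    ((hψs.slice fun x hx => ⟨hs, hx⟩).contDiffAt
      (Metric.isOpen_ball.mem_nhds hz)).differentiableAt (by simp)
  have heul : ∀ z ∈ Metric.ball (0 : E) (2 * r),
        fderiv ℝ (fun z => ψ (s, z)) z z = V (s, ψ (s, z)) := fun z hz =>
    h.euler_identity hs (mem_ball_zero_iff.1 hz) (w := fun z => w (s, z)) (hw s hs) (hdiff z hz)
  refine ⟨h0, hlip, heul, ?_, ?_⟩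
  · rw [starConvex_zero_iff]
    rintro z ⟨hz, hψz⟩ a ha0 ha1
    have hball : ∀ t ∈ Icc (0 : ℝ) 1, t • z ∈ Metric.ball (0 : E) (2 * r) := fun t ht => by
      rw [mem_ball_zero_iff, norm_smul, Real.norm_of_nonneg ht.1] at *
      exact (mul_le_of_le_one_left (norm_nonneg _) ht.2).trans_lt hz
    refine ⟨hball a ⟨ha0, ha1⟩, ?_⟩
    -- The squared distance m of ψ(tz) from x₀ increases strictly wherever m ≥ r²/4. Followed
    -- backwards from t = 1 it therefore never exceeds max(m(1), r²/4) < r², so the whole segment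
    -- stays in the preimage of the ball.
    let m : ℝ → ℝ := fun t => ‖ψ (s, t • z) - x₀‖ ^ 2
    let m' : ℝ → ℝ := fun t =>
      2 * inner ℝ (ψ (s, t • z) - x₀) (fderiv ℝ (fun z => ψ (s, z)) (t • z) z)
    have hm : ∀ t ∈ Icc (0 : ℝ) 1, HasDerivAt m (m' t) t := by
      intro t ht
      have hl : HasDerivAt (fun τ : ℝ => τ • z) z t := by
        simpa using (hasDerivAt_id t).smul_const z
      exact (((hdiff _ (hball t ht)).hasFDerivAt.comp_hasDerivAt t hl).sub_const x₀).norm_sq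
    have hin : ∀ t ∈ Icc (0 : ℝ) 1, r ^ 2 / 4 ≤ m t → 0 < t ∧ 0 < m' t := by
      intro t ht hmt
      set x := ψ (s, t • z) with hx
      have hc := h.norm_zero_sub_le s hs
      have hxr : r / 2 ≤ ‖x - x₀‖ := by
        by_contra! hcon
        have : ‖x - x₀‖ ^ 2 < (r / 2) ^ 2 := by gcongr
        have h2 : m t = ‖x - x₀‖ ^ 2 := rfl
        nlinarith
      have ht0 : 0 < t := by
        rcases ht.1.eq_or_lt with h' | h'
        · exfalso
          rw [← h', zero_smul, h0] at hx
          rw [hx] at hxr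
          linarith
        · exact h'
      refine ⟨ht0, ?_⟩
      have hxc : ‖x - c s‖ < 4 * r := by
        have h1 := hlip _ (hball t ht) 0 (Metric.mem_ball_self (by linarith))
        rw [h0, sub_zero] at h1
        have h2 := mem_ball_zero_iff.1 (hball t ht)
        have h3 : ‖x - c s‖ ≤ ‖x - c s - t • z‖ + ‖t • z‖ := by
          simpa using norm_add_le (x - c s - t • z) (t • z)
        linarith
      have hV := h.norm_apply_sub_le hs hxc
      have he := heul _ (hball t ht)
      rw [map_smul] at he
      have h4 : inner ℝ (x - x₀) (V (s, x))
          = t * inner ℝ (x - x₀) (fderiv ℝ (fun z => ψ (s, z)) (t • z) z) := by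
        rw [← real_inner_smul_right, he]
      have h5 : 0 < inner ℝ (x - x₀) (V (s, x)) := by
        -- The error V(x) - (x - x₀) is at most r/8 + ‖x - c‖/8, hence at most ‖x - x₀‖/2 because r
        -- ≤ 2‖x - x₀‖. So V points away from x₀.
        have e1 : V (s, x) = (x - x₀) + ((x₀ - c s) + (V (s, x) - (x - c s))) := by abel
        have h6 : ‖x - c s‖ ≤ ‖x - x₀‖ + r / 8 := by
          calc ‖x - c s‖ = ‖(x - x₀) - (c s - x₀)‖ := by congr 1; abel
            _ ≤ _ := (norm_sub_le _ _).trans (by linarith)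
        have h7 : ‖(x₀ - c s) + (V (s, x) - (x - c s))‖ ≤ 1 / 2 * ‖x - x₀‖ := by
          refine (norm_add_le _ _).trans ?_
          rw [norm_sub_rev x₀]
          linarith
        have h8 := abs_real_inner_le_norm (x - x₀) ((x₀ - c s) + (V (s, x) - (x - c s)))
        have h9 := neg_abs_le (inner ℝ (x - x₀) ((x₀ - c s) + (V (s, x) - (x - c s))))
        rw [e1, inner_add_right, real_inner_self_eq_norm_sq]
        have h10 : 0 < ‖x - x₀‖ := by linarith
        nlinarith
      have h6 : 0 < inner ℝ (x - x₀) (fderiv ℝ (fun z => ψ (s, z)) (t • z) z) := by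
        rw [h4] at h5
        exact (mul_pos_iff_of_pos_left ht0).1 h5
      show 0 < 2 * _
      linarith
    have h1 : m 1 < r ^ 2 := by
      have := mem_ball_iff_norm.1 hψz
      simp only [m, one_smul]
      gcongr
    -- Reversed time 1 - t turns the increase of m into a comparison with a constant barrier.
    have key := image_le_of_deriv_right_lt_deriv_boundary (f := fun u => m (1 - u))
      (f' := fun u => -m' (1 - u)) (a := 0) (b := 1) (B := fun _ => max (m 1) (r ^ 2 / 4))
      (B' := fun _ => 0)
      (fun u hu => by
        have := (hm (1 - u) ⟨by linarith [hu.2], by linarith [hu.1]⟩).continuousAt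
        exact (this.comp (f := fun u : ℝ => 1 - u) (by fun_prop)).continuousWithinAt)
      (fun u hu => by
        have := (hm (1 - u) ⟨by linarith [hu.2], by linarith [hu.1]⟩)
        have h2 : HasDerivAt (fun u : ℝ => 1 - u) (-1) u := by
          simpa using (hasDerivAt_id u).const_sub 1
        have h3 := this.comp u h2
        simp only [mul_neg, mul_one] at h3
        exact h3.hasDerivWithinAt)
      (by simp) (fun u => hasDerivAt_const _ _)
      (fun u hu he => by
        have h2 := (hin (1 - u) ⟨by linarith [hu.2], by linarith [hu.1]⟩
          (by rw [he]; exact le_max_right _ _)).2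
        linarith)
    have h2 := key (x := 1 - a) ⟨by linarith, by linarith⟩
    simp only [sub_sub_cancel] at h2
    have h3 : m a < r ^ 2 := h2.trans_lt (max_lt h1 (by nlinarith))
    rw [mem_ball_iff_norm]
    exact lt_of_pow_lt_pow_left₀ 2 hr.le h3
  · intro x hx
    have hsub : Metric.closedBall (0 : E) (3 / 2 * r) ⊆ Metric.ball 0 (2 * r) :=
      Metric.closedBall_subset_ball (by linarith)
    -- The radius 3r/2 lies below 2r and suffices because (6/7)(3/2)r ≥ r + r/8.
    obtain ⟨z, hz, hzx⟩ := exists_eq_of_norm_sub_sub_le (f := fun z => ψ (s, z))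
      (c := 1 / 7) (ε := 3 / 2 * r) (b := 0) (y := x) (by norm_num) (by linarith) hlip hsub (by
        have hc := h.norm_zero_sub_le s hs
        have := mem_ball_iff_norm.1 hx
        simp only [h0]
        rw [dist_eq_norm]
        calc ‖x - c s‖ = ‖(x - x₀) - (c s - x₀)‖ := by congr 1; abel
            _ ≤ r + r / 8 := (norm_sub_le _ _).trans (by linarith)
            _ ≤ _ := by linarith)
    exact ⟨z, hsub hz, hzx⟩

end IsEulerFamily

end EulerLinearization

/-! ### The linearizing coordinates as inverses of ψ. -/

section LinearizingInverse

theorem ContinuousLinearMap.isInvertible_of_norm_sub_id_lt_one {E : Type*} [NormedAddCommGroup E]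
    [NormedSpace ℝ E] [CompleteSpace E] {B : E →L[ℝ] E}
    (h : ‖ContinuousLinearMap.id ℝ E - B‖ < 1) : B.IsInvertible := by
  have := isUnit_one_sub_of_norm_lt_one (R := E →L[ℝ] E) h
  change IsUnit (ContinuousLinearMap.id ℝ E - (ContinuousLinearMap.id ℝ E - B)) at this
  rw [sub_sub_cancel] at this
  obtain ⟨b, hb⟩ := this
  exact ⟨ContinuousLinearEquiv.ofUnit b, hb⟩

variable {P E : Type} [NormedAddCommGroup P] [NormedSpace ℝ P] [CompleteSpace P]
  [NormedAddCommGroup E] [InnerProductSpace ℝ E] [CompleteSpace E]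

/-- The data of linearizing coordinates for a family of vector fields on a fixed ball: the inverse
coordinates `ψ` and the coordinates `ζ`. -/
structure IsLinearization (S : Set P) (V : P × E → E) (x₀ : E) (r : ℝ) (ψ ζ : P × E → E) :
    Prop where
  isOpen : IsOpen S
  smooth : ContDiffOn ℝ ∞ ψ (S ×ˢ Metric.ball 0 (2 * r))
  smooth_inv : ContDiffOn ℝ ∞ ζ (S ×ˢ Metric.ball x₀ r)
  isInvertible : ∀ s ∈ S, ∀ z ∈ Metric.ball (0 : E) (2 * r),
    (fderiv ℝ (fun z => ψ (s, z)) z).IsInvertible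
  apply_zero_mem : ∀ s ∈ S, ψ (s, 0) ∈ Metric.ball x₀ r
  euler : ∀ s ∈ S, ∀ z ∈ Metric.ball (0 : E) (2 * r),
    fderiv ℝ (fun z => ψ (s, z)) z z = V (s, ψ (s, z))
  starConvex : ∀ s ∈ S,
    StarConvex ℝ 0 {z ∈ Metric.ball (0 : E) (2 * r) | ψ (s, z) ∈ Metric.ball x₀ r}
  inv_mem : ∀ s ∈ S, ∀ x ∈ Metric.ball x₀ r, ζ (s, x) ∈ Metric.ball (0 : E) (2 * r)
  apply_inv : ∀ s ∈ S, ∀ x ∈ Metric.ball x₀ r, ψ (s, ζ (s, x)) = x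
  inv_apply : ∀ s ∈ S, ∀ z ∈ Metric.ball (0 : E) (2 * r), ψ (s, z) ∈ Metric.ball x₀ r →
    ζ (s, ψ (s, z)) = z

theorem IsEulerFamily.exists_isLinearization {S : Set P} {V : P × E → E} {c : P → E} {x₀ : E}
    {r R A : ℝ} (h : IsEulerFamily S V c x₀ r R A) :
    ∃ ψ ζ : P × E → E, IsLinearization S V x₀ r ψ ζ := by
  obtain ⟨ψ, hψ, H⟩ := h.exists_linearization
  have hr := h.pos
  have hex : ∀ q : P × E, ∃ z : E, q.1 ∈ S → q.2 ∈ Metric.ball x₀ r →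
      z ∈ Metric.ball (0 : E) (2 * r) ∧ ψ (q.1, z) = q.2 := by
    intro q
    by_cases h1 : q.1 ∈ S ∧ q.2 ∈ Metric.ball x₀ r
    · obtain ⟨z, hz⟩ := (H q.1 h1.1).2.2.2.2 q.2 h1.2
      exact ⟨z, fun _ _ => hz⟩
    · exact ⟨0, fun h2 h3 => absurd ⟨h2, h3⟩ h1⟩
  choose ζ hζ using hex
  have hinj : ∀ s ∈ S, InjOn (fun z => ψ (s, z)) (Metric.ball (0 : E) (2 * r)) := by
    intro s hs z hz z' hz' he
    have := (H s hs).2.1 z hz z' hz'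
    simp only at he
    rw [he, sub_self, zero_sub, norm_neg] at this
    have h2 : ‖z - z'‖ ≤ 0 := by linarith [norm_nonneg (z - z')]
    exact sub_eq_zero.1 (norm_le_zero_iff.1 h2)
  have hinv : ∀ s ∈ S, ∀ z ∈ Metric.ball (0 : E) (2 * r),
      (fderiv ℝ (fun z => ψ (s, z)) z).IsInvertible := by
    intro s hs z hz
    have hd : DifferentiableAt ℝ (fun z => ψ (s, z)) z :=
      ((hψ.slice fun x hx => ⟨hs, hx⟩).contDiffAt
        (Metric.isOpen_ball.mem_nhds hz)).differentiableAt (by simp)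
    have hl : LipschitzOnWith (1 / 7) (fun z => z - ψ (s, z)) (Metric.ball (0 : E) (2 * r)) := by
      refine LipschitzOnWith.of_dist_le_mul fun z hz z' hz' => ?_
      rw [dist_eq_norm, dist_eq_norm]
      refine le_trans (le_of_eq ?_) (((H s hs).2.1 z hz z' hz').trans_eq (by simp))
      rw [← norm_neg]
      congr 1
      abel
    have := ((hasFDerivAt_id z).sub hd.hasFDerivAt).le_of_lipschitzOn
      (Metric.isOpen_ball.mem_nhds hz) hl
    exact ContinuousLinearMap.isInvertible_of_norm_sub_id_lt_one
      (this.trans_lt (by norm_num))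
  refine ⟨ψ, ζ, ⟨h.isOpen, hψ, ?_, hinv, ?_, fun s hs => (H s hs).2.2.1,
    fun s hs => (H s hs).2.2.2.1, fun s hs x hx => (hζ (s, x) hs hx).1,
    fun s hs x hx => (hζ (s, x) hs hx).2, fun s hs z hz hψz => ?_⟩⟩
  -- Smoothness of ζ jointly in s and x: it is the unique solution of ψ(s, ζ) = x, whose derivative
  -- in ζ is invertible.
  · have hO : IsOpen ((S ×ˢ (univ : Set E)) ×ˢ Metric.ball (0 : E) (2 * r)) :=
      (h.isOpen.prod isOpen_univ).prod Metric.isOpen_ball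
    have hF : ContDiffOn ℝ ∞ (fun q : (P × E) × E => ψ (q.1.1, q.2) - q.1.2)
        ((S ×ˢ (univ : Set E)) ×ˢ Metric.ball (0 : E) (2 * r)) := by
      refine ContDiffOn.sub ?_ (by fun_prop)
      exact hψ.comp (f := fun q : (P × E) × E => (q.1.1, q.2)) (by fun_prop)
        fun q hq => ⟨hq.1.1, hq.2⟩
    refine contDiffOn_of_unique_solution (h.isOpen.prod Metric.isOpen_ball) hO hF ?_ ?_ ?_
    · rintro ⟨s, x⟩ ⟨hs, hx⟩
      obtain ⟨h1, h2⟩ := hζ (s, x) hs hx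
      exact ⟨⟨⟨hs, mem_univ _⟩, h1⟩, sub_eq_zero.2 h2⟩
    · rintro ⟨s, x⟩ ⟨hs, hx⟩
      obtain ⟨h1, h2⟩ := hζ (s, x) hs hx
      have hm : ((s, x), ζ (s, x)) ∈ (S ×ˢ (univ : Set E)) ×ˢ Metric.ball (0 : E) (2 * r) :=
        ⟨⟨hs, mem_univ _⟩, h1⟩
      rw [← fderiv_partial_snd ((hF.contDiffAt (hO.mem_nhds hm)).differentiableAt (by simp))]
      simp only [fderiv_sub_const]
      exact hinv s hs _ h1
    · rintro ⟨s, x⟩ ⟨hs, hx⟩ z ⟨_, hz⟩ he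
      obtain ⟨h1, h2⟩ := hζ (s, x) hs hx
      exact hinj s hs hz h1 ((sub_eq_zero.1 he).trans h2.symm)
  · intro s hs
    rw [(H s hs).1, mem_ball_iff_norm]
    linarith [h.norm_zero_sub_le s hs]
  · obtain ⟨h1, h2⟩ := hζ (s, ψ (s, z)) hs hψz
    exact hinj s hs h1 hz h2

end LinearizingInverse

/-! ### The operator in linearizing coordinates. -/

section FlatOperators

theorem clm_integral_apply {E₁ G : Type*} [NormedAddCommGroup E₁] [NormedSpace ℝ E₁]
    [NormedAddCommGroup G] [NormedSpace ℝ G] [CompleteSpace G] {φ : ℝ → E₁ →L[ℝ] G}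
    (hφ : ContinuousOn φ (Icc 0 1)) (v : E₁) :
    (∫ t in (0 : ℝ)..1, φ t) v = ∫ t in (0 : ℝ)..1, φ t v := by
  have hi : IntervalIntegrable φ MeasureTheory.volume 0 1 := by
    apply ContinuousOn.intervalIntegrable
    rwa [uIcc_of_le zero_le_one]
  rw [ContinuousLinearMap.intervalIntegral_apply hi]

variable {n : ℕ}

/-- Contraction over the standard basis does not depend on the basis. -/
theorem sum_coord_basis_invariant {F : Type*} [AddCommGroup F] [Module ℝ F]
    (T : EuclideanSpace ℝ (Fin n) ≃L[ℝ] EuclideanSpace ℝ (Fin n))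
    (α : (EuclideanSpace ℝ (Fin n) →L[ℝ] ℝ) →ₗ[ℝ] EuclideanSpace ℝ (Fin n) →ₗ[ℝ] F) :
    ∑ i, α ((EuclideanSpace.proj i) ∘L (T.symm : _ →L[ℝ] _)) (T (EuclideanSpace.single i 1))
      = ∑ i, α (EuclideanSpace.proj i) (EuclideanSpace.single i 1) := by
  have hv : ∀ v : EuclideanSpace ℝ (Fin n), v = ∑ i, v i • EuclideanSpace.single i (1 : ℝ) := by
    intro v
    ext k
    simp [Finset.sum_apply, Pi.single_apply]
  have h1 : ∀ i : Fin n, ((EuclideanSpace.proj i : EuclideanSpace ℝ (Fin n) →L[ℝ] ℝ)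
        ∘L (T.symm : EuclideanSpace ℝ (Fin n) →L[ℝ] EuclideanSpace ℝ (Fin n)))
      = ∑ l, (T.symm (EuclideanSpace.single l 1)) i • EuclideanSpace.proj l := by
    intro i
    ext v
    conv_lhs => rw [hv v]
    simp [mul_comm]
  simp only [h1, map_sum, LinearMap.sum_apply, map_smul, LinearMap.smul_apply]
  rw [Finset.sum_comm]
  refine Finset.sum_congr rfl fun l _ => ?_
  have h2 := congrArg (fun v => α (EuclideanSpace.proj l) (T v))
    (hv (T.symm (EuclideanSpace.single l 1)))
  simp only [ContinuousLinearEquiv.apply_symm_apply, map_sum, map_smul] at h2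
  exact h2.symm

/-- Full contraction of a bilinear form on covectors with a bilinear form on vectors. -/
def contractForms {F : Type*} [AddCommGroup F] [Module ℝ F]
    (p : (EuclideanSpace ℝ (Fin n) →L[ℝ] ℝ) → (EuclideanSpace ℝ (Fin n) →L[ℝ] ℝ) → ℝ)
    (B : EuclideanSpace ℝ (Fin n) → EuclideanSpace ℝ (Fin n) → F) : F :=
  ∑ i, ∑ j, p (EuclideanSpace.proj i) (EuclideanSpace.proj j) •
    B (EuclideanSpace.single i 1) (EuclideanSpace.single j 1)

/-- Basis independence of a trace, applied to each of the two contracted indices. It reduces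
invariance of the operator to invariance of its coefficient forms. -/
theorem contractForms_comp {F : Type*} [NormedAddCommGroup F] [NormedSpace ℝ F]
    (T : EuclideanSpace ℝ (Fin n) ≃L[ℝ] EuclideanSpace ℝ (Fin n))
    (p : (EuclideanSpace ℝ (Fin n) →L[ℝ] ℝ) →ₗ[ℝ] (EuclideanSpace ℝ (Fin n) →L[ℝ] ℝ) →ₗ[ℝ] ℝ)
    (B : EuclideanSpace ℝ (Fin n) →L[ℝ] EuclideanSpace ℝ (Fin n) →L[ℝ] F) :
    contractForms (fun ξ η => p (ξ ∘L (T.symm : _ →L[ℝ] _)) (η ∘L (T.symm : _ →L[ℝ] _)))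
      (fun v w => B (T v) (T w)) = contractForms (fun ξ η => p ξ η) (fun v w => B v w) := by
  have h1 : ∀ (ξ : EuclideanSpace ℝ (Fin n) →L[ℝ] ℝ) (v : EuclideanSpace ℝ (Fin n)),
      ∑ j, p ξ ((EuclideanSpace.proj j) ∘L (T.symm : _ →L[ℝ] _)) •
        B v (T (EuclideanSpace.single j 1))
      = ∑ j, p ξ (EuclideanSpace.proj j) • B v (EuclideanSpace.single j 1) := fun ξ v =>
    sum_coord_basis_invariant T (LinearMap.mk₂ ℝ (fun η w => p ξ η • B v w)
      (by intros; simp [add_smul]) (by intros; simp [mul_smul]) (by intros; simp)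
      (by intro a η w; simp only [map_smul]; rw [smul_comm]))
  simp only [contractForms, h1]
  have := sum_coord_basis_invariant T (LinearMap.mk₂ ℝ (fun ξ v =>
      ∑ j, p ξ (EuclideanSpace.proj j) • B v (EuclideanSpace.single j 1))
      (by intros; simp [add_smul, Finset.sum_add_distrib])
      (by intros; simp [mul_smul, Finset.smul_sum])
      (by intros; simp [Finset.sum_add_distrib])
      (by
        intro a ξ v
        simp only [map_smul, smul_apply, Finset.smul_sum]
        exact Finset.sum_congr rfl fun j _ => smul_comm _ _ _))
  simpa using this

/-- The average `2 ∫ t H(tz) dt` of the Hessian along the ray to `z`. -/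
def hessianAverage
    (H : EuclideanSpace ℝ (Fin n) → EuclideanSpace ℝ (Fin n) →L[ℝ] EuclideanSpace ℝ (Fin n) →L[ℝ] ℝ)
    (z : EuclideanSpace ℝ (Fin n)) :
    EuclideanSpace ℝ (Fin n) →L[ℝ] EuclideanSpace ℝ (Fin n) →L[ℝ] ℝ :=
  ∫ t in (0 : ℝ)..1, (2 * t) • H (t • z)

/-- The principal part of the operator, as a bilinear form on covectors. -/
def principalForm
    (H : EuclideanSpace ℝ (Fin n) → EuclideanSpace ℝ (Fin n) →L[ℝ] EuclideanSpace ℝ (Fin n) →L[ℝ] ℝ)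
    (z : EuclideanSpace ℝ (Fin n)) :
    (EuclideanSpace ℝ (Fin n) →L[ℝ] ℝ) →ₗ[ℝ] (EuclideanSpace ℝ (Fin n) →L[ℝ] ℝ) →ₗ[ℝ] ℝ :=
  LinearMap.mk₂ ℝ (fun ξ η => hessianAverage H z ((H z).inverse ξ) ((H z).inverse η))
    (by intros; simp) (by intros; simp) (by intros; simp) (by intros; simp)

@[simp] theorem principalForm_apply
    (H : EuclideanSpace ℝ (Fin n) → EuclideanSpace ℝ (Fin n) →L[ℝ] EuclideanSpace ℝ (Fin n) →L[ℝ] ℝ)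
    (z : EuclideanSpace ℝ (Fin n)) (ξ η : EuclideanSpace ℝ (Fin n) →L[ℝ] ℝ) :
    principalForm H z ξ η = hessianAverage H z ((H z).inverse ξ) ((H z).inverse η) := rfl

/-- The amount by which the principal part applied to the phase misses the dimension. -/
def traceDefect (u : EuclideanSpace ℝ (Fin n) → ℝ)
    (H : EuclideanSpace ℝ (Fin n) → EuclideanSpace ℝ (Fin n) →L[ℝ] EuclideanSpace ℝ (Fin n) →L[ℝ] ℝ)
    (z : EuclideanSpace ℝ (Fin n)) : ℝ :=
  n - contractForms (fun ξ η => principalForm H z ξ η) (fun v w => fderiv ℝ (fderiv ℝ u) z v w)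

/-- The covector `∫ De(tz) dt` for the trace defect `e`. -/
def driftForm (u : EuclideanSpace ℝ (Fin n) → ℝ)
    (H : EuclideanSpace ℝ (Fin n) → EuclideanSpace ℝ (Fin n) →L[ℝ] EuclideanSpace ℝ (Fin n) →L[ℝ] ℝ)
    (z : EuclideanSpace ℝ (Fin n)) : EuclideanSpace ℝ (Fin n) →L[ℝ] ℝ :=
  ∫ t in (0 : ℝ)..1, fderiv ℝ (traceDefect u H) (t • z)

/-- The operator of the phase `u` and the covariant Hessian `H` in linearizing coordinates. -/
def flatBox {F : Type*} [NormedAddCommGroup F] [NormedSpace ℝ F]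
    (u : EuclideanSpace ℝ (Fin n) → ℝ)
    (H : EuclideanSpace ℝ (Fin n) → EuclideanSpace ℝ (Fin n) →L[ℝ] EuclideanSpace ℝ (Fin n) →L[ℝ] ℝ)
    (g : EuclideanSpace ℝ (Fin n) → F) (z : EuclideanSpace ℝ (Fin n)) : F :=
  contractForms (fun ξ η => principalForm H z ξ η) (fun v w => fderiv ℝ (fderiv ℝ g) z v w)
    + ∑ i, driftForm u H z ((H z).inverse (EuclideanSpace.proj i)) •
        fderiv ℝ g z (EuclideanSpace.single i 1)

section Smoothness

variable {P : Type} [NormedAddCommGroup P] [NormedSpace ℝ P]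

/-- A jointly smooth family of phases `u` and Hessians `H` on star-shaped domains. -/
structure IsSmoothFlatFamily (D : Set (P × EuclideanSpace ℝ (Fin n)))
    (u : P × EuclideanSpace ℝ (Fin n) → ℝ)
    (H : P × EuclideanSpace ℝ (Fin n) →
      EuclideanSpace ℝ (Fin n) →L[ℝ] EuclideanSpace ℝ (Fin n) →L[ℝ] ℝ) : Prop where
  isOpen : IsOpen D
  smul_mem : ∀ s z, (s, z) ∈ D → ∀ t ∈ Icc (0 : ℝ) 1, (s, t • z) ∈ D
  smooth_phase : ContDiffOn ℝ ∞ u D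
  smooth_hessian : ContDiffOn ℝ ∞ H D
  isInvertible : ∀ q ∈ D, (H q).IsInvertible

theorem ContDiffOn.ray_integral {F : Type} [NormedAddCommGroup F] [NormedSpace ℝ F]
    {D : Set (P × EuclideanSpace ℝ (Fin n))} (hD : IsOpen D)
    (hs : ∀ s z, (s, z) ∈ D → ∀ t ∈ Icc (0 : ℝ) 1, (s, t • z) ∈ D) {κ : ℝ → ℝ}
    (hκ : ContDiff ℝ ∞ κ) {f : P × EuclideanSpace ℝ (Fin n) → F} (hf : ContDiffOn ℝ ∞ f D) :
    ContDiffOn ℝ ∞ (fun q : P × EuclideanSpace ℝ (Fin n) =>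
      ∫ t in (0 : ℝ)..1, κ t • f (q.1, t • q.2)) D := by
  have hc : ContDiff ℝ ∞ (fun q : (P × EuclideanSpace ℝ (Fin n)) × ℝ => (q.1.1, q.2 • q.1.2)) := by
    fun_prop
  refine contDiffOn_parametric_integral (f := fun q : (P × EuclideanSpace ℝ (Fin n)) × ℝ =>
    κ q.2 • f (q.1.1, q.2 • q.1.2)) (hD.preimage hc.continuous) ?_ ?_
  · exact (hκ.comp contDiff_snd).contDiffOn.smul (hf.comp hc.contDiffOn fun q hq => hq)
  · exact fun q hq t ht => hs q.1 q.2 hq t ht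

namespace IsSmoothFlatFamily

variable {D : Set (P × EuclideanSpace ℝ (Fin n))}
  {u : P × EuclideanSpace ℝ (Fin n) → ℝ} {H : P × EuclideanSpace ℝ (Fin n) →
      EuclideanSpace ℝ (Fin n) →L[ℝ] EuclideanSpace ℝ (Fin n) →L[ℝ] ℝ}

theorem smooth_hessianAverage (h : IsSmoothFlatFamily D u H) :
    ContDiffOn ℝ ∞ (fun q : P × EuclideanSpace ℝ (Fin n) =>
      hessianAverage (fun z => H (q.1, z)) q.2) D :=
  ContDiffOn.ray_integral h.isOpen h.smul_mem (κ := fun t => 2 * t) (by fun_prop)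
    h.smooth_hessian

theorem smooth_inverse (h : IsSmoothFlatFamily D u H) :
    ContDiffOn ℝ ∞ (fun q => (H q).inverse) D := by
  intro q hq
  obtain ⟨e, he⟩ := h.isInvertible q hq
  have h1 : ContDiffAt ℝ ∞ ContinuousLinearMap.inverse (H q) := by
    rw [← he]; exact contDiffAt_map_inverse e
  exact (h1.comp q (h.smooth_hessian.contDiffAt (h.isOpen.mem_nhds hq))).contDiffWithinAt

theorem smooth_principalForm (h : IsSmoothFlatFamily D u H)
    (ξ η : EuclideanSpace ℝ (Fin n) →L[ℝ] ℝ) :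
    ContDiffOn ℝ ∞ (fun q : P × EuclideanSpace ℝ (Fin n) =>
      principalForm (fun z => H (q.1, z)) q.2 ξ η) D :=
  (h.smooth_hessianAverage.clm_apply (h.smooth_inverse.clm_apply contDiffOn_const)).clm_apply
    (h.smooth_inverse.clm_apply contDiffOn_const)

theorem smooth_traceDefect (h : IsSmoothFlatFamily D u H) :
    ContDiffOn ℝ ∞ (fun q : P × EuclideanSpace ℝ (Fin n) =>
      traceDefect (fun z => u (q.1, z)) (fun z => H (q.1, z)) q.2) D := by
  have h2 := (h.smooth_phase.partial_fderiv h.isOpen).partial_fderiv h.isOpen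
  refine contDiffOn_const.sub (ContDiffOn.sum fun i _ => ContDiffOn.sum fun j _ => ?_)
  exact (h.smooth_principalForm _ _).smul
    ((h2.clm_apply contDiffOn_const).clm_apply contDiffOn_const)

theorem smooth_driftForm (h : IsSmoothFlatFamily D u H) :
    ContDiffOn ℝ ∞ (fun q : P × EuclideanSpace ℝ (Fin n) =>
      driftForm (fun z => u (q.1, z)) (fun z => H (q.1, z)) q.2) D := by
  have := ContDiffOn.ray_integral h.isOpen h.smul_mem (κ := fun _ => 1) contDiff_const
    (h.smooth_traceDefect.partial_fderiv h.isOpen)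
  simpa [driftForm] using this

theorem smooth_driftCoeff (h : IsSmoothFlatFamily D u H) (ξ : EuclideanSpace ℝ (Fin n) →L[ℝ] ℝ) :
    ContDiffOn ℝ ∞ (fun q : P × EuclideanSpace ℝ (Fin n) =>
      driftForm (fun z => u (q.1, z)) (fun z => H (q.1, z)) q.2 ((H q).inverse ξ)) D :=
  h.smooth_driftForm.clm_apply (h.smooth_inverse.clm_apply contDiffOn_const)

end IsSmoothFlatFamily

end Smoothness

/-- A phase and a covariant Hessian in linearizing coordinates. -/
structure IsFlatModel (D : Set (EuclideanSpace ℝ (Fin n))) (u : EuclideanSpace ℝ (Fin n) → ℝ)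
    (H : EuclideanSpace ℝ (Fin n) →
      EuclideanSpace ℝ (Fin n) →L[ℝ] EuclideanSpace ℝ (Fin n) →L[ℝ] ℝ) : Prop where
  isOpen : IsOpen D
  zero_mem : (0 : EuclideanSpace ℝ (Fin n)) ∈ D
  starConvex : StarConvex ℝ 0 D
  smooth_phase : ContDiffOn ℝ ∞ u D
  smooth_hessian : ContDiffOn ℝ ∞ H D
  isInvertible : ∀ z ∈ D, (H z).IsInvertible
  euler : ∀ z ∈ D, H z z = fderiv ℝ u z

namespace IsFlatModel

variable {D D' : Set (EuclideanSpace ℝ (Fin n))} {u u' : EuclideanSpace ℝ (Fin n) → ℝ}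
  {H H' : EuclideanSpace ℝ (Fin n) →
      EuclideanSpace ℝ (Fin n) →L[ℝ] EuclideanSpace ℝ (Fin n) →L[ℝ] ℝ}

theorem smul_mem (h : IsFlatModel D u H) {z : EuclideanSpace ℝ (Fin n)} (hz : z ∈ D) {t : ℝ}
    (ht : t ∈ Icc (0 : ℝ) 1) : t • z ∈ D :=
  h.starConvex.smul_mem hz ht.1 ht.2

/-- A single model is a family constant in a dummy real parameter, so the smoothness results for
families apply to it. -/
theorem family (h : IsFlatModel D u H) : IsSmoothFlatFamily (P := ℝ) (univ ×ˢ D)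
    (fun q => u q.2) (fun q => H q.2) where
  isOpen := isOpen_univ.prod h.isOpen
  smul_mem := fun _ _ hz _ ht => ⟨mem_univ _, h.smul_mem hz.2 ht⟩
  smooth_phase := h.smooth_phase.comp contDiffOn_snd fun _ hq => hq.2
  smooth_hessian := h.smooth_hessian.comp contDiffOn_snd fun _ hq => hq.2
  isInvertible := fun q hq => h.isInvertible q.2 hq.2

theorem smooth_traceDefect (h : IsFlatModel D u H) : ContDiffOn ℝ ∞ (traceDefect u H) D :=
  h.family.smooth_traceDefect.slice (s := 0) fun _ hx => ⟨mem_univ _, hx⟩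

theorem hessianAverage_apply (h : IsFlatModel D u H) {z : EuclideanSpace ℝ (Fin n)} (hz : z ∈ D)
    (v w : EuclideanSpace ℝ (Fin n)) :
    hessianAverage H z v w = ∫ t in (0 : ℝ)..1, 2 * t * H (t • z) v w := by
  have hc : ContinuousOn (fun t : ℝ => H (t • z)) (Icc 0 1) :=
    h.smooth_hessian.continuousOn.comp (by fun_prop) fun t ht => h.smul_mem hz ht
  have h2 : ContinuousOn (fun t : ℝ => (2 * t) • H (t • z)) (Icc 0 1) :=
    ((by fun_prop : Continuous fun t : ℝ => 2 * t).continuousOn).smul hc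
  rw [hessianAverage, clm_integral_apply h2,
    clm_integral_apply (h2.clm_apply continuousOn_const)]
  rfl

theorem smul_ray_hasDerivAt {F : Type*} [NormedAddCommGroup F] [NormedSpace ℝ F]
    (h : IsFlatModel D u H) {f : EuclideanSpace ℝ (Fin n) → F}
    (hf : ContDiffOn ℝ ∞ f D) {z : EuclideanSpace ℝ (Fin n)} (hz : z ∈ D) {t : ℝ}
    (ht : t ∈ Icc (0 : ℝ) 1) :
    HasDerivAt (fun t : ℝ => f (t • z)) (fderiv ℝ f (t • z) z) t := by
  have hl : HasDerivAt (fun τ : ℝ => τ • z) z t := by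
    simpa using (hasDerivAt_id t).smul_const z
  exact ((hf.contDiffAt (h.isOpen.mem_nhds (h.smul_mem hz ht))).differentiableAt
    (by simp)).hasFDerivAt.comp_hasDerivAt t hl

/-- By the Euler relation H(tz)(tz) = Du(tz), the integrand 2t H(tz)(z,z) is the derivative of
2u(tz); this is the reason for the weight 2t. It becomes the eikonal equation a(du,du) = 2(u -
u(0)). -/
theorem hessianAverage_self (h : IsFlatModel D u H) {z : EuclideanSpace ℝ (Fin n)} (hz : z ∈ D) :
    hessianAverage H z z z = 2 * (u z - u 0) := by
  rw [h.hessianAverage_apply hz]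
  have hd : ∀ t ∈ uIcc (0 : ℝ) 1, HasDerivAt (fun t : ℝ => 2 * u (t • z))
      (2 * t * H (t • z) z z) t := by
    intro t ht
    rw [uIcc_of_le zero_le_one] at ht
    refine ((h.smul_ray_hasDerivAt h.smooth_phase hz ht).const_mul 2).congr_deriv ?_
    rw [← h.euler _ (h.smul_mem hz ht), map_smul, smul_apply, smul_eq_mul]
    ring
  have hc : ContinuousOn (fun t : ℝ => H (t • z)) (Icc 0 1) :=
    h.smooth_hessian.continuousOn.comp (by fun_prop) fun t ht => h.smul_mem hz ht
  rw [intervalIntegral.integral_eq_sub_of_hasDerivAt hd]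
  · simp; ring
  · apply ContinuousOn.intervalIntegrable
    rw [uIcc_of_le zero_le_one]
    exact ((by fun_prop : Continuous fun t : ℝ => 2 * t).continuousOn).mul
      ((hc.clm_apply continuousOn_const).clm_apply continuousOn_const)

/-- Differentiate Du(z) = H(z)z at 0, where the term containing DH is applied to z = 0. -/
theorem fderiv_fderiv_zero (h : IsFlatModel D u H) : fderiv ℝ (fderiv ℝ u) 0 = H 0 := by
  have h1 : fderiv ℝ u =ᶠ[𝓝 0] fun z => H z z := by
    filter_upwards [h.isOpen.mem_nhds h.zero_mem] with z hz
    exact (h.euler z hz).symm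
  rw [h1.fderiv_eq]
  have h2 : DifferentiableAt ℝ H 0 :=
    (h.smooth_hessian.contDiffAt (h.isOpen.mem_nhds h.zero_mem)).differentiableAt (by simp)
  have h3 := h2.hasFDerivAt.clm_apply (hasFDerivAt_id (0 : EuclideanSpace ℝ (Fin n)))
  refine HasFDerivAt.fderiv (h3.congr_fderiv ?_)
  ext v w
  simp

theorem contractForms_coord (B : EuclideanSpace ℝ (Fin n) →L[ℝ] EuclideanSpace ℝ (Fin n) →L[ℝ] ℝ)
    (hB : B.IsInvertible) :
    contractForms (fun ξ η => ξ (B.inverse η)) (fun v w => B v w) = (n : ℝ) := by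
  have hv : ∀ v : EuclideanSpace ℝ (Fin n), v = ∑ i, v i • EuclideanSpace.single i (1 : ℝ) := by
    intro v
    ext k
    simp [Finset.sum_apply, Pi.single_apply]
  rw [contractForms, Finset.sum_comm]
  have h1 : ∀ j : Fin n, ∑ i, (EuclideanSpace.proj i : EuclideanSpace ℝ (Fin n) →L[ℝ] ℝ)
      (B.inverse (EuclideanSpace.proj j)) • B (EuclideanSpace.single i 1)
        (EuclideanSpace.single j 1) = 1 := by
    intro j
    have h2 := congrArg (fun v => B v (EuclideanSpace.single j 1))
      (hv (B.inverse (EuclideanSpace.proj j)))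
    obtain ⟨e, rfl⟩ := hB
    simp only [map_sum, map_smul, sum_apply, smul_apply] at h2
    simp only [PiLp.proj_apply]
    rw [← h2]
    simp
  rw [Finset.sum_congr rfl fun j _ => h1 j]
  simp

theorem hessianAverage_zero (h : IsFlatModel D u H) : hessianAverage H 0 = H 0 := by
  ext v w
  rw [h.hessianAverage_apply h.zero_mem]
  simp only [smul_zero]
  rw [intervalIntegral.integral_mul_const, intervalIntegral.integral_const_mul, integral_id]
  simp

/-- At 0 the average, the covariant Hessian and D²u coincide, and contracting an invertible form
with its inverse gives n. -/
theorem traceDefect_zero (h : IsFlatModel D u H) : traceDefect u H 0 = 0 := by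
  have hB := h.isInvertible 0 h.zero_mem
  have h1 := contractForms_coord (H 0) hB
  rw [traceDefect, h.fderiv_fderiv_zero, sub_eq_zero, ← h1]
  simp only [contractForms, principalForm_apply, h.hessianAverage_zero]
  obtain ⟨e, he⟩ := hB
  simp [← he]

/-- The fundamental theorem of calculus along the ray, using that the defect vanishes at 0. Since
H⁻¹du = z, the drift applied to u restores exactly the defect. -/
theorem driftForm_self (h : IsFlatModel D u H) {z : EuclideanSpace ℝ (Fin n)} (hz : z ∈ D) :
    driftForm u H z z = traceDefect u H z := by
  have hs := h.smooth_traceDefect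
  have hc : ContinuousOn (fun t : ℝ => fderiv ℝ (traceDefect u H) (t • z)) (Icc 0 1) :=
    (hs.fderiv_of_isOpen h.isOpen le_rfl :
      ContDiffOn ℝ ∞ _ _).continuousOn.comp (by fun_prop) fun t ht => h.smul_mem hz ht
  have hi : IntervalIntegrable (fun t : ℝ => fderiv ℝ (traceDefect u H) (t • z))
      MeasureTheory.volume 0 1 := by
    apply ContinuousOn.intervalIntegrable
    rw [uIcc_of_le zero_le_one]
    exact hc
  have h1 := (ContinuousLinearMap.apply ℝ ℝ z).intervalIntegral_comp_comm hi
  simp only [ContinuousLinearMap.apply_apply] at h1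
  rw [driftForm, ← h1, intervalIntegral.integral_eq_sub_of_hasDerivAt
    (f := fun t : ℝ => traceDefect u H (t • z))]
  · simp [h.traceDefect_zero]
  · intro t ht
    rw [uIcc_of_le zero_le_one] at ht
    exact h.smul_ray_hasDerivAt hs hz ht
  · apply ContinuousOn.intervalIntegrable
    rw [uIcc_of_le zero_le_one]
    fun_prop

end IsFlatModel

end FlatOperators

/-! ### The Schrödinger equation and invariance under linear isomorphisms. -/

section FlatOperatorEquation

variable {n : ℕ}

theorem EuclideanSpace.eq_sum_single (v : EuclideanSpace ℝ (Fin n)) :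
    v = ∑ i, v i • EuclideanSpace.single i (1 : ℝ) := by
  ext k
  simp [Finset.sum_apply, Pi.single_apply]

theorem EuclideanSpace.covector_eq_sum_proj (ξ : EuclideanSpace ℝ (Fin n) →L[ℝ] ℝ) :
    ξ = ∑ i, ξ (EuclideanSpace.single i 1) • EuclideanSpace.proj i := by
  ext v
  conv_lhs => rw [EuclideanSpace.eq_sum_single v]
  simp [mul_comm]

theorem contractForms_self
    (p : (EuclideanSpace ℝ (Fin n) →L[ℝ] ℝ) →ₗ[ℝ] (EuclideanSpace ℝ (Fin n) →L[ℝ] ℝ) →ₗ[ℝ] ℝ)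
    (ξ η : EuclideanSpace ℝ (Fin n) →L[ℝ] ℝ) :
    contractForms (fun ξ η => p ξ η) (fun v w => ξ v * η w) = p ξ η := by
  conv_rhs => rw [EuclideanSpace.covector_eq_sum_proj ξ, EuclideanSpace.covector_eq_sum_proj η]
  simp only [contractForms, map_sum, map_smul, LinearMap.sum_apply, LinearMap.smul_apply,
    smul_eq_mul, Finset.mul_sum]
  rw [Finset.sum_comm]
  refine Finset.sum_congr rfl fun i _ => Finset.sum_congr rfl fun j _ => ?_
  ring

theorem contractForms_ofReal
    (p : (EuclideanSpace ℝ (Fin n) →L[ℝ] ℝ) → (EuclideanSpace ℝ (Fin n) →L[ℝ] ℝ) → ℝ)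
    (B : EuclideanSpace ℝ (Fin n) → EuclideanSpace ℝ (Fin n) → ℝ) (c : ℂ) :
    contractForms p (fun v w => c * (B v w : ℂ)) = c * (contractForms p B : ℝ) := by
  simp only [contractForms, Complex.ofReal_sum, Finset.mul_sum, Complex.real_smul, smul_eq_mul,
    Complex.ofReal_mul]
  refine Finset.sum_congr rfl fun i _ => Finset.sum_congr rfl fun j _ => ?_
  ring

theorem contractForms_add {F : Type*} [AddCommGroup F] [Module ℝ F]
    (p : (EuclideanSpace ℝ (Fin n) →L[ℝ] ℝ) → (EuclideanSpace ℝ (Fin n) →L[ℝ] ℝ) → ℝ)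
    (B B' : EuclideanSpace ℝ (Fin n) → EuclideanSpace ℝ (Fin n) → F) :
    contractForms p (fun v w => B v w + B' v w) = contractForms p B + contractForms p B' := by
  simp [contractForms, Finset.sum_add_distrib]

theorem hasFDerivAt_wave {u : EuclideanSpace ℝ (Fin n) → ℝ} {z : EuclideanSpace ℝ (Fin n)}
    (hu : DifferentiableAt ℝ u z) (A : ℂ) (κ c : ℝ) :
    HasFDerivAt (fun z => A * Complex.exp (Complex.I * ((κ * (u z - c) : ℝ) : ℂ)))
      ((Complex.I * κ * (A * Complex.exp (Complex.I * ((κ * (u z - c) : ℝ) : ℂ)))) •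
        (Complex.ofRealCLM ∘L fderiv ℝ u z)) z := by
  have h1 : HasFDerivAt (fun z => ((κ * (u z - c) : ℝ) : ℂ))
      (Complex.ofRealCLM ∘L (κ • fderiv ℝ u z)) z :=
    Complex.ofRealCLM.hasFDerivAt.comp z ((hu.hasFDerivAt.sub_const c).const_mul κ)
  have h2 := ((h1.const_mul Complex.I).cexp).const_mul A
  refine h2.congr_fderiv ?_
  ext v
  simp
  ring

theorem fderiv_fderiv_wave {u : EuclideanSpace ℝ (Fin n) → ℝ} {z : EuclideanSpace ℝ (Fin n)}
    (hu : ContDiffAt ℝ ∞ u z) (A : ℂ) (κ c : ℝ) (v w : EuclideanSpace ℝ (Fin n)) :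
    fderiv ℝ (fderiv ℝ fun z => A * Complex.exp (Complex.I * ((κ * (u z - c) : ℝ) : ℂ))) z v w
      = (Complex.I * κ * (A * Complex.exp (Complex.I * ((κ * (u z - c) : ℝ) : ℂ)))) *
        (fderiv ℝ (fderiv ℝ u) z v w : ℝ)
      + ((Complex.I * κ) ^ 2 * (A * Complex.exp (Complex.I * ((κ * (u z - c) : ℝ) : ℂ)))) *
        ((fderiv ℝ u z v * fderiv ℝ u z w : ℝ) : ℂ) := by
  set f : EuclideanSpace ℝ (Fin n) → ℂ :=
    fun z => A * Complex.exp (Complex.I * ((κ * (u z - c) : ℝ) : ℂ)) with hf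
  have hev : ∀ᶠ y in 𝓝 z, fderiv ℝ f y =
      (Complex.I * κ * f y) • (Complex.ofRealCLM ∘L fderiv ℝ u y) := by
    have h1 : ∀ᶠ y in 𝓝 z, ContDiffAt ℝ 1 u y :=
      (hu.of_le (by simp)).eventually (by simp)
    filter_upwards [h1] with y hy
    exact (hasFDerivAt_wave (hy.differentiableAt (by simp)) A κ c).fderiv
  have hd2 : DifferentiableAt ℝ (fderiv ℝ u) z :=
    (hu.fderiv_right (m := ∞) le_rfl).differentiableAt (by simp)
  have h1 := (hasFDerivAt_wave (hu.differentiableAt (by simp)) A κ c).const_mul (Complex.I * κ)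
  have h2 := (ContinuousLinearMap.compL ℝ (EuclideanSpace ℝ (Fin n)) ℝ ℂ
    Complex.ofRealCLM).hasFDerivAt.comp z hd2.hasFDerivAt
  have hd := (h1.smul h2).fderiv
  have hev' : fderiv ℝ f =ᶠ[𝓝 z] (fun y => (Complex.I * κ * f y) •
      ((ContinuousLinearMap.compL ℝ (EuclideanSpace ℝ (Fin n)) ℝ ℂ Complex.ofRealCLM) ∘
        fderiv ℝ u) y) := hev
  rw [hev'.fderiv_eq]
  erw [hd]
  simp
  ring

namespace IsFlatModel

variable {D D' : Set (EuclideanSpace ℝ (Fin n))} {u u' : EuclideanSpace ℝ (Fin n) → ℝ}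
  {H H' : EuclideanSpace ℝ (Fin n) →
      EuclideanSpace ℝ (Fin n) →L[ℝ] EuclideanSpace ℝ (Fin n) →L[ℝ] ℝ}

/-- In these coordinates the gradient field is the Euler field. -/
theorem inverse_fderiv (h : IsFlatModel D u H) {z : EuclideanSpace ℝ (Fin n)} (hz : z ∈ D) :
    (H z).inverse (fderiv ℝ u z) = z := by
  rw [← h.euler z hz]
  obtain ⟨e, he⟩ := h.isInvertible z hz
  simp [← he]

/-- On an exponential with frequency κ the operator acts as multiplication by iκ □u + (iκ)²
a(du,du). The second-order part contributes n - e to □u and the drift contributes e, while a(du,du)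
= 2(u - u(0)). -/
theorem flatBox_wave (h : IsFlatModel D u H) {z : EuclideanSpace ℝ (Fin n)} (hz : z ∈ D)
    (A : ℂ) (κ : ℝ) :
    flatBox u H (fun z => A * Complex.exp (Complex.I * ((κ * (u z - u 0) : ℝ) : ℂ))) z
      = (Complex.I * κ * n + (Complex.I * κ) ^ 2 * (2 * (u z - u 0))) *
        (A * Complex.exp (Complex.I * ((κ * (u z - u 0) : ℝ) : ℂ))) := by
  have hu := h.smooth_phase.contDiffAt (h.isOpen.mem_nhds hz)
  have hp : principalForm H z (fderiv ℝ u z) (fderiv ℝ u z) = 2 * (u z - u 0) := by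
    rw [principalForm_apply, h.inverse_fderiv hz, h.hessianAverage_self hz]
  have hd : ∑ i, driftForm u H z ((H z).inverse (EuclideanSpace.proj i)) *
      fderiv ℝ u z (EuclideanSpace.single i 1) = traceDefect u H z := by
    have hξ : ∀ ξ : EuclideanSpace ℝ (Fin n) →L[ℝ] ℝ,
        ∑ i, driftForm u H z ((H z).inverse (EuclideanSpace.proj i)) *
          ξ (EuclideanSpace.single i 1) = driftForm u H z ((H z).inverse ξ) := by
      intro ξ
      conv_rhs => rw [EuclideanSpace.covector_eq_sum_proj ξ]
      simp [map_sum, mul_comm]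
    rw [hξ, h.inverse_fderiv hz, h.driftForm_self hz]
  simp only [flatBox, fderiv_fderiv_wave hu]
  rw [contractForms_add, contractForms_ofReal, contractForms_ofReal, contractForms_self, hp,
    (hasFDerivAt_wave (hu.differentiableAt (by simp)) A κ (u 0)).fderiv]
  have ht : contractForms (fun ξ η => principalForm H z ξ η)
      (fun v w => fderiv ℝ (fderiv ℝ u) z v w) = n - traceDefect u H z := by
    rw [traceDefect]; ring
  rw [ht, ← hd]
  simp only [smul_apply, ContinuousLinearMap.comp_apply, Complex.ofRealCLM_apply,
    smul_eq_mul, Complex.real_smul]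
  push_cast
  have h3 : ∀ X : ℂ, ∑ i, (driftForm u H z ((H z).inverse (EuclideanSpace.proj i)) : ℂ) *
      (X * (fderiv ℝ u z (EuclideanSpace.single i 1) : ℂ))
      = X * ∑ i, (driftForm u H z ((H z).inverse (EuclideanSpace.proj i)) : ℂ) *
      (fderiv ℝ u z (EuclideanSpace.single i 1) : ℂ) := by
    intro X
    rw [Finset.mul_sum]
    exact Finset.sum_congr rfl fun i _ => by ring
  rw [h3]
  ring

/-- With κ = 1/t both sides are the wave multiplied by -n/(2t) - i(u - u(0))/t². -/
theorem hasDerivAt_wave (h : IsFlatModel D u H) {z : EuclideanSpace ℝ (Fin n)} (hz : z ∈ D)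
    {t : ℝ} (ht : 0 < t) :
    HasDerivAt (fun τ : ℝ => ((τ ^ (-(n : ℝ) / 2) : ℝ) : ℂ) *
        Complex.exp (Complex.I * ((τ⁻¹ * (u z - u 0) : ℝ) : ℂ)))
      (Complex.I / 2 * flatBox u H (fun z => ((t ^ (-(n : ℝ) / 2) : ℝ) : ℂ) *
        Complex.exp (Complex.I * ((t⁻¹ * (u z - u 0) : ℝ) : ℂ))) z) t := by
  rw [h.flatBox_wave hz]
  have h1 : HasDerivAt (fun τ : ℝ => ((τ ^ (-(n : ℝ) / 2) : ℝ) : ℂ))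
      ((-(n : ℝ) / 2 * t ^ (-(n : ℝ) / 2 - 1) : ℝ) : ℂ) t :=
    (Real.hasDerivAt_rpow_const (Or.inl ht.ne')).ofReal_comp
  have h2 : HasDerivAt (fun τ : ℝ => ((τ⁻¹ * (u z - u 0) : ℝ) : ℂ))
      ((-(t ^ 2)⁻¹ * (u z - u 0) : ℝ) : ℂ) t :=
    ((hasDerivAt_inv ht.ne').mul_const (u z - u 0)).ofReal_comp
  refine (h1.mul ((h2.const_mul Complex.I).cexp)).congr_deriv ?_
  have h3 : t ^ (-(n : ℝ) / 2 - 1) = t ^ (-(n : ℝ) / 2) * t⁻¹ := by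
    rw [Real.rpow_sub ht, Real.rpow_one, div_eq_mul_inv]
  rw [h3]
  generalize t ^ (-(n : ℝ) / 2) = X
  have htc : (t : ℂ) ≠ 0 := by exact_mod_cast ht.ne'
  push_cast
  field_simp
  linear_combination (X : ℂ) *
    (-n * t - 2 * Complex.I * (↑(u z) - ↑(u 0))) * Complex.I_sq

end IsFlatModel

/-- A linear isomorphism carrying one flat model to another. -/
structure IsFlatMorphism (D : Set (EuclideanSpace ℝ (Fin n)))
    (u : EuclideanSpace ℝ (Fin n) → ℝ)
    (H : EuclideanSpace ℝ (Fin n) → EuclideanSpace ℝ (Fin n) →L[ℝ] EuclideanSpace ℝ (Fin n) →L[ℝ] ℝ)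
    (D' : Set (EuclideanSpace ℝ (Fin n))) (u' : EuclideanSpace ℝ (Fin n) → ℝ)
    (H' : EuclideanSpace ℝ (Fin n) →
      EuclideanSpace ℝ (Fin n) →L[ℝ] EuclideanSpace ℝ (Fin n) →L[ℝ] ℝ)
    (T : EuclideanSpace ℝ (Fin n) ≃L[ℝ] EuclideanSpace ℝ (Fin n)) : Prop where
  mapsTo : MapsTo T D D'
  phase : ∀ z ∈ D, u' (T z) = u z
  hessian : ∀ z ∈ D, ∀ v w, H' (T z) (T v) (T w) = H z v w

theorem fderiv_fderiv_comp_linearEquiv {F : Type*} [NormedAddCommGroup F] [NormedSpace ℝ F]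
    (T : EuclideanSpace ℝ (Fin n) ≃L[ℝ] EuclideanSpace ℝ (Fin n))
    {g : EuclideanSpace ℝ (Fin n) → F} {z : EuclideanSpace ℝ (Fin n)}
    (hg : ContDiffAt ℝ ∞ g (T z)) (v w : EuclideanSpace ℝ (Fin n)) :
    fderiv ℝ (fderiv ℝ (g ∘ T)) z v w = fderiv ℝ (fderiv ℝ g) (T z) (T v) (T w) := by
  have h1 : fderiv ℝ (g ∘ T) = fun y => (fderiv ℝ g (T y)) ∘L
      (T : EuclideanSpace ℝ (Fin n) →L[ℝ] EuclideanSpace ℝ (Fin n)) := by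
    funext y
    exact T.comp_right_fderiv
  have hd2 : DifferentiableAt ℝ (fderiv ℝ g) (T z) :=
    (hg.fderiv_right (m := ∞) le_rfl).differentiableAt (by simp)
  have h2 := ((ContinuousLinearMap.compL ℝ (EuclideanSpace ℝ (Fin n)) (EuclideanSpace ℝ (Fin n))
    F).flip (T : _ →L[ℝ] _)).hasFDerivAt.comp z (hd2.hasFDerivAt.comp z T.hasFDerivAt)
  rw [h1]
  have h3 : fderiv ℝ (fun y => (fderiv ℝ g (T y)) ∘L
      (T : EuclideanSpace ℝ (Fin n) →L[ℝ] EuclideanSpace ℝ (Fin n))) z = _ := h2.fderiv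
  rw [h3]
  simp

namespace IsFlatMorphism

variable {D D' : Set (EuclideanSpace ℝ (Fin n))} {u u' : EuclideanSpace ℝ (Fin n) → ℝ}
  {H H' : EuclideanSpace ℝ (Fin n) →
      EuclideanSpace ℝ (Fin n) →L[ℝ] EuclideanSpace ℝ (Fin n) →L[ℝ] ℝ}
  {T : EuclideanSpace ℝ (Fin n) ≃L[ℝ] EuclideanSpace ℝ (Fin n)}

theorem inverse_eq (hT : IsFlatMorphism D u H D' u' H' T) (h : IsFlatModel D u H)
    (h' : IsFlatModel D' u' H') {z : EuclideanSpace ℝ (Fin n)} (hz : z ∈ D)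
    (ξ : EuclideanSpace ℝ (Fin n) →L[ℝ] ℝ) :
    (H' (T z)).inverse (ξ ∘L (T.symm : _ →L[ℝ] _)) = T ((H z).inverse ξ) := by
  obtain ⟨e, he⟩ := h.isInvertible z hz
  obtain ⟨e', he'⟩ := h'.isInvertible (T z) (hT.mapsTo hz)
  have hH := hT.hessian z hz
  rw [← he, ← he'] at hH ⊢
  simp only [ContinuousLinearMap.inverse_equiv, ContinuousLinearEquiv.coe_coe] at hH ⊢
  rw [ContinuousLinearEquiv.symm_apply_eq]
  ext w
  have := hH (e.symm ξ) (T.symm w)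
  simpa using this.symm

theorem hessianAverage_eq (hT : IsFlatMorphism D u H D' u' H' T) (h : IsFlatModel D u H)
    (h' : IsFlatModel D' u' H') {z : EuclideanSpace ℝ (Fin n)} (hz : z ∈ D)
    (v w : EuclideanSpace ℝ (Fin n)) :
    hessianAverage H' (T z) (T v) (T w) = hessianAverage H z v w := by
  rw [h.hessianAverage_apply hz, h'.hessianAverage_apply (hT.mapsTo hz)]
  refine intervalIntegral.integral_congr fun t ht => ?_
  rw [uIcc_of_le zero_le_one] at ht
  rw [← hT.hessian _ (h.smul_mem hz ht), map_smul]

theorem contractForms_eq (hT : IsFlatMorphism D u H D' u' H' T) (h : IsFlatModel D u H)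
    (h' : IsFlatModel D' u' H') {z : EuclideanSpace ℝ (Fin n)} (hz : z ∈ D)
    {F : Type*} [NormedAddCommGroup F] [NormedSpace ℝ F]
    (B : EuclideanSpace ℝ (Fin n) →L[ℝ] EuclideanSpace ℝ (Fin n) →L[ℝ] F) :
    contractForms (fun ξ η => principalForm H z ξ η) (fun v w => B (T v) (T w))
      = contractForms (fun ξ η => principalForm H' (T z) ξ η) (fun v w => B v w) := by
  rw [← contractForms_comp T (principalForm H' (T z)) B]
  congr 1
  funext ξ η
  simp only [principalForm_apply]
  rw [hT.inverse_eq h h' hz, hT.inverse_eq h h' hz, hT.hessianAverage_eq h h' hz]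

/-- The plain second derivative of u transforms as a tensor because T is linear; under a nonlinear
change of coordinates a term with D²T would appear. -/
theorem traceDefect_eq (hT : IsFlatMorphism D u H D' u' H' T) (h : IsFlatModel D u H)
    (h' : IsFlatModel D' u' H') {z : EuclideanSpace ℝ (Fin n)} (hz : z ∈ D) :
    traceDefect u H z = traceDefect u' H' (T z) := by
  have hev : u =ᶠ[𝓝 z] u' ∘ T := by
    filter_upwards [h.isOpen.mem_nhds hz] with y hy
    exact (hT.phase y hy).symm
  rw [traceDefect, traceDefect, ← hT.contractForms_eq h h' hz, hev.fderiv.fderiv_eq]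
  simp only [fderiv_fderiv_comp_linearEquiv T
    (h'.smooth_phase.contDiffAt (h'.isOpen.mem_nhds (hT.mapsTo hz)))]

theorem driftForm_eq (hT : IsFlatMorphism D u H D' u' H' T) (h : IsFlatModel D u H)
    (h' : IsFlatModel D' u' H') {z : EuclideanSpace ℝ (Fin n)} (hz : z ∈ D)
    (v : EuclideanSpace ℝ (Fin n)) :
    driftForm u' H' (T z) (T v) = driftForm u H z v := by
  have hc : ContinuousOn (fun t : ℝ => fderiv ℝ (traceDefect u H) (t • z)) (Icc 0 1) :=
    (h.smooth_traceDefect.fderiv_of_isOpen h.isOpen le_rfl :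
      ContDiffOn ℝ ∞ _ _).continuousOn.comp (by fun_prop) fun t ht => h.smul_mem hz ht
  have hc' : ContinuousOn (fun t : ℝ => fderiv ℝ (traceDefect u' H') (t • T z)) (Icc 0 1) :=
    (h'.smooth_traceDefect.fderiv_of_isOpen h'.isOpen le_rfl :
      ContDiffOn ℝ ∞ _ _).continuousOn.comp (by fun_prop)
        fun t ht => h'.smul_mem (hT.mapsTo hz) ht
  rw [driftForm, driftForm, clm_integral_apply hc, clm_integral_apply hc']
  refine intervalIntegral.integral_congr fun t ht => ?_
  rw [uIcc_of_le zero_le_one] at ht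
  have hev : traceDefect u H =ᶠ[𝓝 (t • z)] traceDefect u' H' ∘ T := by
    filter_upwards [h.isOpen.mem_nhds (h.smul_mem hz ht)] with y hy
    exact hT.traceDefect_eq h h' hy
  rw [hev.fderiv_eq, T.comp_right_fderiv, map_smul]
  rfl

/-- The flat operator is invariant under linear isomorphisms. -/
theorem flatBox_eq (hT : IsFlatMorphism D u H D' u' H' T) (h : IsFlatModel D u H)
    (h' : IsFlatModel D' u' H') {z : EuclideanSpace ℝ (Fin n)} (hz : z ∈ D)
    {F : Type*} [NormedAddCommGroup F] [NormedSpace ℝ F] {g g' : EuclideanSpace ℝ (Fin n) → F}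
    (hg' : ContDiffAt ℝ ∞ g' (T z)) (hg : g =ᶠ[𝓝 z] g' ∘ T) :
    flatBox u H g z = flatBox u' H' g' (T z) := by
  rw [flatBox, flatBox, ← hT.contractForms_eq h h' hz, hg.fderiv.fderiv_eq, hg.fderiv_eq,
    T.comp_right_fderiv]
  simp only [fderiv_fderiv_comp_linearEquiv T hg']
  congr 1
  have := sum_coord_basis_invariant T (LinearMap.mk₂ ℝ (fun ξ v =>
      driftForm u' H' (T z) ((H' (T z)).inverse ξ) • fderiv ℝ g' (T z) v)
      (by intros; simp [add_smul]) (by intros; simp [mul_smul]) (by intros; simp)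
      (by intro a ξ v; simp only [map_smul]; rw [smul_comm]))
  simp only [LinearMap.mk₂_apply] at this
  rw [← this]
  refine Finset.sum_congr rfl fun i _ => ?_
  rw [hT.inverse_eq h h' hz, hT.driftForm_eq h h' hz]
  rfl

end IsFlatMorphism

end FlatOperatorEquation

local notation "𝔼" n:max => EuclideanSpace ℝ (Fin n)

/-! ### Connections in charts. -/

section ChartFields

variable {n : ℕ} {M : Type u} [TopologicalSpace M]
  [ChartedSpace (EuclideanSpace ℝ (Fin n)) M] [IsManifold (𝓡 n) ∞ M]

/-- The vector field with coordinates `g` in the chart `y`. -/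
def chartField (y : OpenPartialHomeomorph M (𝔼 n)) (g : 𝔼 n → 𝔼 n) :
    Π x : M, TangentSpace (𝓡 n) x :=
  fun x => (mfderiv (𝓡 n) (𝓡 n) y x).inverse (g (y x))

variable {y : OpenPartialHomeomorph M (𝔼 n)}

theorem mdifferentiable_of_mem_maximalAtlas
    (hy : y ∈ IsManifold.maximalAtlas (𝓡 n) ∞ M) : y.MDifferentiable (𝓡 n) (𝓡 n) :=
  ⟨fun x hx => ((contMDiffAt_of_mem_maximalAtlas hy hx).mdifferentiableAt
      (by simp)).mdifferentiableWithinAt,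
    fun z hz => ((contMDiffAt_symm_of_mem_maximalAtlas hy hz).mdifferentiableAt
      (by simp)).mdifferentiableWithinAt⟩

theorem isInvertible_mfderiv_of_mem_maximalAtlas
    (hy : y ∈ IsManifold.maximalAtlas (𝓡 n) ∞ M) {x : M} (hx : x ∈ y.source) :
    (mfderiv (𝓡 n) (𝓡 n) y x).IsInvertible :=
  ⟨(mdifferentiable_of_mem_maximalAtlas hy).mfderiv hx, rfl⟩

theorem contMDiffAt_chartField (hy : y ∈ IsManifold.maximalAtlas (𝓡 n) ∞ M)
    {g : 𝔼 n → 𝔼 n} {x : M} (hx : x ∈ y.source) (hg : ContDiffAt ℝ ∞ g (y x)) :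
    ContMDiffAt (𝓡 n) (𝓡 n).tangent ∞
      (fun z => (⟨z, chartField y g z⟩ : TangentBundle (𝓡 n) M)) x := by
  have : IsManifold (𝓡 n) 1 M := IsManifold.of_le (n := ∞) (by simp)
  exact ContMDiffAt.mpullback_vectorField_preimage (f := y) (V := g) (n := ∞)
    (contMDiffAt_vectorSpace_iff_contDiffAt.2 hg)
    (contMDiffAt_of_mem_maximalAtlas hy hx) (isInvertible_mfderiv_of_mem_maximalAtlas hy hx)
    le_rfl

theorem mfderiv_chartField (hy : y ∈ IsManifold.maximalAtlas (𝓡 n) ∞ M)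
    {g : 𝔼 n → 𝔼 n} {x : M} (hx : x ∈ y.source) :
    mfderiv (𝓡 n) (𝓡 n) y x (chartField y g x) = g (y x) := by
  obtain ⟨e, he⟩ := isInvertible_mfderiv_of_mem_maximalAtlas hy hx
  rw [chartField, ← he, ContinuousLinearMap.inverse_equiv]
  exact e.apply_symm_apply _

theorem TorsionFreeConnection.eventually_cov_eq (C : TorsionFreeConnection n M)
    {σ τ : Π x : M, TangentSpace (𝓡 n) x} {x : M}
    (hσ : ∀ᶠ z in 𝓝 x, ContMDiffAt (𝓡 n) (𝓡 n).tangent ∞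
      (fun z => (⟨z, σ z⟩ : TangentBundle (𝓡 n) M)) z)
    (hστ : ∀ᶠ z in 𝓝 x, σ z = τ z) :
    ∀ᶠ z in 𝓝 x, C.cov σ z = C.cov τ z := by
  filter_upwards [hσ, hστ.eventually_nhds] with z hz hz'
  have hd := hz.mdifferentiableAt (by simp)
  refine C.cov.isCovariantDerivativeOnUniv.congr_of_eventuallyEq hd ?_ univ_mem hz'
  refine hd.congr_of_eventuallyEq ?_
  filter_upwards [hz'] with a ha
  rw [ha]

/-- Smoothness of the connection is applied to globally smooth fields. A bump function supported in
s turns σ into one, and locality of the covariant derivative shows that nothing changes near x. -/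
theorem TorsionFreeConnection.contMDiffAt_cov [T2Space M] (C : TorsionFreeConnection n M)
    {σ : Π x : M, TangentSpace (𝓡 n) x} {s : Set M} (hs : IsOpen s)
    (hσ : ContMDiffOn (𝓡 n) (𝓡 n).tangent ∞
      (fun z => (⟨z, σ z⟩ : TangentBundle (𝓡 n) M)) s) {x : M} (hx : x ∈ s) :
    ContMDiffAt (𝓡 n) ((𝓡 n).prod 𝓘(ℝ, 𝔼 n →L[ℝ] 𝔼 n)) ∞
      (fun z => (⟨z, C.cov σ z⟩ : Bundle.TotalSpace (𝔼 n →L[ℝ] 𝔼 n)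
        fun z : M => TangentSpace (𝓡 n) z →L[ℝ] TangentSpace (𝓡 n) z)) x := by
  have : IsManifold (𝓡 n) 1 M := IsManifold.of_le (n := ∞) (by simp)
  obtain ⟨f, -, hf⟩ := (SmoothBumpFunction.nhds_basis_tsupport (I := 𝓡 n) x).mem_iff.1
    (hs.mem_nhds hx)
  have hglob := ContMDiffOn.smul_section_of_tsupport (f.contMDiff.contMDiffOn (s := s)) hs hf hσ
  have hc := C.smooth.contMDiff.contMDiff hglob.contMDiffOn
  refine (hc.contMDiffAt univ_mem).congr_of_eventuallyEq ?_
  have h1 : ∀ᶠ z in 𝓝 x, σ z = ((f : M → ℝ) • σ) z := by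
    filter_upwards [f.eventuallyEq_one] with z hz
    simp [hz]
  have h2 := C.eventually_cov_eq (σ := σ)
    (by filter_upwards [hs.mem_nhds hx] with z hz using hσ.contMDiffAt (hs.mem_nhds hz)) h1
  filter_upwards [h2] with z hz
  rw [hz]

theorem TorsionFreeConnection.cov_sum (C : TorsionFreeConnection n M) {ι : Type*}
    (s : Finset ι) (σ : ι → Π x : M, TangentSpace (𝓡 n) x) {x : M}
    (hσ : ∀ i ∈ s, MDifferentiableAt (𝓡 n) (𝓡 n).tangent
      (fun z => (⟨z, σ i z⟩ : TangentBundle (𝓡 n) M)) x) :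
    C.cov (fun z => ∑ i ∈ s, σ i z) x = ∑ i ∈ s, C.cov (σ i) x := by
  classical
  have : IsManifold (𝓡 n) 1 M := IsManifold.of_le (n := ∞) (by simp)
  induction s using Finset.induction_on with
  | empty => exact congrFun C.cov.zero x
  | insert a s ha ih =>
    rw [Finset.sum_insert ha, ← ih fun i hi => hσ i (Finset.mem_insert_of_mem hi),
      ← C.cov.isCovariantDerivativeOnUniv.add (hσ a (Finset.mem_insert_self a s))
        (MDifferentiableAt.sum_section fun i hi => hσ i (Finset.mem_insert_of_mem hi))]
    congr 1
    funext z
    simp [Finset.sum_insert ha]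

/-- The covariant derivative in coordinates. -/
def chartCov (C : TorsionFreeConnection n M) (y : OpenPartialHomeomorph M (𝔼 n)) (v : 𝔼 n)
    (g : 𝔼 n → 𝔼 n) (z : 𝔼 n) : 𝔼 n :=
  mfderiv (𝓡 n) (𝓡 n) y (y.symm z) (C.cov (chartField y g) (y.symm z)
    ((mfderiv (𝓡 n) (𝓡 n) y (y.symm z)).inverse v))

theorem chartField_eq_sum (g : 𝔼 n → 𝔼 n) (x : M) :
    chartField y g x = ∑ b, (g (y x) b) • chartField y (fun _ => EuclideanSpace.single b 1) x := by
  have h : ∀ (L : 𝔼 n →L[ℝ] 𝔼 n) (w : 𝔼 n),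
      L.inverse w = ∑ b, w b • L.inverse (EuclideanSpace.single b 1) := by
    intro L w
    conv_lhs => rw [EuclideanSpace.eq_sum_single w]
    simp
  exact h _ _

/-- Expand the field in the constant coordinate fields and apply the Leibniz rule to each term; the
derivatives of the components of g assemble to Dg(v). -/
theorem chartCov_eq_sum (C : TorsionFreeConnection n M)
    (hy : y ∈ IsManifold.maximalAtlas (𝓡 n) ∞ M) {g : 𝔼 n → 𝔼 n} {z : 𝔼 n} (hz : z ∈ y.target)
    (hg : DifferentiableAt ℝ g z) (v : 𝔼 n) :
    chartCov C y v g z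
      = (∑ b, g z b • christoffel C y v (EuclideanSpace.single b 1) z) + fderiv ℝ g z v := by
  have hx := y.map_target hz
  have hyx : y (y.symm z) = z := y.right_inv hz
  have hb : ∀ b : Fin n, MDifferentiableAt (𝓡 n) (𝓡 n).tangent
      (fun q => (⟨q, chartField y (fun _ => EuclideanSpace.single b 1) q⟩ :
        TangentBundle (𝓡 n) M)) (y.symm z) := fun b =>
    (contMDiffAt_chartField hy hx contDiffAt_const).mdifferentiableAt (by simp)
  have hgb : ∀ b : Fin n, MDifferentiableAt (𝓡 n) 𝓘(ℝ, ℝ) (fun q => g (y q) b) (y.symm z) := by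
    intro b
    have h1 : DifferentiableAt ℝ (fun q => g q b) (y (y.symm z)) := by
      rw [hyx]; exact (differentiableAt_euclidean.1 hg) b
    exact h1.mdifferentiableAt.comp (y.symm z)
      ((contMDiffAt_of_mem_maximalAtlas hy hx).mdifferentiableAt (by simp))
  have hfun : chartField y g = fun q => ∑ b,
      ((fun q => g (y q) b) • chartField y (fun _ => EuclideanSpace.single b 1)) q := by
    funext q
    exact chartField_eq_sum g q
  have hcov : C.cov (chartField y g) (y.symm z) = ∑ b, (g z b •
      C.cov (chartField y (fun _ => EuclideanSpace.single b 1)) (y.symm z) +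
      (mvfderiv (𝓡 n) (fun q => g (y q) b) (y.symm z)).smulRight
        (chartField y (fun _ => EuclideanSpace.single b 1) (y.symm z))) := by
    rw [hfun, C.cov_sum _ _ fun b _ => (hgb b).smul_section (hb b)]
    refine Finset.sum_congr rfl fun b _ => ?_
    rw [C.cov.isCovariantDerivativeOnUniv.leibniz (hb b) (hgb b), hyx]
  have halg : ∀ (P : 𝔼 n →L[ℝ] 𝔼 n) (A : Fin n → 𝔼 n →L[ℝ] 𝔼 n) (c : Fin n → ℝ)
      (l : Fin n → 𝔼 n →L[ℝ] ℝ) (w : Fin n → 𝔼 n) (q : 𝔼 n),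
      P ((∑ b, (c b • A b + (l b).smulRight (w b))) q)
        = ∑ b, c b • P (A b q) + ∑ b, l b q • P (w b) := by
    intro P A c l w q
    simp [sum_apply, Finset.sum_add_distrib]
  rw [chartCov, hcov]
  refine (halg _ _ _ _ _ _).trans ?_
  congr 1
  rw [EuclideanSpace.eq_sum_single (fderiv ℝ g z v)]
  refine Finset.sum_congr rfl fun b _ => ?_
  have h1 := mfderiv_chartField hy (g := fun _ => EuclideanSpace.single b 1) hx
  have h2 : mvfderiv (𝓡 n) (fun q => g (y q) b) (y.symm z)
      ((mfderiv (𝓡 n) (𝓡 n) y (y.symm z)).inverse v) = fderiv ℝ g z v b := by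
    have hd : HasFDerivAt (fun q => g q b)
        ((EuclideanSpace.proj b : 𝔼 n →L[ℝ] ℝ).comp (fderiv ℝ g z)) (y (y.symm z)) := by
      rw [hyx]
      exact (EuclideanSpace.proj b : 𝔼 n →L[ℝ] ℝ).hasFDerivAt.comp z hg.hasFDerivAt
    have hm := hd.hasMFDerivAt.comp (y.symm z)
      (((contMDiffAt_of_mem_maximalAtlas hy hx).mdifferentiableAt (by simp)).hasMFDerivAt)
    have hv := mfderiv_chartField hy (g := fun _ => v) hx
    have hmv : mvfderiv (𝓡 n) (fun q => g (y q) b) (y.symm z)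
        ((mfderiv (𝓡 n) (𝓡 n) y (y.symm z)).inverse v) = fderiv ℝ g z
          (mfderiv (𝓡 n) (𝓡 n) y (y.symm z)
            ((mfderiv (𝓡 n) (𝓡 n) y (y.symm z)).inverse v)) b := by
      rw [mvfderiv, show mfderiv (𝓡 n) 𝓘(ℝ, ℝ) (fun q => g (y q) b) (y.symm z) = _ from hm.mfderiv]
      rfl
    rw [hmv]
    exact congrArg (fun w : 𝔼 n => fderiv ℝ g z w b) hv
  exact congrArg₂ (fun (a : ℝ) (b : 𝔼 n) => a • b) h2 h1

theorem christoffel_eq_chartCov (C : TorsionFreeConnection n M)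
    (y : OpenPartialHomeomorph M (𝔼 n)) (v w z : 𝔼 n) :
    christoffel C y v w z = chartCov C y v (fun _ => w) z := rfl

theorem christoffel_eq_sum_right (C : TorsionFreeConnection n M)
    (hy : y ∈ IsManifold.maximalAtlas (𝓡 n) ∞ M) {z : 𝔼 n} (hz : z ∈ y.target) (v w : 𝔼 n) :
    christoffel C y v w z = ∑ b, w b • christoffel C y v (EuclideanSpace.single b 1) z := by
  rw [christoffel_eq_chartCov, chartCov_eq_sum C hy hz (differentiableAt_const w)]
  simp

theorem christoffel_eq_sum_left (C : TorsionFreeConnection n M)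
    (y : OpenPartialHomeomorph M (𝔼 n)) (v w z : 𝔼 n) :
    christoffel C y v w z = ∑ a, v a • christoffel C y (EuclideanSpace.single a 1) w z := by
  have h : ∀ (L A B : 𝔼 n →L[ℝ] 𝔼 n) (v : 𝔼 n),
      B (A (L v)) = ∑ a, v a • B (A (L (EuclideanSpace.single a 1))) := by
    intro L A B v
    conv_lhs => rw [EuclideanSpace.eq_sum_single v]
    simp
  exact h _ _ _ v

/-- The connection coefficients in the chart `y` as a field of bilinear maps. -/
def connectionForm (C : TorsionFreeConnection n M) (y : OpenPartialHomeomorph M (𝔼 n)) (z : 𝔼 n) :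
    𝔼 n →L[ℝ] 𝔼 n →L[ℝ] 𝔼 n :=
  ∑ a, ∑ b, (EuclideanSpace.proj a : 𝔼 n →L[ℝ] ℝ).smulRight
    ((EuclideanSpace.proj b : 𝔼 n →L[ℝ] ℝ).smulRight
      (christoffel C y (EuclideanSpace.single a 1) (EuclideanSpace.single b 1) z))

theorem connectionForm_apply (C : TorsionFreeConnection n M)
    (hy : y ∈ IsManifold.maximalAtlas (𝓡 n) ∞ M) {z : 𝔼 n} (hz : z ∈ y.target) (v w : 𝔼 n) :
    connectionForm C y z v w = christoffel C y v w z := by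
  rw [christoffel_eq_sum_left, connectionForm]
  simp only [sum_apply, ContinuousLinearMap.smulRight_apply, smul_apply]
  refine Finset.sum_congr rfl fun a _ => ?_
  rw [christoffel_eq_sum_right C hy hz, Finset.smul_sum]
  rfl

theorem chartCov_eq (C : TorsionFreeConnection n M)
    (hy : y ∈ IsManifold.maximalAtlas (𝓡 n) ∞ M) {g : 𝔼 n → 𝔼 n} {z : 𝔼 n} (hz : z ∈ y.target)
    (hg : DifferentiableAt ℝ g z) (v : 𝔼 n) :
    chartCov C y v g z = connectionForm C y z v (g z) + fderiv ℝ g z v := by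
  rw [chartCov_eq_sum C hy hz hg, connectionForm_apply C hy hz, christoffel_eq_sum_right C hy hz]

/-- The coefficients are the pull-back along `y.symm` of the vector field ∇_V W, for V and W with
constant coordinates, so they inherit the smoothness of that field. -/
theorem contDiffOn_christoffel [T2Space M] (C : TorsionFreeConnection n M)
    (hy : y ∈ IsManifold.maximalAtlas (𝓡 n) ∞ M) (v w : 𝔼 n) :
    ContDiffOn ℝ ∞ (christoffel C y v w) y.target := by
  intro z hz
  have : IsManifold (𝓡 n) 1 M := IsManifold.of_le (n := ∞) (by simp)
  have hx := y.map_target hz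
  have hfield : ∀ g : 𝔼 n, ContMDiffOn (𝓡 n) (𝓡 n).tangent ∞
      (fun z => (⟨z, chartField y (fun _ => g) z⟩ : TangentBundle (𝓡 n) M)) y.source := fun g x hx =>
    (contMDiffAt_chartField hy hx contDiffAt_const).contMDiffWithinAt
  have hcov := C.contMDiffAt_cov y.open_source (hfield w) hx
  have hW := hcov.clm_bundle_apply ((hfield v).contMDiffAt (y.open_source.mem_nhds hx))
  have hM := mdifferentiable_of_mem_maximalAtlas hy
  have hpull := ContMDiffAt.mpullback_vectorField_preimage (f := y.symm) (x₀ := z) (n := ∞) hW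
    (contMDiffAt_symm_of_mem_maximalAtlas hy hz) ⟨hM.symm.mfderiv hz, rfl⟩ le_rfl
  have hcd := contMDiffAt_vectorSpace_iff_contDiffAt.1 hpull
  refine (hcd.congr_of_eventuallyEq ?_).contDiffWithinAt
  filter_upwards [y.open_target.mem_nhds hz] with q hq
  -- The pull-back involves the inverse of the derivative of `y.symm`, the coefficients the
  -- derivative of y; these are the same linear map.
  have h : ∀ (A B : 𝔼 n →L[ℝ] 𝔼 n) (u : 𝔼 n), A.comp B = .id ℝ _ → B.comp A = .id ℝ _ →
      A u = B.inverse u := by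
    intro A B u h1 h2
    have : B = (ContinuousLinearEquiv.equivOfInverse B A
      (fun x => by simpa using DFunLike.congr_fun h1 x)
      (fun x => by simpa using DFunLike.congr_fun h2 x) : 𝔼 n →L[ℝ] 𝔼 n) := rfl
    rw [this, ContinuousLinearMap.inverse_equiv]
    rfl
  refine h _ _ _ ?_ ?_
  · have := hM.comp_symm_deriv hq
    exact this
  · have := hM.symm_comp_deriv (y.map_target hq)
    rw [y.right_inv hq] at this
    exact this

theorem contDiffOn_connectionForm [T2Space M] (C : TorsionFreeConnection n M)
    (hy : y ∈ IsManifold.maximalAtlas (𝓡 n) ∞ M) :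
    ContDiffOn ℝ ∞ (connectionForm C y) y.target := by
  refine ContDiffOn.sum fun a _ => ContDiffOn.sum fun b _ => ?_
  exact contDiffOn_const.smulRight (contDiffOn_const.smulRight (contDiffOn_christoffel C hy _ _))

end ChartFields

/-! ### Change of coordinates for connections and covariant Hessians. -/

theorem fderiv_fderiv_comp {X Y F : Type*} [NormedAddCommGroup X] [NormedSpace ℝ X]
    [NormedAddCommGroup Y] [NormedSpace ℝ Y] [NormedAddCommGroup F] [NormedSpace ℝ F]
    {f : Y → F} {T : X → Y} {x : X} (hf : ContDiffAt ℝ ∞ f (T x)) (hT : ContDiffAt ℝ ∞ T x)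
    (v w : X) :
    fderiv ℝ (fderiv ℝ (f ∘ T)) x v w
      = fderiv ℝ (fderiv ℝ f) (T x) (fderiv ℝ T x v) (fderiv ℝ T x w)
        + fderiv ℝ f (T x) (fderiv ℝ (fderiv ℝ T) x v w) := by
  have hev : fderiv ℝ (f ∘ T) =ᶠ[𝓝 x] fun q => (fderiv ℝ f (T q)).comp (fderiv ℝ T q) := by
    filter_upwards [hT.continuousAt.eventually ((hf.of_le (m := 1) (by simp)).eventually (by simp)),
      (hT.of_le (m := 1) (by simp)).eventually (by simp)] with q h1 h2
    exact fderiv_comp q (h1.differentiableAt (by simp)) (h2.differentiableAt (by simp))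
  have h1 : HasFDerivAt (fderiv ℝ f) (fderiv ℝ (fderiv ℝ f) (T x)) (T x) :=
    ((hf.fderiv_right (m := ∞) le_rfl).differentiableAt (by simp)).hasFDerivAt
  have h2 : HasFDerivAt (fderiv ℝ T) (fderiv ℝ (fderiv ℝ T) x) x :=
    ((hT.fderiv_right (m := ∞) le_rfl).differentiableAt (by simp)).hasFDerivAt
  have h3 := (h1.comp x (hT.differentiableAt (by simp)).hasFDerivAt).clm_comp h2
  have h4 : fderiv ℝ (fun q => (fderiv ℝ f (T q)).comp (fderiv ℝ T q)) x = _ := h3.fderiv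
  rw [hev.fderiv_eq, h4]
  simp [add_comm]

section ChangeOfCoordinates

variable {n : ℕ} {M M' : Type u}
  [TopologicalSpace M] [ChartedSpace (EuclideanSpace ℝ (Fin n)) M] [IsManifold (𝓡 n) ∞ M]
  [TopologicalSpace M'] [ChartedSpace (EuclideanSpace ℝ (Fin n)) M'] [IsManifold (𝓡 n) ∞ M']

variable {y : OpenPartialHomeomorph M (𝔼 n)} {y' : OpenPartialHomeomorph M' (𝔼 n)}
  {C : TorsionFreeConnection n M} {C' : TorsionFreeConnection n M'} {F : M → M'}

theorem chartCov_apply (C : TorsionFreeConnection n M) {x : M} (hx : x ∈ y.source) (v : 𝔼 n)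
    (g : 𝔼 n → 𝔼 n) :
    chartCov C y v g (y x) = mfderiv (𝓡 n) (𝓡 n) y x (C.cov (chartField y g) x
      ((mfderiv (𝓡 n) (𝓡 n) y x).inverse v)) :=
  congrArg (fun q => (mfderiv (𝓡 n) (𝓡 n) y q (C.cov (chartField y g) q
      ((mfderiv (𝓡 n) (𝓡 n) y q).inverse v)) : 𝔼 n)) (y.left_inv hx)

theorem contDiffAt_coord (hy : y ∈ IsManifold.maximalAtlas (𝓡 n) ∞ M)
    (hy' : y' ∈ IsManifold.maximalAtlas (𝓡 n) ∞ M') {x : M} (hx : x ∈ y.source)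
    (hF : ContMDiffAt (𝓡 n) (𝓡 n) ∞ F x) (hFx : F x ∈ y'.source) :
    ContDiffAt ℝ ∞ (fun z => y' (F (y.symm z))) (y x) := by
  have h1 := contMDiffAt_symm_of_mem_maximalAtlas hy (y.map_source hx)
  have h2 : ContMDiffAt (𝓡 n) (𝓡 n) ∞ F (y.symm (y x)) := by rwa [y.left_inv hx]
  have h3 : ContMDiffAt (𝓡 n) (𝓡 n) ∞ y' (F (y.symm (y x))) := by
    rw [y.left_inv hx]
    exact contMDiffAt_of_mem_maximalAtlas hy' hFx
  exact (h3.comp (y x) (h2.comp (y x) h1)).contDiffAt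

theorem mfderiv_coord (hy : y ∈ IsManifold.maximalAtlas (𝓡 n) ∞ M)
    (hy' : y' ∈ IsManifold.maximalAtlas (𝓡 n) ∞ M') {x : M} (hx : x ∈ y.source)
    (hF : ContMDiffAt (𝓡 n) (𝓡 n) ∞ F x) (hFx : F x ∈ y'.source) (v : TangentSpace (𝓡 n) x) :
    mfderiv (𝓡 n) (𝓡 n) y' (F x) (mfderiv (𝓡 n) (𝓡 n) F x v)
      = fderiv ℝ (fun z => y' (F (y.symm z))) (y x) (mfderiv (𝓡 n) (𝓡 n) y x v) := by
  have h1 := ((contMDiffAt_of_mem_maximalAtlas hy' hFx).mdifferentiableAt (by simp)).hasMFDerivAt.comp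
    x (hF.mdifferentiableAt (by simp)).hasMFDerivAt
  have h2 := ((contDiffAt_coord hy hy' hx hF hFx).differentiableAt
    (by simp)).hasFDerivAt.hasMFDerivAt.comp x
    ((contMDiffAt_of_mem_maximalAtlas hy hx).mdifferentiableAt (by simp)).hasMFDerivAt
  have h3 : (fun z => y' (F (y.symm z))) ∘ y =ᶠ[𝓝 x] y' ∘ F := by
    filter_upwards [y.open_source.mem_nhds hx] with q hq
    simp [y.left_inv hq]
  have h4 := hasMFDerivAt_unique (h2.congr_of_eventuallyEq h3.symm) h1
  exact DFunLike.congr_fun h4.symm v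

theorem isInvertible_fderiv_coord (hy : y ∈ IsManifold.maximalAtlas (𝓡 n) ∞ M)
    (hy' : y' ∈ IsManifold.maximalAtlas (𝓡 n) ∞ M') {x : M} (hx : x ∈ y.source)
    (hF : IsLocalDiffeomorphAt (𝓡 n) (𝓡 n) ∞ F x) (hFx : F x ∈ y'.source) :
    (fderiv ℝ (fun z => y' (F (y.symm z))) (y x)).IsInvertible := by
  obtain ⟨e, he⟩ := isInvertible_mfderiv_of_mem_maximalAtlas hy hx
  obtain ⟨e', he'⟩ := isInvertible_mfderiv_of_mem_maximalAtlas hy' hFx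
  let k := hF.mfderivToContinuousLinearEquiv (by simp)
  refine ⟨(e.symm.trans k).trans e', ?_⟩
  ext v : 1
  have h := mfderiv_coord hy hy' hx hF.contMDiffAt hFx (e.symm v)
  rw [← he, ← he'] at h
  have h2 : e (e.symm v) = v := e.apply_symm_apply v
  refine Eq.trans ?_ (h.trans ?_)
  · rfl
  · exact congrArg _ h2

theorem connectionForm_coord (hy : y ∈ IsManifold.maximalAtlas (𝓡 n) ∞ M)
    (hy' : y' ∈ IsManifold.maximalAtlas (𝓡 n) ∞ M') {Ω : Set M} (hΩ : IsOpen Ω)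
    (hF : IsLocalDiffeomorphOn (𝓡 n) (𝓡 n) ∞ F Ω) (hC : PreservesConnectionOn C C' F Ω)
    {x : M} (hx : x ∈ y.source) (hxΩ : x ∈ Ω) (hFx : F x ∈ y'.source) {T : 𝔼 n → 𝔼 n}
    (hT : T = fun z => y' (F (y.symm z))) (v w : 𝔼 n) :
    connectionForm C' y' (T (y x)) (fderiv ℝ T (y x) v) (fderiv ℝ T (y x) w)
      = fderiv ℝ T (y x) (connectionForm C y (y x) v w) - fderiv ℝ (fderiv ℝ T) (y x) v w := by
  have hloc : ∀ᶠ q in 𝓝 x, q ∈ y.source ∧ F q ∈ y'.source ∧ q ∈ Ω := by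
    filter_upwards [y.open_source.mem_nhds hx, hΩ.mem_nhds hxΩ,
      (hF ⟨x, hxΩ⟩).contMDiffAt.continuousAt.preimage_mem_nhds (y'.open_source.mem_nhds hFx)]
      with q h1 h2 h3
    exact ⟨h1, h3, h2⟩
  have hTs : ContDiffAt ℝ ∞ T (y x) := hT ▸ contDiffAt_coord hy hy' hx (hF ⟨x, hxΩ⟩).contMDiffAt hFx
  have hinv : ∀ᶠ q in 𝓝 x, (fderiv ℝ T (y q)).IsInvertible := by
    filter_upwards [hloc] with q hq
    exact hT ▸ isInvertible_fderiv_coord hy hy' hq.1 (hF ⟨q, hq.2.2⟩) hq.2.1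
  set w' := fderiv ℝ T (y x) w with hw'
  let g : 𝔼 n → 𝔼 n := fun q => (fderiv ℝ T q).inverse w'
  have hg : ContDiffAt ℝ ∞ g (y x) := by
    have h1 : ContDiffAt ℝ ∞ (fderiv ℝ T) (y x) := hTs.fderiv_right (m := ∞) le_rfl
    obtain ⟨e, he⟩ := hinv.self_of_nhds
    have h2 : ContDiffAt ℝ ∞ ContinuousLinearMap.inverse (fderiv ℝ T (y x)) :=
      he ▸ contDiffAt_map_inverse e
    exact (h2.comp (y x) h1).clm_apply contDiffAt_const
  have hinvy : ∀ᶠ q in 𝓝 (y x), (fderiv ℝ T q).IsInvertible := by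
    have := y.tendsto_symm hx
    filter_upwards [this.eventually hinv, y.open_target.mem_nhds (y.map_source hx)] with q hq hqt
    rwa [y.right_inv hqt] at hq
  have hDg : ∀ q, (fderiv ℝ T q).IsInvertible → fderiv ℝ T q (g q) = w' := by
    rintro q ⟨e, he⟩
    simp only [g, ← he, ContinuousLinearMap.inverse_equiv]
    exact e.apply_symm_apply _
  have hgx : g (y x) = w := by
    obtain ⟨e, he⟩ := hinv.self_of_nhds
    simp only [g, hw', ← he, ContinuousLinearMap.inverse_equiv]
    exact e.symm_apply_apply _
  have hderiv : fderiv ℝ (fderiv ℝ T) (y x) v w + fderiv ℝ T (y x) (fderiv ℝ g (y x) v) = 0 := by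
    have h1 := ((hTs.fderiv_right (m := ∞) le_rfl).differentiableAt (by simp)).hasFDerivAt.clm_apply
      (hg.differentiableAt (by simp)).hasFDerivAt
    have h2 : (fun q => fderiv ℝ T q (g q)) =ᶠ[𝓝 (y x)] fun _ => w' :=
      hinvy.mono fun q hq => hDg q hq
    have h3 := h1.fderiv.symm.trans (h2.fderiv_eq.trans (fderiv_const_apply _))
    have h4 := DFunLike.congr_fun h3 v
    simpa [hgx, add_comm] using h4
  have hrel : ∀ᶠ q in 𝓝 x, mfderiv (𝓡 n) (𝓡 n) F q (chartField y g q)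
      = chartField y' (fun _ => w') (F q) := by
    filter_upwards [hloc, hinv] with q hq hqi
    have h1 := mfderiv_coord hy hy' hq.1 (hF ⟨q, hq.2.2⟩).contMDiffAt hq.2.1 (chartField y g q)
    rw [mfderiv_chartField hy hq.1, ← hT, hDg _ hqi] at h1
    obtain ⟨e, he⟩ := isInvertible_mfderiv_of_mem_maximalAtlas hy' hq.2.1
    have h2 := mfderiv_chartField hy' (g := fun _ => w') hq.2.1
    rw [← he] at h1 h2
    exact e.injective (h1.trans h2.symm)
  have hpres := hC x hxΩ _ _ (contMDiffAt_chartField hy hx hg)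
    (contMDiffAt_chartField hy' hFx (contDiffAt_const (c := w'))) hrel
    ((mfderiv (𝓡 n) (𝓡 n) y x).inverse v)
  have hpush := mfderiv_coord hy hy' hx (hF ⟨x, hxΩ⟩).contMDiffAt hFx
    (C.cov (chartField y g) x ((mfderiv (𝓡 n) (𝓡 n) y x).inverse v))
  have hv := mfderiv_coord hy hy' hx (hF ⟨x, hxΩ⟩).contMDiffAt hFx
    ((mfderiv (𝓡 n) (𝓡 n) y x).inverse v)
  have hv0 : mfderiv (𝓡 n) (𝓡 n) y x ((mfderiv (𝓡 n) (𝓡 n) y x).inverse v) = v :=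
    mfderiv_chartField hy (g := fun _ => v) hx
  have hv' : mfderiv (𝓡 n) (𝓡 n) F x ((mfderiv (𝓡 n) (𝓡 n) y x).inverse v)
      = (mfderiv (𝓡 n) (𝓡 n) y' (F x)).inverse (fderiv ℝ T (y x) v) := by
    rw [hv0, ← hT] at hv
    obtain ⟨e, he⟩ := isInvertible_mfderiv_of_mem_maximalAtlas hy' hFx
    rw [← he] at hv ⊢
    rw [ContinuousLinearMap.inverse_equiv]
    exact e.injective (hv.trans (e.apply_symm_apply _).symm)
  have hTx : T (y x) = y' (F x) := by simp [hT, y.left_inv hx]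
  have hL := chartCov_apply C hx v g
  have hR := chartCov_apply C' hFx (fderiv ℝ T (y x) v) (fun _ => w')
  rw [hpres, hv', ← hT] at hpush
  have hfin : chartCov C' y' (fderiv ℝ T (y x) v) (fun _ => w') (y' (F x))
      = fderiv ℝ T (y x) (chartCov C y v g (y x)) := by
    rw [hR, hL]
    exact hpush
  rw [chartCov_eq C' hy' (y'.map_source hFx) (differentiableAt_const _),
    chartCov_eq C hy (y.map_source hx) (hg.differentiableAt (by simp)), hgx] at hfin
  rw [hTx]
  rw [fderiv_const_apply, map_add] at hfin
  rw [← sub_eq_zero]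
  have : fderiv ℝ T (y x) (fderiv ℝ g (y x) v) = - fderiv ℝ (fderiv ℝ T) (y x) v w :=
    eq_neg_of_add_eq_zero_right hderiv
  rw [this] at hfin
  simp only [zero_apply, add_zero] at hfin
  rw [hfin]
  abel

/-- The covariant Hessian `D²Φ - dΦ ∘ Γ` in the coordinates `y`. -/
def covariantHess (C : TorsionFreeConnection n M) (Φ : M → ℝ) (y : OpenPartialHomeomorph M (𝔼 n))
    (z : 𝔼 n) : 𝔼 n →L[ℝ] 𝔼 n →L[ℝ] ℝ :=
  fderiv ℝ (fderiv ℝ (Φ ∘ y.symm)) z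
    - (ContinuousLinearMap.compL ℝ (𝔼 n) (𝔼 n) ℝ (fderiv ℝ (Φ ∘ y.symm) z)).comp
        (connectionForm C y z)

theorem covariantHess_apply (C : TorsionFreeConnection n M) (Φ : M → ℝ)
    (y : OpenPartialHomeomorph M (𝔼 n)) (z v w : 𝔼 n) :
    covariantHess C Φ y z v w = fderiv ℝ (fderiv ℝ (Φ ∘ y.symm)) z v w
      - fderiv ℝ (Φ ∘ y.symm) z (connectionForm C y z v w) := rfl

/-- The term with D²T from the chain rule cancels the inhomogeneous term of the connection
coefficients, so the covariant Hessian is a tensor. -/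
theorem covariantHess_coord (hy : y ∈ IsManifold.maximalAtlas (𝓡 n) ∞ M)
    (hy' : y' ∈ IsManifold.maximalAtlas (𝓡 n) ∞ M') {Ω : Set M} (hΩ : IsOpen Ω)
    (hF : IsLocalDiffeomorphOn (𝓡 n) (𝓡 n) ∞ F Ω) (hC : PreservesConnectionOn C C' F Ω)
    {x : M} (hx : x ∈ y.source) (hxΩ : x ∈ Ω) (hFx : F x ∈ y'.source) {T : 𝔼 n → 𝔼 n}
    (hT : T = fun z => y' (F (y.symm z))) {Φ : M → ℝ} {Φ' : M' → ℝ}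
    (hΦ' : ContDiffAt ℝ ∞ (Φ' ∘ y'.symm) (T (y x)))
    (hΦ : Φ ∘ y.symm =ᶠ[𝓝 (y x)] (Φ' ∘ y'.symm) ∘ T) (v w : 𝔼 n) :
    covariantHess C' Φ' y' (T (y x)) (fderiv ℝ T (y x) v) (fderiv ℝ T (y x) w)
      = covariantHess C Φ y (y x) v w := by
  have hTs : ContDiffAt ℝ ∞ T (y x) := hT ▸ contDiffAt_coord hy hy' hx (hF ⟨x, hxΩ⟩).contMDiffAt hFx
  have h1 : fderiv ℝ (Φ ∘ y.symm) (y x)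
      = (fderiv ℝ (Φ' ∘ y'.symm) (T (y x))).comp (fderiv ℝ T (y x)) := by
    rw [hΦ.fderiv_eq]
    exact fderiv_comp _ (hΦ'.differentiableAt (by simp)) (hTs.differentiableAt (by simp))
  rw [covariantHess_apply, covariantHess_apply, connectionForm_coord hy hy' hΩ hF hC hx hxΩ hFx hT,
    hΦ.fderiv.fderiv_eq, fderiv_fderiv_comp hΦ' hTs, h1, map_sub]
  simp only [ContinuousLinearMap.comp_apply]
  ring

end ChangeOfCoordinates

/-- Euler's theorem on homogeneous functions, in degree one. -/
theorem eq_fderiv_zero_of_euler {X Y : Type*} [NormedAddCommGroup X] [NormedSpace ℝ X]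
    [NormedAddCommGroup Y] [NormedSpace ℝ Y] {D : Set X} {T : X → Y} (hD : IsOpen D)
    (h0 : (0 : X) ∈ D) (hs : StarConvex ℝ 0 D) (hT : DifferentiableOn ℝ T D)
    (he : ∀ z ∈ D, fderiv ℝ T z z = T z) {z : X} (hz : z ∈ D) : T z = fderiv ℝ T 0 z := by
  have hd : ∀ q ∈ D, HasFDerivAt T (fderiv ℝ T q) q := fun q hq =>
    (hT.differentiableAt (hD.mem_nhds hq)).hasFDerivAt
  have hline : ∀ t : ℝ, HasDerivAt (fun t : ℝ => t • z) z t := fun t => by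
    simpa using (hasDerivAt_id t).smul_const z
  let O : Set ℝ := {t | 0 < t ∧ t • z ∈ D}
  have hO : IsOpen O := isOpen_Ioi.inter (hD.preimage (by fun_prop : Continuous fun t : ℝ => t • z))
  have hconn : IsPreconnected O := by
    refine (ordConnected_def.2 fun a ha b hb c hc => ?_).isPreconnected
    have hb0 : 0 < b := hb.1
    refine ⟨ha.1.trans_le hc.1, ?_⟩
    have := hs.smul_mem hb.2 (div_nonneg (ha.1.le.trans hc.1) hb0.le)
      ((div_le_one hb0).2 hc.2)
    rwa [smul_smul, div_mul_cancel₀ _ hb0.ne'] at this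
  -- Euler's identity makes this quotient constant on O, an interval because D is star-shaped. Its
  -- limit as t → 0 from the right is the derivative of T at 0 applied to z.
  let q : ℝ → Y := fun t => t⁻¹ • T (t • z)
  have hq : ∀ t ∈ O, HasDerivAt q 0 t := by
    intro t ht
    have h1 := (hasDerivAt_inv ht.1.ne').smul ((hd _ ht.2).comp_hasDerivAt t (hline t))
    refine h1.congr_deriv ?_
    have h2 : fderiv ℝ T (t • z) z = t⁻¹ • T (t • z) := by
      rw [← he _ ht.2, map_smul, smul_smul, inv_mul_cancel₀ ht.1.ne', one_smul]
    simp only [h2, Function.comp]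
    rw [smul_smul, ← add_smul, show t⁻¹ * t⁻¹ + -(t ^ 2)⁻¹ = 0 by field_simp; ring, zero_smul]
  have h1O : (1 : ℝ) ∈ O := ⟨one_pos, by simpa using hz⟩
  have hconst : ∀ t ∈ O, q t = q 1 := fun t ht =>
    hO.is_const_of_deriv_eq_zero hconn
      (fun s hs => (hq s hs).differentiableAt.differentiableWithinAt)
      (fun s hs => (hq s hs).deriv) ht h1O
  have hT0 : T 0 = 0 := by simpa using (he 0 h0).symm
  have hderiv : HasDerivAt (fun t : ℝ => T (t • z)) (fderiv ℝ T 0 z) 0 := by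
    have h2 : HasFDerivAt T (fderiv ℝ T 0) ((0 : ℝ) • z) := by rw [zero_smul]; exact hd 0 h0
    exact h2.comp_hasDerivAt 0 (hline 0)
  have hlim := hasDerivAt_iff_tendsto_slope_zero.1 hderiv
  have hlim2 : Tendsto q (𝓝[>] 0) (𝓝 (fderiv ℝ T 0 z)) := by
    refine (hlim.mono_left (nhdsWithin_mono _ fun t ht => ne_of_gt ht)).congr fun t => ?_
    simp [q, hT0]
  have hev : ∀ᶠ t in 𝓝[>] (0 : ℝ), q t = q 1 := by
    have h3 : ∀ᶠ t in 𝓝 (0 : ℝ), t • z ∈ D :=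
      (by fun_prop : Continuous fun t : ℝ => t • z).continuousAt.preimage_mem_nhds
        (hD.mem_nhds (by simpa using h0))
    filter_upwards [h3.filter_mono nhdsWithin_le_nhds, self_mem_nhdsWithin] with t h4 h5
    exact hconst t ⟨h5, h4⟩
  have h6 := tendsto_nhds_unique hlim2 (tendsto_const_nhds.congr' (hev.mono fun t ht => ht.symm))
  rw [h6]
  simp [q]

theorem IsFlatModel.congr {n : ℕ} {D : Set (EuclideanSpace ℝ (Fin n))}
    {u u' : EuclideanSpace ℝ (Fin n) → ℝ}
    {H H' : EuclideanSpace ℝ (Fin n) →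
      EuclideanSpace ℝ (Fin n) →L[ℝ] EuclideanSpace ℝ (Fin n) →L[ℝ] ℝ}
    (h : IsFlatModel D u H) (hu : EqOn u' u D) (hH : EqOn H' H D) : IsFlatModel D u' H' where
  isOpen := h.isOpen
  zero_mem := h.zero_mem
  starConvex := h.starConvex
  smooth_phase := h.smooth_phase.congr hu
  smooth_hessian := h.smooth_hessian.congr hH
  isInvertible z hz := by rw [hH hz]; exact h.isInvertible z hz
  euler z hz := by
    rw [hH hz, h.euler z hz, (hu.eventuallyEq_of_mem (h.isOpen.mem_nhds hz)).fderiv_eq]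

/-! ### Linearizing charts and the intrinsic operator. -/

section FlatCharts

variable {n : ℕ} {M M' : Type u}
  [TopologicalSpace M] [ChartedSpace (EuclideanSpace ℝ (Fin n)) M] [IsManifold (𝓡 n) ∞ M]
  [TopologicalSpace M'] [ChartedSpace (EuclideanSpace ℝ (Fin n)) M'] [IsManifold (𝓡 n) ∞ M']

/-- The chart `y` of `Ω` linearizes the gradient field of the phase with respect to its covariant
Hessian. -/
structure IsFlatChart (C : TorsionFreeConnection n M) (Φ : M → ℝ) (Ω : Set M)
    (y : OpenPartialHomeomorph M (𝔼 n)) : Prop where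
  mem : y ∈ IsManifold.maximalAtlas (𝓡 n) ∞ M
  source_eq : y.source = Ω
  model : IsFlatModel y.target (Φ ∘ y.symm) (covariantHess C Φ y)

variable {y : OpenPartialHomeomorph M (𝔼 n)} {y' : OpenPartialHomeomorph M' (𝔼 n)}
  {C : TorsionFreeConnection n M} {C' : TorsionFreeConnection n M'} {F : M → M'}
  {Φ : M → ℝ} {Φ' : M' → ℝ} {Ω : Set M} {Ω' : Set M'}

/-- The coordinate expression of a structure embedding between flat charts is linear. -/
theorem IsFlatChart.exists_linear (h : IsFlatChart C Φ Ω y) (h' : IsFlatChart C' Φ' Ω' y')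
    (hF : IsStructureEmbedding C Φ Ω C' Φ' Ω' F) :
    ∃ L : 𝔼 n ≃L[ℝ] 𝔼 n, IsFlatMorphism y.target (Φ ∘ y.symm) (covariantHess C Φ y)
      y'.target (Φ' ∘ y'.symm) (covariantHess C' Φ' y') L ∧
      ∀ z ∈ y.target, y' (F (y.symm z)) = L z := by
  obtain ⟨hloc, -, hmaps, hphase, hpres⟩ := hF
  have hΩ : IsOpen Ω := h.source_eq ▸ y.open_source
  let T : 𝔼 n → 𝔼 n := fun z => y' (F (y.symm z))
  have hsrc : ∀ z ∈ y.target, y.symm z ∈ Ω := fun z hz => h.source_eq ▸ y.map_target hz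
  have hsrc' : ∀ x ∈ Ω, F x ∈ y'.source := fun x hx => h'.source_eq ▸ hmaps hx
  have hTmaps : ∀ z ∈ y.target, T z ∈ y'.target := fun z hz =>
    y'.map_source (hsrc' _ (hsrc z hz))
  have hTs : ∀ z ∈ y.target, ContDiffAt ℝ ∞ T z := by
    intro z hz
    have := contDiffAt_coord h.mem h'.mem (y.map_target hz) (hloc ⟨_, hsrc z hz⟩).contMDiffAt
      (hsrc' _ (hsrc z hz))
    rwa [y.right_inv hz] at this
  have hTi : ∀ z ∈ y.target, (fderiv ℝ T z).IsInvertible := by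
    intro z hz
    have := isInvertible_fderiv_coord h.mem h'.mem (y.map_target hz) (hloc ⟨_, hsrc z hz⟩)
      (hsrc' _ (hsrc z hz))
    rwa [y.right_inv hz] at this
  have hu : ∀ z ∈ y.target, Φ (y.symm z) = Φ' (y'.symm (T z)) := by
    intro z hz
    simp only [T, y'.left_inv (hsrc' _ (hsrc z hz)), hphase _ (hsrc z hz)]
  have huev : ∀ z ∈ y.target, Φ ∘ y.symm =ᶠ[𝓝 z] (Φ' ∘ y'.symm) ∘ T := fun z hz =>
    eventuallyEq_of_mem (y.open_target.mem_nhds hz) hu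
  have hu's : ∀ z ∈ y.target, ContDiffAt ℝ ∞ (Φ' ∘ y'.symm) (T z) := fun z hz =>
    h'.model.smooth_phase.contDiffAt (y'.open_target.mem_nhds (hTmaps z hz))
  have hH : ∀ z ∈ y.target, ∀ v w, covariantHess C' Φ' y' (T z) (fderiv ℝ T z v) (fderiv ℝ T z w)
      = covariantHess C Φ y z v w := by
    intro z hz v w
    have := covariantHess_coord (T := T) (Φ := Φ) (Φ' := Φ') h.mem h'.mem hΩ hloc hpres
      (y.map_target hz) (hsrc z hz) (hsrc' _ (hsrc z hz)) rfl
    rw [y.right_inv hz] at this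
    exact this (hu's z hz) (huev z hz) v w
  -- T carries one Euler field to the other: H'(Tz)(DT z, DT w) = H(z)(z, w) = Du(z)w = Du'(Tz)(DT
  -- w) = H'(Tz)(Tz, DT w). Invertibility of H'(Tz) and of DT gives DT(z)z = Tz.
  have heuler : ∀ z ∈ y.target, fderiv ℝ T z z = T z := by
    intro z hz
    obtain ⟨e, he⟩ := h'.model.isInvertible _ (hTmaps z hz)
    obtain ⟨k, hk⟩ := hTi z hz
    have hinj : ∀ a b, covariantHess C' Φ' y' (T z) a = covariantHess C' Φ' y' (T z) b → a = b := by
      intro a b hab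
      rw [← he] at hab
      exact e.injective hab
    refine hinj _ _ ?_
    ext w
    obtain ⟨w, rfl⟩ : ∃ w', fderiv ℝ T z w' = w := ⟨k.symm w, by rw [← hk]; simp⟩
    rw [hH z hz, h.model.euler z hz, h'.model.euler _ (hTmaps z hz), (huev z hz).fderiv_eq,
      fderiv_comp _ ((hu's z hz).differentiableAt (by simp))
        ((hTs z hz).differentiableAt (by simp))]
    rfl
  have hlin : ∀ z ∈ y.target, T z = fderiv ℝ T 0 z := fun z hz =>
    eq_fderiv_zero_of_euler y.open_target h.model.zero_mem h.model.starConvex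
      (fun q hq => ((hTs q hq).differentiableAt (by simp)).differentiableWithinAt) heuler hz
  obtain ⟨L, hL⟩ := hTi 0 h.model.zero_mem
  have hTL : ∀ z ∈ y.target, T z = L z := by
    intro z hz
    rw [hlin z hz, ← hL]
    rfl
  have hDT : ∀ z ∈ y.target, fderiv ℝ T z = (L : 𝔼 n →L[ℝ] 𝔼 n) := by
    intro z hz
    rw [(eventuallyEq_of_mem (y.open_target.mem_nhds hz) hTL).fderiv_eq]
    exact L.fderiv
  refine ⟨L, ⟨fun z hz => hTL z hz ▸ hTmaps z hz, fun z hz => ?_, fun z hz v w => ?_⟩, hTL⟩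
  · rw [← hTL z hz]
    exact (hu z hz).symm
  · have := hH z hz v w
    rw [hDT z hz, hTL z hz] at this
    exact this

theorem IsFlatChart.flatBox_eq (h : IsFlatChart C Φ Ω y) (h' : IsFlatChart C' Φ' Ω' y')
    (hF : IsStructureEmbedding C Φ Ω C' Φ' Ω' F) {x : M} (hx : x ∈ Ω) {f : M' → ℂ}
    (hf : ContMDiffAt (𝓡 n) 𝓘(ℝ, ℂ) ∞ f (F x)) :
    flatBox (Φ ∘ y.symm) (covariantHess C Φ y) ((f ∘ F) ∘ y.symm) (y x)
      = flatBox (Φ' ∘ y'.symm) (covariantHess C' Φ' y') (f ∘ y'.symm) (y' (F x)) := by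
  obtain ⟨L, hL, hLT⟩ := h.exists_linear h' hF
  have hxs : x ∈ y.source := h.source_eq ▸ hx
  have hFx : ∀ x ∈ Ω, F x ∈ y'.source := fun x hx => h'.source_eq ▸ hF.2.2.1 hx
  have hz := y.map_source hxs
  have hLx : L (y x) = y' (F x) := by rw [← hLT _ hz, y.left_inv hxs]
  rw [← hLx]
  refine hL.flatBox_eq h.model h'.model hz ?_ ?_
  · rw [hLx]
    have h1 := contMDiffAt_symm_of_mem_maximalAtlas h'.mem (y'.map_source (hFx x hx))
    have h2 : ContMDiffAt (𝓡 n) 𝓘(ℝ, ℂ) ∞ f (y'.symm (y' (F x))) := by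
      rwa [y'.left_inv (hFx x hx)]
    exact (h2.comp _ h1).contDiffAt
  · filter_upwards [y.open_target.mem_nhds hz] with q hq
    have : y.symm q ∈ Ω := h.source_eq ▸ y.map_target hq
    simp only [Function.comp, ← hLT q hq, y'.left_inv (hFx _ this)]

/-- Compose the chart with the inverse of F. In the two charts F becomes the identity, so phase and
covariant Hessian have the same coordinate expressions. -/
theorem IsFlatChart.exists_push (h : IsFlatChart C Φ Ω y) (hΩ' : IsOpen Ω')
    (hF : IsStructureEmbedding C Φ Ω C' Φ' Ω' F) (hsurj : SurjOn F Ω Ω') :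
    ∃ y', IsFlatChart C' Φ' Ω' y' := by
  obtain ⟨hloc, hinj, hmaps, hphase, hpres⟩ := hF
  have hΩ : IsOpen Ω := h.source_eq ▸ y.open_source
  rcases isEmpty_or_nonempty M with hM | hM
  · exact (hM.false (y.symm 0)).elim
  let G : M' → M := Function.invFunOn F Ω
  have hG : ∀ q ∈ Ω', G q ∈ Ω ∧ F (G q) = q := fun q hq =>
    ⟨Function.invFunOn_mem (hsurj hq), Function.invFunOn_eq (hsurj hq)⟩
  have hGF : ∀ x ∈ Ω, G (F x) = x := fun x hx =>
    hinj (hG _ (hmaps hx)).1 hx (hG _ (hmaps hx)).2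
  have hGs : ContMDiffOn (𝓡 n) (𝓡 n) ∞ G Ω' := by
    intro q hq
    obtain ⟨Ψ, hΨ, hFΨ⟩ := hloc ⟨G q, (hG q hq).1⟩
    have hq' : Ψ.toOpenPartialHomeomorph (G q) = q := (hFΨ hΨ).symm.trans (hG q hq).2
    have hqt : q ∈ Ψ.target := hq' ▸ Ψ.toOpenPartialHomeomorph.map_source hΨ
    have hs : ContMDiffAt (𝓡 n) (𝓡 n) ∞ Ψ.symm q :=
      Ψ.contMDiffOn_invFun.contMDiffAt (Ψ.open_target.mem_nhds hqt)
    have hsq : Ψ.symm q = G q := by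
      have := Ψ.toOpenPartialHomeomorph.left_inv hΨ
      rw [hq'] at this
      exact this
    refine (hs.congr_of_eventuallyEq ?_).contMDiffWithinAt
    have hev : ∀ᶠ r in 𝓝 q, Ψ.symm r ∈ Ω :=
      hs.continuousAt.preimage_mem_nhds (by rw [hsq]; exact hΩ.mem_nhds (hG q hq).1)
    filter_upwards [hev, Ψ.open_target.mem_nhds hqt] with r hr hrt
    have h1 : F (Ψ.symm r) = r :=
      (hFΨ (Ψ.toOpenPartialHomeomorph.map_target hrt)).trans
        (Ψ.toOpenPartialHomeomorph.right_inv hrt)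
    rw [← hGF _ hr, h1]
  have hFs : ContMDiffOn (𝓡 n) (𝓡 n) ∞ F Ω := fun x hx =>
    (hloc ⟨x, hx⟩).contMDiffAt.contMDiffWithinAt
  have hsrc : ∀ z ∈ y.target, y.symm z ∈ Ω := fun z hz => h.source_eq ▸ y.map_target hz
  have hys : ContMDiffOn (𝓡 n) (𝓡 n) ∞ y Ω :=
    h.source_eq ▸ contMDiffOn_of_mem_maximalAtlas h.mem
  have hto : ContMDiffOn (𝓡 n) (𝓡 n) ∞ (fun q => y (G q)) Ω' :=
    hys.comp hGs fun q hq => (hG q hq).1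
  have hinv : ContMDiffOn (𝓡 n) (𝓡 n) ∞ (fun z => F (y.symm z)) y.target :=
    hFs.comp (contMDiffOn_symm_of_mem_maximalAtlas h.mem) hsrc
  let y' : OpenPartialHomeomorph M' (𝔼 n) :=
    { toFun := fun q => y (G q)
      invFun := fun z => F (y.symm z)
      source := Ω'
      target := y.target
      map_source' := fun q hq => y.map_source (h.source_eq ▸ (hG q hq).1)
      map_target' := fun z hz => hmaps (hsrc z hz)
      left_inv' := fun q hq => by
        rw [y.left_inv (h.source_eq ▸ (hG q hq).1), (hG q hq).2]
      right_inv' := fun z hz => by rw [hGF _ (hsrc z hz), y.right_inv hz]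
      open_source := hΩ'
      open_target := y.open_target
      continuousOn_toFun := hto.continuousOn
      continuousOn_invFun := hinv.continuousOn }
  have hmem : y' ∈ IsManifold.maximalAtlas (𝓡 n) ∞ M' :=
    y'.mem_maximalAtlas_of_contMDiffOn hto hinv
  let T : 𝔼 n → 𝔼 n := fun z => y' (F (y.symm z))
  have hT : ∀ z ∈ y.target, T z = z := fun z hz => y'.right_inv (x := z) hz
  have hTev : ∀ z ∈ y.target, T =ᶠ[𝓝 z] id := fun z hz =>
    eventuallyEq_of_mem (y.open_target.mem_nhds hz) hT
  have hu : EqOn (Φ' ∘ y'.symm) (Φ ∘ y.symm) y.target := fun z hz => hphase _ (hsrc z hz)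
  refine ⟨y', hmem, rfl, h.model.congr hu fun z hz => ?_⟩
  have hev : Φ' ∘ y'.symm =ᶠ[𝓝 z] Φ ∘ y.symm := hu.eventuallyEq_of_mem (y.open_target.mem_nhds hz)
  have hs : ContDiffAt ℝ ∞ (Φ' ∘ y'.symm) z :=
    (h.model.smooth_phase.contDiffAt (y.open_target.mem_nhds hz)).congr_of_eventuallyEq hev
  have hcoord := covariantHess_coord (T := T) (Φ := Φ) (Φ' := Φ') h.mem hmem hΩ hloc hpres
    (y.map_target hz) (hsrc z hz) (hmaps (hsrc z hz)) rfl
  rw [y.right_inv hz, hT z hz] at hcoord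
  have hDT : fderiv ℝ T z = .id ℝ (𝔼 n) := by rw [(hTev z hz).fderiv_eq, fderiv_id]
  ext v w
  have := hcoord hs (hev.symm.trans (by
    filter_upwards [y.open_target.mem_nhds hz] with q hq
    simp only [Function.comp, hT q hq])) v w
  rwa [hDT] at this

theorem mfderiv_eq_fderiv_coord (hy : y ∈ IsManifold.maximalAtlas (𝓡 n) ∞ M) {x : M}
    (hx : x ∈ y.source) (hΦ : DifferentiableAt ℝ (Φ ∘ y.symm) (y x)) (v : TangentSpace (𝓡 n) x) :
    mfderiv (𝓡 n) 𝓘(ℝ, ℝ) Φ x v = fderiv ℝ (Φ ∘ y.symm) (y x) (mfderiv (𝓡 n) (𝓡 n) y x v) := by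
  have h1 := hΦ.hasFDerivAt.hasMFDerivAt.comp x
    ((contMDiffAt_of_mem_maximalAtlas hy hx).mdifferentiableAt (by simp)).hasMFDerivAt
  have h2 : (Φ ∘ y.symm) ∘ y =ᶠ[𝓝 x] Φ := by
    filter_upwards [y.open_source.mem_nhds hx] with q hq
    simp [y.left_inv hq]
  have h3 := (h1.congr_of_eventuallyEq h2.symm).mfderiv
  exact DFunLike.congr_fun h3 v

theorem mfderiv_eq_zero_iff_fderiv_coord (hy : y ∈ IsManifold.maximalAtlas (𝓡 n) ∞ M) {x : M}
    (hx : x ∈ y.source) (hΦ : DifferentiableAt ℝ (Φ ∘ y.symm) (y x)) :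
    mfderiv (𝓡 n) 𝓘(ℝ, ℝ) Φ x = 0 ↔ fderiv ℝ (Φ ∘ y.symm) (y x) = 0 := by
  constructor
  · intro h0
    ext v
    have h2 := mfderiv_eq_fderiv_coord hy hx hΦ ((mfderiv (𝓡 n) (𝓡 n) y x).inverse v)
    have h3 : mfderiv (𝓡 n) (𝓡 n) y x ((mfderiv (𝓡 n) (𝓡 n) y x).inverse v) = v :=
      mfderiv_chartField hy (g := fun _ => v) hx
    rw [h0, h3] at h2
    exact h2.symm
  · intro h0
    ext v
    refine (mfderiv_eq_fderiv_coord hy hx hΦ v).trans ?_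
    rw [h0]
    rfl

/-- Since Du(z) = H(z)z with H(z) invertible, the differential vanishes only at z = 0. -/
theorem IsFlatChart.mfderiv_eq_zero_iff (h : IsFlatChart C Φ Ω y) {x : M} (hx : x ∈ Ω) :
    mfderiv (𝓡 n) 𝓘(ℝ, ℝ) Φ x = 0 ↔ x = y.symm 0 := by
  have hxs : x ∈ y.source := h.source_eq ▸ hx
  have hz := y.map_source hxs
  have hcrit : x = y.symm 0 ↔ y x = 0 :=
    ⟨fun hx0 => by rw [hx0, y.right_inv h.model.zero_mem], fun h0 => by rw [← h0, y.left_inv hxs]⟩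
  rw [hcrit, mfderiv_eq_zero_iff_fderiv_coord h.mem hxs
    ((h.model.smooth_phase.contDiffAt (y.open_target.mem_nhds hz)).differentiableAt (by simp)),
    ← h.model.euler _ hz]
  obtain ⟨e, he⟩ := h.model.isInvertible _ hz
  rw [← he]
  exact map_eq_zero_iff e e.injective

/-- At a critical point the second derivative changes tensorially between charts, so nondegeneracy
in the preferred chart follows from invertibility of D²u(0) = H(0). -/
theorem IsFlatChart.isNondegenerateCriticalPoint (h : IsFlatChart C Φ Ω y) :
    IsNondegenerateCriticalPoint (n := n) Φ (y.symm 0) := by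
  set p := y.symm 0 with hp
  have hps : p ∈ y.source := y.map_target h.model.zero_mem
  have hyp : y p = 0 := y.right_inv h.model.zero_mem
  refine ⟨(h.mfderiv_eq_zero_iff (h.source_eq ▸ hps)).2 rfl, fun v hv => ?_⟩
  set χ := chartAt (𝔼 n) p
  have hχ : χ ∈ IsManifold.maximalAtlas (𝓡 n) ∞ M := IsManifold.chart_mem_maximalAtlas p
  have hpχ : p ∈ χ.source := mem_chart_source _ p
  let T : 𝔼 n → 𝔼 n := fun z => y (id (χ.symm z))
  have hTp : T (χ p) = 0 := by simp [T, χ.left_inv hpχ, hyp]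
  have hTs : ContDiffAt ℝ ∞ T (χ p) := contDiffAt_coord hχ h.mem hpχ contMDiffAt_id hps
  obtain ⟨k, hk⟩ := isInvertible_fderiv_coord (F := id) hχ h.mem hpχ
    ((Diffeomorph.refl (𝓡 n) M ∞).isLocalDiffeomorph p) hps
  have hev : Φ ∘ χ.symm =ᶠ[𝓝 (χ p)] (Φ ∘ y.symm) ∘ T := by
    filter_upwards [(χ.tendsto_symm hpχ).eventually (y.open_source.mem_nhds hps)] with z hz
    simp [T, y.left_inv hz]
  have hu : ContDiffAt ℝ ∞ (Φ ∘ y.symm) (T (χ p)) := by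
    rw [hTp]
    exact h.model.smooth_phase.contDiffAt (y.open_target.mem_nhds h.model.zero_mem)
  have hdu : fderiv ℝ (Φ ∘ y.symm) 0 = 0 := by
    rw [← h.model.euler 0 h.model.zero_mem, map_zero]
  obtain ⟨e, he⟩ := h.model.isInvertible 0 h.model.zero_mem
  have h1 : covariantHess C Φ y 0 (fderiv ℝ T (χ p) v) = 0 := by
    ext w
    have h2 := hv (k.symm w)
    rw [hev.fderiv.fderiv_eq, fderiv_fderiv_comp hu hTs, hTp, hdu, h.model.fderiv_fderiv_zero] at h2
    have h3 : fderiv ℝ T (χ p) (k.symm w) = w := by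
      change fderiv ℝ (fun z => y (id (χ.symm z))) (χ p) (k.symm w) = w
      rw [← hk]
      exact k.apply_symm_apply w
    rw [h3] at h2
    simpa using h2
  rw [← he] at h1
  have h4 := (map_eq_zero_iff e e.injective).1 h1
  change fderiv ℝ (fun z => y (id (χ.symm z))) (χ p) v = 0 at h4
  rw [← hk] at h4
  exact (map_eq_zero_iff k k.injective).1 h4

end FlatCharts

/-- The domains on which the gradient field of the phase can be linearized. -/
def flatAdmissibility (n : ℕ) : AdmissibilityRule.{u} n :=
  fun _ _ _ _ _ C Φ Ω => ∃ y, IsFlatChart C Φ Ω y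

open Classical in
/-- The operator, computed in any linearizing chart. -/
def flatOperator (n : ℕ) : OperatorRule.{u} n :=
  fun _ _ _ _ _ C Φ Ω f x =>
    if h : ∃ y, IsFlatChart C Φ Ω y then
      flatBox (Φ ∘ h.choose.symm) (covariantHess C Φ h.choose) (f ∘ h.choose.symm) (h.choose x)
    else 0

/-- Charts are pushed forward along surjective embeddings. Transitions between flat charts are
linear, and `flatBox` is natural under linear maps, so the charts picked by choice do not matter. -/
theorem isIntrinsic_flat (n : ℕ) :
    IsIntrinsic (flatAdmissibility.{u} n) (flatOperator.{u} n) := by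
  intro M M' _ _ _ _ _ _ _ _ C C' Φ Φ' Ω Ω' F _ hΩ' hF hadm
  refine ⟨fun hs => hadm.choose_spec.exists_push hΩ' hF hs, fun hadm' x hx f hf => ?_⟩
  have h1 : ∃ y, IsFlatChart C Φ Ω y := hadm
  have h2 : ∃ y, IsFlatChart C' Φ' Ω' y := hadm'
  rw [flatOperator, flatOperator, dif_pos h1, dif_pos h2]
  exact h1.choose_spec.flatBox_eq h2.choose_spec hF hx hf

section OperatorEquation

variable {n : ℕ} {M : Type u} [TopologicalSpace M] [T2Space M]
  [ChartedSpace (EuclideanSpace ℝ (Fin n)) M] [IsManifold (𝓡 n) ∞ M]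
  {C : TorsionFreeConnection n M} {Φ : M → ℝ} {Ω : Set M}
  {y : OpenPartialHomeomorph M (EuclideanSpace ℝ (Fin n))}

/-- Applied to the identity, naturality says that the operator may be computed in any flat chart.
Preservation of the connection is here the locality of the covariant derivative. -/
theorem isStructureEmbedding_id (C : TorsionFreeConnection n M) (Φ : M → ℝ) (Ω : Set M) :
    IsStructureEmbedding C Φ Ω C Φ Ω id := by
  refine ⟨fun x => (Diffeomorph.refl (𝓡 n) M ∞).isLocalDiffeomorph x, injOn_id Ω, mapsTo_id Ω,
    fun _ _ => rfl, fun x _ Y Y' hY hY' hYY' v => ?_⟩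
  have h1 : C.cov Y x = C.cov Y' x := by
    refine C.cov.isCovariantDerivativeOnUniv.congr_of_eventuallyEq
      (hY.mdifferentiableAt (by simp)) (hY'.mdifferentiableAt (by simp)) univ_mem ?_
    filter_upwards [hYY'] with z hz
    simpa [mfderiv_id] using hz
  simp only [mfderiv_id, id, ContinuousLinearMap.id_apply, h1]

theorem IsFlatChart.flatOperator_eq (h : IsFlatChart C Φ Ω y) {x : M} (hx : x ∈ Ω) {f : M → ℂ}
    (hf : ContMDiffAt (𝓡 n) 𝓘(ℝ, ℂ) ∞ f x) :
    flatOperator n M C Φ Ω f x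
      = flatBox (Φ ∘ y.symm) (covariantHess C Φ y) (f ∘ y.symm) (y x) := by
  have h1 : ∃ y, IsFlatChart C Φ Ω y := ⟨y, h⟩
  rw [flatOperator, dif_pos h1]
  exact h1.choose_spec.flatBox_eq h (isStructureEmbedding_id C Φ Ω) hx hf

theorem IsFlatChart.exists_criticalPoint (h : IsFlatChart C Φ Ω y) :
    ∃ p' ∈ Ω, IsNondegenerateCriticalPoint (n := n) Φ p' ∧
      (∀ q ∈ Ω, mfderiv (𝓡 n) 𝓘(ℝ, ℝ) Φ q = 0 → q = p') ∧
      SolvesSchrodingerOn n Φ p' Ω (flatOperator n M C Φ Ω) := by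
  have h1 : ∃ y, IsFlatChart C Φ Ω y := ⟨y, h⟩
  have hc := h1.choose_spec
  set c := h1.choose with hcdef
  refine ⟨c.symm 0, hc.source_eq ▸ c.map_target hc.model.zero_mem,
    hc.isNondegenerateCriticalPoint, fun q hq => (hc.mfderiv_eq_zero_iff hq).1, ?_⟩
  intro t ht x hx
  have hxs : x ∈ c.source := hc.source_eq ▸ hx
  have := hc.model.hasDerivAt_wave (c.map_source hxs) ht
  rw [flatOperator, dif_pos h1, ← hcdef]
  simp only [Function.comp, c.left_inv hxs] at this
  exact this

end OperatorEquation

/-! ### Coefficients of the operator in arbitrary coordinates. -/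

section SmoothCoefficients

variable {n k : ℕ}

/-- The second-order coefficients of the flat operator in the coordinates `T`. -/
def flatSymbol (H : 𝔼 n → 𝔼 n →L[ℝ] 𝔼 n →L[ℝ] ℝ) (T : 𝔼 n → 𝔼 n) (z : 𝔼 n) (i j : Fin n) : ℝ :=
  contractForms (fun ξ η => principalForm H z ξ η)
    (fun v w => fderiv ℝ T z v i * fderiv ℝ T z w j)

theorem clm_apply_eq_sum {F : Type*} [NormedAddCommGroup F] [NormedSpace ℝ F]
    (l : 𝔼 n →L[ℝ] F) (v : 𝔼 n) : l v = ∑ i, v i • l (EuclideanSpace.single i 1) := by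
  conv_lhs => rw [EuclideanSpace.eq_sum_single v]
  simp

/-- In the chain rule the drift and the second derivatives of T combine into `flatBox` of the
vector-valued function T. Its components are the first-order coefficients. -/
theorem flatBox_comp {u : 𝔼 n → ℝ} {H : 𝔼 n → 𝔼 n →L[ℝ] 𝔼 n →L[ℝ] ℝ} {T : 𝔼 n → 𝔼 n}
    {f : 𝔼 n → ℂ} {z : 𝔼 n} (hf : ContDiffAt ℝ ∞ f (T z)) (hT : ContDiffAt ℝ ∞ T z) :
    flatBox u H (f ∘ T) z
      = (∑ i, ∑ j, (flatSymbol H T z i j : ℂ) *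
          fderiv ℝ (fun y => fderiv ℝ f y (EuclideanSpace.single j 1)) (T z)
            (EuclideanSpace.single i 1))
        + ∑ i, (flatBox u H T z i : ℂ) * fderiv ℝ f (T z) (EuclideanSpace.single i 1) := by
  have hd : DifferentiableAt ℝ (fderiv ℝ f) (T z) :=
    (hf.fderiv_right (m := ∞) le_rfl).differentiableAt (by simp)
  have h1 : fderiv ℝ (f ∘ T) z = (fderiv ℝ f (T z)).comp (fderiv ℝ T z) :=
    fderiv_comp _ (hf.differentiableAt (by simp)) (hT.differentiableAt (by simp))
  have h2 : ∀ i j : Fin n, fderiv ℝ (fun y => fderiv ℝ f y (EuclideanSpace.single j 1)) (T z)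
      (EuclideanSpace.single i 1)
      = fderiv ℝ (fderiv ℝ f) (T z) (EuclideanSpace.single i 1) (EuclideanSpace.single j 1) := by
    intro i j
    rw [fderiv_clm_apply hd (differentiableAt_const _)]
    simp
  have h3 : flatBox u H (f ∘ T) z
      = contractForms (fun ξ η => principalForm H z ξ η)
          (fun v w => fderiv ℝ (fderiv ℝ f) (T z) (fderiv ℝ T z v) (fderiv ℝ T z w))
        + fderiv ℝ f (T z) (flatBox u H T z) := by
    simp only [flatBox, contractForms, fderiv_fderiv_comp hf hT, h1, smul_add,
      Finset.sum_add_distrib, map_add, map_sum, map_smul, ContinuousLinearMap.comp_apply, add_assoc]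
  rw [h3]
  congr 1
  · have h4 : ∀ v w : 𝔼 n, fderiv ℝ (fderiv ℝ f) (T z) v w = ∑ i, ∑ j, (v i * w j) •
        fderiv ℝ (fderiv ℝ f) (T z) (EuclideanSpace.single i 1) (EuclideanSpace.single j 1) := by
      intro v w
      rw [clm_apply_eq_sum _ v, sum_apply]
      refine Finset.sum_congr rfl fun i _ => ?_
      rw [smul_apply, clm_apply_eq_sum _ w, Finset.smul_sum]
      simp only [smul_smul]
    simp only [h2, flatSymbol, contractForms, Complex.ofReal_sum]
    simp_rw [h4 (fderiv ℝ T z _), Finset.smul_sum, Finset.sum_mul]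
    rw [Finset.sum_congr rfl fun a _ => Finset.sum_comm, Finset.sum_comm]
    refine Finset.sum_congr rfl fun i _ => ?_
    rw [Finset.sum_congr rfl fun a _ => Finset.sum_comm, Finset.sum_comm]
    refine Finset.sum_congr rfl fun j _ => ?_
    refine Finset.sum_congr rfl fun a _ => Finset.sum_congr rfl fun b _ => ?_
    simp only [Complex.real_smul, smul_eq_mul, Complex.ofReal_mul, mul_assoc]
  · rw [clm_apply_eq_sum]
    simp

theorem IsSmoothFlatFamily.smooth_flatSymbol {P : Type} [NormedAddCommGroup P] [NormedSpace ℝ P]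
    {D D' : Set (P × 𝔼 n)} {u : P × 𝔼 n → ℝ} {H : P × 𝔼 n → 𝔼 n →L[ℝ] 𝔼 n →L[ℝ] ℝ}
    (h : IsSmoothFlatFamily D u H) (hD' : IsOpen D') (hsub : D' ⊆ D) {T : P × 𝔼 n → 𝔼 n}
    (hT : ContDiffOn ℝ ∞ T D') (i j : Fin n) :
    ContDiffOn ℝ ∞ (fun q : P × 𝔼 n =>
      flatSymbol (fun z => H (q.1, z)) (fun z => T (q.1, z)) q.2 i j) D' := by
  have h1 := hT.partial_fderiv hD'
  have h2 : ∀ (v : 𝔼 n) (i : Fin n), ContDiffOn ℝ ∞ (fun q : P × 𝔼 n =>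
      (fderiv ℝ (fun z => T (q.1, z)) q.2 v : 𝔼 n) i) D' := fun v i =>
    (EuclideanSpace.proj i : 𝔼 n →L[ℝ] ℝ).contDiff.comp_contDiffOn
      (h1.clm_apply (contDiffOn_const (c := v)))
  simp only [flatSymbol, contractForms]
  refine ContDiffOn.sum fun a _ => ContDiffOn.sum fun b _ => ?_
  exact ((h.smooth_principalForm _ _).mono hsub).smul ((h2 _ _).mul (h2 _ _))

theorem IsSmoothFlatFamily.smooth_flatBox {P : Type} [NormedAddCommGroup P] [NormedSpace ℝ P]
    {D D' : Set (P × 𝔼 n)} {u : P × 𝔼 n → ℝ} {H : P × 𝔼 n → 𝔼 n →L[ℝ] 𝔼 n →L[ℝ] ℝ}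
    (h : IsSmoothFlatFamily D u H) (hD' : IsOpen D') (hsub : D' ⊆ D) {T : P × 𝔼 n → 𝔼 n}
    (hT : ContDiffOn ℝ ∞ T D') :
    ContDiffOn ℝ ∞ (fun q : P × 𝔼 n =>
      flatBox (fun z => u (q.1, z)) (fun z => H (q.1, z)) (fun z => T (q.1, z)) q.2) D' := by
  have h1 := hT.partial_fderiv hD'
  have h2 := h1.partial_fderiv hD'
  refine ContDiffOn.add (ContDiffOn.sum fun a _ => ContDiffOn.sum fun b _ => ?_)
    (ContDiffOn.sum fun i _ => ?_)
  · exact ((h.smooth_principalForm _ _).mono hsub).smul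
      ((h2.clm_apply contDiffOn_const).clm_apply contDiffOn_const)
  · exact ((h.smooth_driftCoeff _).mono hsub).smul (h1.clm_apply contDiffOn_const)

end SmoothCoefficients

/-! ### Joint smoothness of the operators in parameter and point. -/

section FlatFamilies

variable {n k : ℕ} {M : Type u} [TopologicalSpace M] [T2Space M]
  [ChartedSpace (EuclideanSpace ℝ (Fin n)) M] [IsManifold (𝓡 n) ∞ M]

/-- The domain of a family of inverse charts. -/
def chartFamilyTarget (S : Set (𝔼 k)) (y : 𝔼 k → OpenPartialHomeomorph M (𝔼 n)) :
    Set (𝔼 k × 𝔼 n) :=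
  {q | q.1 ∈ S ∧ q.2 ∈ (y q.1).target}

/-- A jointly smooth family of linearizing charts of a fixed domain. -/
structure IsSmoothFlatChartFamily (S : Set (𝔼 k)) (C : 𝔼 k → TorsionFreeConnection n M)
    (Φ : 𝔼 k → M → ℝ) (Ω : Set M) (y : 𝔼 k → OpenPartialHomeomorph M (𝔼 n)) : Prop where
  chart : ∀ s ∈ S, IsFlatChart (C s) (Φ s) Ω (y s)
  family : IsSmoothFlatFamily (chartFamilyTarget S y) (fun q => Φ q.1 ((y q.1).symm q.2))
    (fun q => covariantHess (C q.1) (Φ q.1) (y q.1) q.2)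
  smooth : ContMDiffOn ((𝓡 k).prod (𝓡 n)) (𝓡 n) ∞ (fun q : 𝔼 k × M => y q.1 q.2) (S ×ˢ Ω)
  smooth_symm : ContMDiffOn 𝓘(ℝ, 𝔼 k × 𝔼 n) (𝓡 n) ∞ (fun q : 𝔼 k × 𝔼 n => (y q.1).symm q.2)
    (chartFamilyTarget S y)

theorem IsSmoothFlatChartFamily.isSmoothFamilyOfSecondOrderOperatorsOn {S : Set (𝔼 k)}
    {C : 𝔼 k → TorsionFreeConnection n M} {Φ : 𝔼 k → M → ℝ} {Ω : Set M}
    {y : 𝔼 k → OpenPartialHomeomorph M (𝔼 n)} (h : IsSmoothFlatChartFamily S C Φ Ω y) :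
    IsSmoothFamilyOfSecondOrderOperatorsOn (n := n) S Ω
      (fun s => flatOperator n M (C s) (Φ s) Ω) := by
  intro φ hφ
  let D' := chartFamilyTarget S y ∩ (fun q : 𝔼 k × 𝔼 n => (y q.1).symm q.2) ⁻¹' φ.source
  have hD' : IsOpen D' :=
    h.smooth_symm.continuousOn.isOpen_inter_preimage h.family.isOpen φ.open_source
  let T : 𝔼 k × 𝔼 n → 𝔼 n := fun q => φ ((y q.1).symm q.2)
  have hT : ContDiffOn ℝ ∞ T D' := contMDiffOn_iff_contDiffOn.1
    ((contMDiffOn_of_mem_maximalAtlas hφ).comp (h.smooth_symm.mono inter_subset_left)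
      fun q hq => hq.2)
  have hsub : D' ⊆ chartFamilyTarget S y := inter_subset_left
  have hsrc : ∀ s ∈ S, ∀ x ∈ Ω, x ∈ (y s).source := fun s hs x hx => (h.chart s hs).source_eq ▸ hx
  let j : 𝔼 k × M → 𝔼 k × 𝔼 n := fun q => (q.1, y q.1 q.2)
  have hj : ContMDiffOn ((𝓡 k).prod (𝓡 n)) 𝓘(ℝ, 𝔼 k × 𝔼 n) ∞ j (S ×ˢ (Ω ∩ φ.source)) :=
    contMDiffOn_fst.prodMk_space
      (h.smooth.mono (prod_mono subset_rfl inter_subset_left))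
  have hjm : MapsTo j (S ×ˢ (Ω ∩ φ.source)) D' := by
    rintro ⟨s, x⟩ ⟨hs, hx, hxφ⟩
    refine ⟨⟨hs, (y s).map_source (hsrc s hs x hx)⟩, ?_⟩
    change (y s).symm (y s x) ∈ φ.source
    rwa [(y s).left_inv (hsrc s hs x hx)]
  let a : 𝔼 k × 𝔼 n → Fin n → Fin n → ℝ := fun q i l =>
    flatSymbol (covariantHess (C q.1) (Φ q.1) (y q.1)) (fun z => T (q.1, z)) q.2 i l
  let b : 𝔼 k × 𝔼 n → Fin n → ℝ := fun q i =>
    flatBox (Φ q.1 ∘ (y q.1).symm) (covariantHess (C q.1) (Φ q.1) (y q.1))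
      (fun z => T (q.1, z)) q.2 i
  have ha : ContDiffOn ℝ ∞ a D' := contDiffOn_pi.2 fun i => contDiffOn_pi.2 fun l =>
    h.family.smooth_flatSymbol hD' hsub hT i l
  have hb : ContDiffOn ℝ ∞ b D' := contDiffOn_pi.2 fun i =>
    (EuclideanSpace.proj i : 𝔼 n →L[ℝ] ℝ).contDiff.comp_contDiffOn
      (h.family.smooth_flatBox hD' hsub hT)
  -- The coefficients are smooth in the parameter and the linearizing coordinates, and j expresses
  -- those through the point of M. There is no zeroth-order term.
  refine ⟨fun q => a (j q), fun q => b (j q), fun _ => 0, ha.contMDiffOn.comp hj hjm,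
    hb.contMDiffOn.comp hj hjm, contMDiffOn_const, ?_⟩
  rintro s hs x ⟨hx, hxφ⟩ f hf
  have hxs := hsrc s hs x hx
  refine ((h.chart s hs).flatOperator_eq hx hf).trans ?_
  have hz := (y s).map_source hxs
  have hTz : T (s, y s x) = φ x := by simp only [T, (y s).left_inv hxs]
  have hTs : ContDiffAt ℝ ∞ (fun z => T (s, z)) (y s x) :=
    (hT.contDiffAt (hD'.mem_nhds (hjm (x := (s, x)) ⟨hs, hx, hxφ⟩))).comp (y s x)
      (contDiff_const.prodMk contDiff_id).contDiffAt
  have hfs : ContDiffAt ℝ ∞ (f ∘ φ.symm) (T (s, y s x)) := by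
    rw [hTz]
    have h1 := contMDiffAt_symm_of_mem_maximalAtlas hφ (φ.map_source hxφ)
    have h2 : ContMDiffAt (𝓡 n) 𝓘(ℝ, ℂ) ∞ f (φ.symm (φ x)) := by rwa [φ.left_inv hxφ]
    exact (h2.comp _ h1).contDiffAt
  have hev : f ∘ (y s).symm =ᶠ[𝓝 (y s x)] (f ∘ φ.symm) ∘ fun z => T (s, z) := by
    filter_upwards [((y s).tendsto_symm hxs).eventually (φ.open_source.mem_nhds hxφ)] with z hz
    simp [T, φ.left_inv hz]
  have hcongr : flatBox (Φ s ∘ (y s).symm) (covariantHess (C s) (Φ s) (y s)) (f ∘ (y s).symm)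
      (y s x) = flatBox (Φ s ∘ (y s).symm) (covariantHess (C s) (Φ s) (y s))
        ((f ∘ φ.symm) ∘ fun z => T (s, z)) (y s x) := by
    rw [flatBox, flatBox, hev.fderiv.fderiv_eq, hev.fderiv_eq]
  rw [hcongr, flatBox_comp hfs hTs, hTz]
  simp [secondOrderExpr, a, b, j]

end FlatFamilies

/-! ### Uniform control of the gradient field under perturbations. -/

section UniformEstimates

variable {E : Type} [NormedAddCommGroup E] [NormedSpace ℝ E] [FiniteDimensional ℝ E]

/-- The covariant Hessian as a function of the differential and the Hessian of the phase and the
connection form. -/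
def jetHessian (J : (E →L[ℝ] ℝ) × (E →L[ℝ] E →L[ℝ] ℝ) × (E →L[ℝ] E →L[ℝ] E)) :
    E →L[ℝ] E →L[ℝ] ℝ :=
  J.2.1 - (ContinuousLinearMap.compL ℝ E E ℝ J.1).comp J.2.2

/-- The gradient with respect to the covariant Hessian. -/
def jetGradient (J : (E →L[ℝ] ℝ) × (E →L[ℝ] E →L[ℝ] ℝ) × (E →L[ℝ] E →L[ℝ] E)) : E :=
  (jetHessian J).inverse J.1

/-- The jet of a phase and a connection form. -/
def phaseJet (φ : E → ℝ) (Γ : E → E →L[ℝ] E →L[ℝ] E) (x : E) :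
    (E →L[ℝ] ℝ) × (E →L[ℝ] E →L[ℝ] ℝ) × (E →L[ℝ] E →L[ℝ] E) :=
  (fderiv ℝ φ x, fderiv ℝ (fderiv ℝ φ) x, Γ x)

theorem contDiff_jetHessian : ContDiff ℝ ∞ (jetHessian (E := E)) := by
  unfold jetHessian
  exact contDiff_snd.fst.sub
    (((ContinuousLinearMap.compL ℝ E E ℝ).contDiff.comp contDiff_fst).clm_comp contDiff_snd.snd)

theorem isOpen_setOf_isInvertible_jetHessian :
    IsOpen {J : (E →L[ℝ] ℝ) × (E →L[ℝ] E →L[ℝ] ℝ) × (E →L[ℝ] E →L[ℝ] E) |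
      (jetHessian J).IsInvertible} :=
  ContinuousLinearEquiv.isOpen.preimage contDiff_jetHessian.continuous

theorem contDiffOn_jetGradient : ContDiffOn ℝ ∞ (jetGradient (E := E))
    {J | (jetHessian J).IsInvertible} := by
  intro J ⟨e, he⟩
  have h1 : ContDiffAt ℝ ∞ ContinuousLinearMap.inverse (jetHessian J) := by
    rw [← he]; exact contDiffAt_map_inverse e
  exact ((h1.comp J contDiff_jetHessian.contDiffAt).clm_apply contDiffAt_fst).contDiffWithinAt

theorem ContDiffOn.phaseJet {φ : E → ℝ} {Γ : E → E →L[ℝ] E →L[ℝ] E} {B : Set E} (hB : IsOpen B)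
    (hφ : ContDiffOn ℝ ∞ φ B) (hΓ : ContDiffOn ℝ ∞ Γ B) : ContDiffOn ℝ ∞ (phaseJet φ Γ) B :=
  have h1 : ContDiffOn ℝ ∞ (fderiv ℝ φ) B := hφ.fderiv_of_isOpen hB le_rfl
  h1.prodMk ((h1.fderiv_of_isOpen hB le_rfl : ContDiffOn ℝ ∞ _ B).prodMk hΓ)

theorem norm_fderiv_fderiv_comp_le {X Y F : Type*} [NormedAddCommGroup X] [NormedSpace ℝ X]
    [NormedAddCommGroup Y] [NormedSpace ℝ Y] [NormedAddCommGroup F] [NormedSpace ℝ F]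
    {f : Y → F} {T : X → Y} {x : X} (hf : ContDiffAt ℝ ∞ f (T x)) (hT : ContDiffAt ℝ ∞ T x)
    {a b : ℝ} (h1 : ‖fderiv ℝ f (T x)‖ ≤ a) (h2 : ‖fderiv ℝ (fderiv ℝ f) (T x)‖ ≤ a)
    (h3 : ‖fderiv ℝ T x‖ ≤ b) (h4 : ‖fderiv ℝ (fderiv ℝ T) x‖ ≤ b) :
    ‖fderiv ℝ (fderiv ℝ (f ∘ T)) x‖ ≤ a * b * b + a * b := by
  have ha : 0 ≤ a := (norm_nonneg _).trans h1
  have hb : 0 ≤ b := (norm_nonneg _).trans h3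
  refine ContinuousLinearMap.opNorm_le_bound _ (by positivity) fun v =>
    ContinuousLinearMap.opNorm_le_bound _ (by positivity) fun w => ?_
  rw [fderiv_fderiv_comp hf hT]
  have e1 : ‖fderiv ℝ (fderiv ℝ f) (T x) (fderiv ℝ T x v) (fderiv ℝ T x w)‖
      ≤ a * (b * ‖v‖) * (b * ‖w‖) :=
    (ContinuousLinearMap.le_opNorm₂ _ _ _).trans (by
      gcongr
      · exact (fderiv ℝ T x).le_of_opNorm_le h3 v
      · exact (fderiv ℝ T x).le_of_opNorm_le h3 w)
  have e2 : ‖fderiv ℝ f (T x) (fderiv ℝ (fderiv ℝ T) x v w)‖ ≤ a * (b * ‖v‖ * ‖w‖) :=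
    (ContinuousLinearMap.le_of_opNorm_le _ h1 _).trans (by
      gcongr
      exact (ContinuousLinearMap.le_opNorm₂ _ _ _).trans (by gcongr))
  refine (norm_add_le _ _).trans ((add_le_add e1 e2).trans_eq (by ring))

/-- The second derivatives of `G ∘ J'` are uniformly bounded on a compact set when `J'` is close to
`J` with two derivatives. -/
theorem exists_bound_fderiv_fderiv_comp {X Y F : Type*} [NormedAddCommGroup X] [NormedSpace ℝ X]
    [NormedAddCommGroup Y] [NormedSpace ℝ Y] [ProperSpace Y] [NormedAddCommGroup F]
    [NormedSpace ℝ F] {G : Y → F} {O : Set Y} (hO : IsOpen O) (hG : ContDiffOn ℝ ∞ G O)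
    {J : X → Y} {B K : Set X} (hB : IsOpen B) (hJ : ContDiffOn ℝ ∞ J B) (hK : IsCompact K)
    (hKB : K ⊆ B) (hJO : MapsTo J K O) :
    ∃ A δ : ℝ, 0 ≤ A ∧ 0 < δ ∧ ∀ J' : X → Y, ContDiffOn ℝ ∞ J' B →
      (∀ x ∈ K, ∀ j ≤ 2, ‖iteratedFDeriv ℝ j (J' - J) x‖ ≤ δ) →
      ∀ x ∈ K, J' x ∈ O ∧ ‖fderiv ℝ (fderiv ℝ (G ∘ J')) x‖ ≤ A := by
  have hJ1 : ContDiffOn ℝ ∞ (fderiv ℝ J) B := hJ.fderiv_of_isOpen hB le_rfl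
  have hJ2 : ContDiffOn ℝ ∞ (fderiv ℝ (fderiv ℝ J)) B := hJ1.fderiv_of_isOpen hB le_rfl
  have hG1 : ContDiffOn ℝ ∞ (fderiv ℝ G) O := hG.fderiv_of_isOpen hO le_rfl
  have hG2 : ContDiffOn ℝ ∞ (fderiv ℝ (fderiv ℝ G)) O := hG1.fderiv_of_isOpen hO le_rfl
  -- A closed thickening of the compact set J(K) is compact and lies in O. The values of J' on K
  -- stay in it, and there the derivatives of G are bounded.
  obtain ⟨δ, hδ, hδO⟩ := (hK.image_of_continuousOn
    (hJ.continuousOn.mono hKB)).exists_cthickening_subset_open hO hJO.image_subset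
  have hKδ := (hK.image_of_continuousOn (hJ.continuousOn.mono hKB)).cthickening (r := δ)
  obtain ⟨a₁, ha₁⟩ := hKδ.exists_bound_of_continuousOn (hG1.continuousOn.mono hδO)
  obtain ⟨a₂, ha₂⟩ := hKδ.exists_bound_of_continuousOn (E := Y →L[ℝ] Y →L[ℝ] F) (hG2.continuousOn.mono hδO)
  obtain ⟨b₁, hb₁⟩ := hK.exists_bound_of_continuousOn (hJ1.continuousOn.mono hKB)
  obtain ⟨b₂, hb₂⟩ := hK.exists_bound_of_continuousOn (E := X →L[ℝ] X →L[ℝ] Y) (hJ2.continuousOn.mono hKB)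
  set a := max 0 (max a₁ a₂)
  set b := max 0 (max b₁ b₂)
  have ha0 : 0 ≤ a := le_max_left _ _
  have hb0 : 0 ≤ b := le_max_left _ _
  refine ⟨a * (b + 1) * (b + 1) + a * (b + 1), min δ 1, by positivity, lt_min hδ one_pos, ?_⟩
  intro J' hJ' hclose x hx
  have hxB := hB.mem_nhds (hKB hx)
  have hsub1 : ∀ x ∈ B, fderiv ℝ (J' - J) x = fderiv ℝ J' x - fderiv ℝ J x := fun x hx =>
    fderiv_sub ((hJ'.contDiffAt (hB.mem_nhds hx)).differentiableAt (by simp))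
      ((hJ.contDiffAt (hB.mem_nhds hx)).differentiableAt (by simp))
  have hd0 : ‖J' x - J x‖ ≤ δ := by
    simpa using (hclose x hx 0 (by norm_num)).trans (min_le_left _ _)
  have hd1 : ‖fderiv ℝ J' x‖ ≤ b + 1 := by
    have h1 := (hclose x hx 1 (by norm_num)).trans (min_le_right _ _)
    rw [norm_iteratedFDeriv_one, hsub1 x (hKB hx)] at h1
    have h2 : ‖fderiv ℝ J x‖ ≤ b := (hb₁ x hx).trans ((le_max_left _ _).trans (le_max_right _ _))
    have h3 := norm_le_norm_add_norm_sub' (fderiv ℝ J' x) (fderiv ℝ J x)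
    linarith
  have hd2 : ‖fderiv ℝ (fderiv ℝ J') x‖ ≤ b + 1 := by
    have h1 := (hclose x hx 2 le_rfl).trans (min_le_right _ _)
    have hJ'1 : ContDiffOn ℝ ∞ (fderiv ℝ J') B := hJ'.fderiv_of_isOpen hB le_rfl
    have hev : fderiv ℝ (J' - J) =ᶠ[𝓝 x] fderiv ℝ J' - fderiv ℝ J :=
      eventuallyEq_of_mem hxB hsub1
    rw [← norm_iteratedFDeriv_fderiv, norm_iteratedFDeriv_one, hev.fderiv_eq, fderiv_sub
      ((hJ'1.contDiffAt hxB).differentiableAt (by simp))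
      ((hJ1.contDiffAt hxB).differentiableAt (by simp))] at h1
    have h2 : ‖fderiv ℝ (fderiv ℝ J) x‖ ≤ b :=
      (hb₂ x hx).trans ((le_max_right _ _).trans (le_max_right _ _))
    have h3 := norm_le_norm_add_norm_sub' (fderiv ℝ (fderiv ℝ J') x) (fderiv ℝ (fderiv ℝ J) x)
    linarith
  have hmem : J' x ∈ Metric.cthickening δ (J '' K) :=
    Metric.mem_cthickening_of_dist_le _ (J x) _ _ (mem_image_of_mem _ hx)
      (by rwa [dist_eq_norm])
  exact ⟨hδO hmem, norm_fderiv_fderiv_comp_le (hG.contDiffAt (hO.mem_nhds (hδO hmem)))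
    (hJ'.contDiffAt hxB) ((ha₁ _ hmem).trans ((le_max_left _ _).trans (le_max_right _ _)))
    ((ha₂ _ hmem).trans ((le_max_right _ _).trans (le_max_right _ _))) hd1 hd2⟩

theorem ContDiffAt.eventually_norm_sub_lt {X Y : Type*} [NormedAddCommGroup X] [NormedSpace ℝ X]
    [NormedAddCommGroup Y] [NormedSpace ℝ Y] {f : X → Y} {x : X} (hf : ContDiffAt ℝ ∞ f x) {ε : ℝ}
    (hε : 0 < ε) : ∀ᶠ q in 𝓝 x, ‖f q - f x‖ < ε := by
  filter_upwards [hf.continuousAt.preimage_mem_nhds (Metric.ball_mem_nhds (f x) hε)] with q hq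
  exact mem_ball_iff_norm.1 hq

theorem properSpace_clm {X Y : Type*} [NormedAddCommGroup X] [NormedSpace ℝ X]
    [FiniteDimensional ℝ X] [NormedAddCommGroup Y] [NormedSpace ℝ Y] [FiniteDimensional ℝ Y] :
    ProperSpace (X →L[ℝ] Y) := FiniteDimensional.proper ℝ _

/-- At a critical point the derivative of H⁻¹ is applied to dφ = 0 and the connection term of H
vanishes, leaving (D²φ)⁻¹D²φ. -/
theorem fderiv_jetGradient_comp_phaseJet {φ : E → ℝ} {Γ : E → E →L[ℝ] E →L[ℝ] E} {x : E}
    (hφ : ContDiffAt ℝ ∞ φ x) (hΓ : ContDiffAt ℝ ∞ Γ x) (hx : fderiv ℝ φ x = 0)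
    (hi : (jetHessian (phaseJet φ Γ x)).IsInvertible) :
    fderiv ℝ (jetGradient ∘ phaseJet φ Γ) x = .id ℝ E := by
  have h1 : ContDiffAt ℝ ∞ (fderiv ℝ φ) x := hφ.fderiv_right (m := ∞) le_rfl
  have hJ : ContDiffAt ℝ ∞ (phaseJet φ Γ) x :=
    h1.prodMk ((h1.fderiv_right (m := ∞) le_rfl).prodMk hΓ)
  have hH : ContDiffAt ℝ ∞ (fun q => (jetHessian (phaseJet φ Γ q)).inverse) x := by
    obtain ⟨e, he⟩ := hi
    have h2 : ContDiffAt ℝ ∞ ContinuousLinearMap.inverse (jetHessian (phaseJet φ Γ x)) := by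
      rw [← he]; exact contDiffAt_map_inverse e
    exact h2.comp x (contDiff_jetHessian.contDiffAt.comp x hJ)
  have h3 := (hH.differentiableAt (by simp)).hasFDerivAt.clm_apply
    (h1.differentiableAt (by simp)).hasFDerivAt
  have h4 : fderiv ℝ (jetGradient ∘ phaseJet φ Γ) x = _ := h3.fderiv
  rw [h4]
  have h5 : jetHessian (phaseJet φ Γ x) = fderiv ℝ (fderiv ℝ φ) x := by
    simp only [jetHessian, phaseJet, hx, map_zero, ContinuousLinearMap.zero_comp]
    exact sub_zero (fderiv ℝ (fderiv ℝ φ) x)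
  obtain ⟨e, he⟩ := hi
  rw [h5] at he ⊢
  ext v
  simp [hx, ← he]

/-- Uniform control of the gradient field under small perturbations. -/
theorem exists_uniform_radius {φ : E → ℝ} {Γ : E → E →L[ℝ] E →L[ℝ] E} {x₀ : E} {R₀ : ℝ}
    (hR₀ : 0 < R₀) (hφ : ContDiffOn ℝ ∞ φ (Metric.ball x₀ R₀))
    (hΓ : ContDiffOn ℝ ∞ Γ (Metric.ball x₀ R₀)) (hcrit : fderiv ℝ φ x₀ = 0)
    (hnd : (fderiv ℝ (fderiv ℝ φ) x₀).IsInvertible) :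
    ∃ r R A ε : ℝ, 0 < r ∧ 9 * r ≤ R ∧ R < R₀ ∧ 0 ≤ A ∧ 32 * A * r ≤ 1 ∧ 0 < ε ∧
      ∀ (φ' : E → ℝ) (Γ' : E → E →L[ℝ] E →L[ℝ] E), ContDiffOn ℝ ∞ φ' (Metric.ball x₀ R₀) →
        ContDiffOn ℝ ∞ Γ' (Metric.ball x₀ R₀) →
        (∀ x ∈ Metric.closedBall x₀ R, ∀ j ≤ 2,
          ‖iteratedFDeriv ℝ j (phaseJet φ' Γ' - phaseJet φ Γ) x‖ ≤ ε) →
        (∀ x ∈ Metric.ball x₀ R, (jetHessian (phaseJet φ' Γ' x)).IsInvertible) ∧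
        (∀ x ∈ Metric.ball x₀ R, (fderiv ℝ (fderiv ℝ φ') x).IsInvertible) ∧
        ∃ c : E, ‖c - x₀‖ ≤ r / 8 ∧ fderiv ℝ φ' c = 0 ∧
          (∀ x ∈ Metric.ball x₀ R, fderiv ℝ φ' x = 0 → x = c) ∧
          ∀ x ∈ Metric.ball x₀ R,
            ‖fderiv ℝ (jetGradient ∘ phaseJet φ' Γ') x - ContinuousLinearMap.id ℝ E‖
              ≤ A * ‖x - c‖ := by
  have hB : IsOpen (Metric.ball x₀ R₀) := Metric.isOpen_ball
  have hx₀ : x₀ ∈ Metric.ball x₀ R₀ := Metric.mem_ball_self hR₀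
  have hJ := hφ.phaseJet hB hΓ
  have hφ1 : ContDiffOn ℝ ∞ (fderiv ℝ φ) (Metric.ball x₀ R₀) := hφ.fderiv_of_isOpen hB le_rfl
  have hφ2 : ContDiffOn ℝ ∞ (fderiv ℝ (fderiv ℝ φ)) (Metric.ball x₀ R₀) :=
    hφ1.fderiv_of_isOpen hB le_rfl
  obtain ⟨e₀, he₀⟩ := hnd
  -- A bound for the inverse Hessian at x₀; adding 1 keeps it positive in dimension 0.
  set κ : ℝ := ‖(e₀.symm : (E →L[ℝ] ℝ) →L[ℝ] E)‖ + 1 with hκ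
  have hκ0 : 0 < κ := by positivity
  have hO := isOpen_setOf_isInvertible_jetHessian (E := E)
  have hJx₀ : (jetHessian (phaseJet φ Γ x₀)).IsInvertible := by
    refine ⟨e₀, he₀.trans ?_⟩
    simp only [jetHessian, phaseJet, hcrit, map_zero, ContinuousLinearMap.zero_comp]
    exact (sub_zero (fderiv ℝ (fderiv ℝ φ) x₀)).symm
  obtain ⟨R', hR', hball⟩ : ∃ R' > 0, Metric.closedBall x₀ R' ⊆
      {x | (jetHessian (phaseJet φ Γ x)).IsInvertible ∧
        ‖fderiv ℝ (fderiv ℝ φ) x - fderiv ℝ (fderiv ℝ φ) x₀‖ < 1 / (4 * κ)} := by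
    refine Metric.nhds_basis_closedBall.mem_iff.1 (inter_mem ?_ ?_)
    · exact (hJ.contDiffAt (hB.mem_nhds hx₀)).continuousAt.preimage_mem_nhds (hO.mem_nhds hJx₀)
    · exact (hφ2.contDiffAt (hB.mem_nhds hx₀)).eventually_norm_sub_lt (by positivity)
  set R := min R' (R₀ / 2) with hR
  have hR0 : 0 < R := lt_min hR' (by linarith)
  have hRR : R < R₀ := (min_le_right _ _).trans_lt (by linarith)
  have hsubO : ∀ x ∈ Metric.closedBall x₀ R, (jetHessian (phaseJet φ Γ x)).IsInvertible ∧
      ‖fderiv ℝ (fderiv ℝ φ) x - fderiv ℝ (fderiv ℝ φ) x₀‖ < 1 / (4 * κ) := fun x hx =>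
    hball (Metric.closedBall_subset_closedBall (min_le_left _ _) hx)
  have hsubB : Metric.closedBall x₀ R ⊆ Metric.ball x₀ R₀ := Metric.closedBall_subset_ball hRR
  have hcpt : IsCompact (Metric.closedBall x₀ R) := isCompact_closedBall x₀ R
  have : ProperSpace ((E →L[ℝ] ℝ) × (E →L[ℝ] E →L[ℝ] ℝ) × (E →L[ℝ] E →L[ℝ] E)) :=
    have h1 : ProperSpace (E →L[ℝ] ℝ) := properSpace_clm
    have h2 : ProperSpace (E →L[ℝ] E →L[ℝ] ℝ) := properSpace_clm
    have h3 : ProperSpace (E →L[ℝ] E →L[ℝ] E) := properSpace_clm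
    inferInstance
  obtain ⟨A, δ, hA0, hδ, hAδ⟩ := exists_bound_fderiv_fderiv_comp hO contDiffOn_jetGradient hB hJ
    hcpt hsubB fun x hx => (hsubO x hx).1
  -- The two entries secure 9r ≤ R and 32Ar ≤ 1.
  set r := min (R / 9) (1 / (32 * (A + 1))) with hr
  have hr0 : 0 < r := lt_min (by positivity) (by positivity)
  have hr9 : 9 * r ≤ R := by
    have := min_le_left (R / 9) (1 / (32 * (A + 1)))
    rw [← hr] at this
    linarith
  have hrA : 32 * A * r ≤ 1 := by
    have h1 : r ≤ 1 / (32 * (A + 1)) := min_le_right _ _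
    rw [le_div_iff₀ (by positivity)] at h1
    nlinarith
  refine ⟨r, R, A, min δ (min (1 / (4 * κ)) (r / (16 * κ))), hr0, hr9, hRR, hA0, hrA,
    lt_min hδ (lt_min (by positivity) (by positivity)), ?_⟩
  intro φ' Γ' hφ' hΓ' hclose
  set ε := min δ (min (1 / (4 * κ)) (r / (16 * κ))) with hε
  have hεδ : ε ≤ δ := min_le_left _ _
  have hεκ : ε ≤ 1 / (4 * κ) := (min_le_right _ _).trans (min_le_left _ _)
  have hεr : ε ≤ r / (16 * κ) := (min_le_right _ _).trans (min_le_right _ _)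
  have hJ' := hφ'.phaseJet hB hΓ'
  have hφ'1 : ContDiffOn ℝ ∞ (fderiv ℝ φ') (Metric.ball x₀ R₀) := hφ'.fderiv_of_isOpen hB le_rfl
  have hd0 : ∀ x ∈ Metric.closedBall x₀ R, ‖phaseJet φ' Γ' x - phaseJet φ Γ x‖ ≤ ε := fun x hx => by
    simpa using hclose x hx 0 (by norm_num)
  have hG := hAδ _ hJ' fun x hx j hj => (hclose x hx j hj).trans hεδ
  have hbc : Metric.ball x₀ R ⊆ Metric.closedBall x₀ R := Metric.ball_subset_closedBall
  -- The gradient preconditioned by the Hessian at x₀. Moving the point and perturbing the phase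
  -- each change the Hessian by at most 1/(4κ), so Dg is within 1/2 of the identity. Hence g is
  -- injective on the ball, and it has a zero within r/8 of x₀ because ‖g(x₀)‖ ≤ r/16.
  let g : E → E := fun x => e₀.symm (fderiv ℝ φ' x)
  have hg : ∀ x ∈ Metric.closedBall x₀ R, HasFDerivAt g
      ((e₀.symm : (E →L[ℝ] ℝ) →L[ℝ] E).comp (fderiv ℝ (fderiv ℝ φ') x)) x := fun x hx =>
    (e₀.symm : (E →L[ℝ] ℝ) →L[ℝ] E).hasFDerivAt.comp x
      ((hφ'1.contDiffAt (hB.mem_nhds (hsubB hx))).differentiableAt (by simp)).hasFDerivAt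
  have hgn : ∀ x ∈ Metric.closedBall x₀ R,
      ‖(e₀.symm : (E →L[ℝ] ℝ) →L[ℝ] E).comp (fderiv ℝ (fderiv ℝ φ') x) - .id ℝ E‖ ≤ 1 / 2 := by
    intro x hx
    have h1 : (e₀.symm : (E →L[ℝ] ℝ) →L[ℝ] E).comp (fderiv ℝ (fderiv ℝ φ') x) - .id ℝ E
        = (e₀.symm : (E →L[ℝ] ℝ) →L[ℝ] E).comp
          (fderiv ℝ (fderiv ℝ φ') x - fderiv ℝ (fderiv ℝ φ) x₀) := by
      rw [← he₀]
      ext v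
      simp
    have h2 : ‖fderiv ℝ (fderiv ℝ φ') x - fderiv ℝ (fderiv ℝ φ) x‖ ≤ ε :=
      ((norm_fst_le _).trans (norm_snd_le _)).trans (hd0 x hx)
    have h3 := norm_sub_le_norm_sub_add_norm_sub (fderiv ℝ (fderiv ℝ φ') x)
      (fderiv ℝ (fderiv ℝ φ) x) (fderiv ℝ (fderiv ℝ φ) x₀)
    have h4 := (hsubO x hx).2
    rw [h1]
    refine (ContinuousLinearMap.opNorm_comp_le _ _).trans ?_
    have h5 : ‖fderiv ℝ (fderiv ℝ φ') x - fderiv ℝ (fderiv ℝ φ) x₀‖ ≤ 1 / (4 * κ) + 1 / (4 * κ) := by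
      linarith
    calc _ ≤ κ * (1 / (4 * κ) + 1 / (4 * κ)) := by
          gcongr
          rw [hκ]; linarith
      _ = 1 / 2 := by field_simp; norm_num
  have hgl : ∀ x ∈ Metric.ball x₀ R, ∀ y ∈ Metric.ball x₀ R,
      ‖g x - g y - (x - y)‖ ≤ 1 / 2 * ‖x - y‖ := by
    intro x hx y hy
    have h1 := (convex_ball x₀ R).norm_image_sub_le_of_norm_hasFDerivWithin_le
      (f := fun x => g x - x) (C := 1 / 2)
      (fun q hq => ((hg q (hbc hq)).sub (hasFDerivAt_id q)).hasFDerivWithinAt)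
      (fun q hq => hgn q (hbc hq)) hy hx
    refine le_trans (le_of_eq ?_) h1
    congr 1
    abel
  have hgx₀ : dist (0 : E) (g x₀) ≤ (1 - 1 / 2) * (r / 8) := by
    have hmem₀ : x₀ ∈ Metric.closedBall x₀ R := Metric.mem_closedBall_self hR0.le
    have h2 : ‖fderiv ℝ φ' x₀ - fderiv ℝ φ x₀‖ ≤ ε := (norm_fst_le _).trans (hd0 x₀ hmem₀)
    rw [hcrit, sub_zero] at h2
    rw [dist_zero_left]
    calc ‖g x₀‖ ≤ ‖(e₀.symm : (E →L[ℝ] ℝ) →L[ℝ] E)‖ * ‖fderiv ℝ φ' x₀‖ :=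
          (e₀.symm : (E →L[ℝ] ℝ) →L[ℝ] E).le_opNorm _
      _ ≤ κ * (r / (16 * κ)) := by
          gcongr
          · rw [hκ]; linarith
          · exact h2.trans hεr
      _ = (1 - 1 / 2) * (r / 8) := by field_simp; norm_num
  obtain ⟨c, hc, hgc⟩ := exists_eq_of_norm_sub_sub_le (by norm_num) (by positivity) hgl
    (Metric.closedBall_subset_ball (by linarith)) hgx₀
  have hcR : c ∈ Metric.ball x₀ R := Metric.closedBall_subset_ball (by linarith) hc
  have hc0 : fderiv ℝ φ' c = 0 := (map_eq_zero_iff e₀.symm e₀.symm.injective).1 hgc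
  refine ⟨fun x hx => (hG x (hbc hx)).1, fun x hx => ?_, c, mem_closedBall_iff_norm.1 hc, hc0,
    fun x hx h0 => ?_, fun x hx => ?_⟩
  · have h1 := hgn x (hbc hx)
    rw [norm_sub_rev] at h1
    obtain ⟨k, hk⟩ := ContinuousLinearMap.isInvertible_of_norm_sub_id_lt_one
      (h1.trans_lt (by norm_num))
    refine ⟨k.trans e₀, ?_⟩
    ext v : 1
    have h2 : k v = e₀.symm (fderiv ℝ (fderiv ℝ φ') x v) := DFunLike.congr_fun hk v
    simp [h2]
  · have h1 := hgl x hx c hcR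
    have h2 : g x = 0 := by simp [g, h0]
    rw [h2, hgc, sub_zero, zero_sub, norm_neg] at h1
    have h3 : ‖x - c‖ ≤ 0 := by linarith [norm_nonneg (x - c)]
    exact sub_eq_zero.1 (norm_le_zero_iff.1 h3)
  -- The derivative of the gradient field is the identity at c, so the bound A on its second
  -- derivative gives the linear estimate by the mean value inequality.
  · have hGat : ∀ q ∈ Metric.ball x₀ R, ContDiffAt ℝ ∞ jetGradient (phaseJet φ' Γ' q) := fun q hq =>
      contDiffOn_jetGradient.contDiffAt (hO.mem_nhds (hG q (hbc hq)).1)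
    have hJat : ∀ q ∈ Metric.ball x₀ R, ContDiffAt ℝ ∞ (phaseJet φ' Γ') q := fun q hq =>
      hJ'.contDiffAt (hB.mem_nhds (hsubB (hbc hq)))
    have hid := fderiv_jetGradient_comp_phaseJet
      (hφ'.contDiffAt (hB.mem_nhds (hsubB (hbc hcR))))
      (hΓ'.contDiffAt (hB.mem_nhds (hsubB (hbc hcR)))) hc0 (hG c (hbc hcR)).1
    rw [← hid]
    refine (convex_ball x₀ R).norm_image_sub_le_of_norm_fderiv_le (𝕜 := ℝ)
      (f := fderiv ℝ (jetGradient ∘ phaseJet φ' Γ')) (fun q hq => ?_) (fun q hq => ?_) hcR hx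
    · exact (((hGat q hq).comp q (hJat q hq)).fderiv_right (m := ∞) le_rfl).differentiableAt (by simp)
    · exact (hG q (hbc hq)).2

end UniformEstimates

/-! ### Pull-back of bilinear forms. -/

section PulledHessian

variable {E : Type*} [NormedAddCommGroup E] [NormedSpace ℝ E]

/-- The pull-back of a bilinear form by a linear map. -/
def pullbackForm (A : E →L[ℝ] E →L[ℝ] ℝ) (L : E →L[ℝ] E) : E →L[ℝ] E →L[ℝ] ℝ :=
  ((ContinuousLinearMap.compL ℝ E E ℝ).flip L).comp (A.comp L)

@[simp]
theorem pullbackForm_apply (A : E →L[ℝ] E →L[ℝ] ℝ) (L : E →L[ℝ] E) (v w : E) :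
    pullbackForm A L v w = A (L v) (L w) := rfl

theorem isInvertible_pullbackForm {A : E →L[ℝ] E →L[ℝ] ℝ} {L : E →L[ℝ] E} (hA : A.IsInvertible)
    (hL : L.IsInvertible) : (pullbackForm A L).IsInvertible := by
  obtain ⟨a, rfl⟩ := hA
  obtain ⟨l, rfl⟩ := hL
  refine ⟨(l.trans a).trans (l.symm.arrowCongr (ContinuousLinearEquiv.refl ℝ ℝ)), ?_⟩
  ext v w
  simp

theorem ContDiffOn.pullbackForm {X : Type*} [NormedAddCommGroup X] [NormedSpace ℝ X]
    {A : X → E →L[ℝ] E →L[ℝ] ℝ} {L : X → E →L[ℝ] E} {s : Set X} (hA : ContDiffOn ℝ ∞ A s)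
    (hL : ContDiffOn ℝ ∞ L s) : ContDiffOn ℝ ∞ (fun x => pullbackForm (A x) (L x)) s := by
  have h1 : ContDiffOn ℝ ∞ (fun x => (ContinuousLinearMap.compL ℝ E E ℝ).flip (L x)) s :=
    contDiffOn_const.clm_apply hL
  exact h1.clm_comp (hA.clm_comp hL)

end PulledHessian

/-! ### Charts built from linearizing coordinates. -/

section Charts

variable {n : ℕ} {M : Type u} [TopologicalSpace M] [T2Space M]
  [ChartedSpace (EuclideanSpace ℝ (Fin n)) M] [IsManifold (𝓡 n) ∞ M]

theorem exists_chart_comp {χ : OpenPartialHomeomorph M (𝔼 n)}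
    (hχ : χ ∈ IsManifold.maximalAtlas (𝓡 n) ∞ M) {B D : Set (𝔼 n)} (hB : IsOpen B)
    (hD : IsOpen D) (hBχ : B ⊆ χ.target) {ψ ζ : 𝔼 n → 𝔼 n} (hψ : ContDiffOn ℝ ∞ ψ D)
    (hζ : ContDiffOn ℝ ∞ ζ B) (hψm : MapsTo ψ D B) (hζm : MapsTo ζ B D)
    (hψζ : ∀ x ∈ B, ψ (ζ x) = x) (hζψ : ∀ z ∈ D, ζ (ψ z) = z) :
    ∃ y ∈ IsManifold.maximalAtlas (𝓡 n) ∞ M, y.source = χ.source ∩ χ ⁻¹' B ∧ y.target = D ∧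
      (∀ x, y x = ζ (χ x)) ∧ ∀ z, y.symm z = χ.symm (ψ z) := by
  have hto : ContMDiffOn (𝓡 n) (𝓡 n) ∞ (fun x => ζ (χ x)) (χ.source ∩ χ ⁻¹' B) :=
    hζ.contMDiffOn.comp ((contMDiffOn_of_mem_maximalAtlas hχ).mono inter_subset_left)
      fun x hx => hx.2
  have hinv : ContMDiffOn (𝓡 n) (𝓡 n) ∞ (fun z => χ.symm (ψ z)) D :=
    (contMDiffOn_symm_of_mem_maximalAtlas hχ).comp hψ.contMDiffOn fun z hz => hBχ (hψm hz)
  let y : OpenPartialHomeomorph M (𝔼 n) :=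
    { toFun := fun x => ζ (χ x)
      invFun := fun z => χ.symm (ψ z)
      source := χ.source ∩ χ ⁻¹' B
      target := D
      map_source' := fun x hx => hζm hx.2
      map_target' := fun z hz => ⟨χ.map_target (hBχ (hψm hz)), by
        rw [mem_preimage, χ.right_inv (hBχ (hψm hz))]
        exact hψm hz⟩
      left_inv' := fun x hx => by rw [hψζ _ hx.2, χ.left_inv hx.1]
      right_inv' := fun z hz => by rw [χ.right_inv (hBχ (hψm hz)), hζψ z hz]
      open_source := χ.isOpen_inter_preimage hB
      open_target := hD
      continuousOn_toFun := hto.continuousOn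
      continuousOn_invFun := hinv.continuousOn }
  exact ⟨y, y.mem_maximalAtlas_of_contMDiffOn hto hinv, rfl, rfl, fun _ => rfl, fun _ => rfl⟩

/-- Tensoriality of the covariant Hessian, applied to the identity map of M, whose coordinate
expression is ψ. -/
theorem covariantHess_comp {χ y : OpenPartialHomeomorph M (𝔼 n)} {C : TorsionFreeConnection n M}
    {Φ : M → ℝ} (hχ : χ ∈ IsManifold.maximalAtlas (𝓡 n) ∞ M)
    (hy : y ∈ IsManifold.maximalAtlas (𝓡 n) ∞ M) {z : 𝔼 n} (hz : z ∈ y.target)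
    {ψ : 𝔼 n → 𝔼 n} (hψ : ∀ z ∈ y.target, ψ z ∈ χ.target)
    (hys : ∀ z ∈ y.target, y.symm z = χ.symm (ψ z))
    (hΦ : ContDiffAt ℝ ∞ (Φ ∘ χ.symm) (ψ z)) :
    covariantHess C Φ y z = pullbackForm (covariantHess C Φ χ (ψ z)) (fderiv ℝ ψ z) := by
  let T : 𝔼 n → 𝔼 n := fun z => χ (id (y.symm z))
  have hT : ∀ z ∈ y.target, T z = ψ z := fun z hz => by
    simp only [T, id, hys z hz, χ.right_inv (hψ z hz)]
  have hTev : T =ᶠ[𝓝 z] ψ := eventuallyEq_of_mem (y.open_target.mem_nhds hz) hT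
  obtain ⟨hloc, -, -, -, hpres⟩ := isStructureEmbedding_id C Φ (univ : Set M)
  have hcoord := covariantHess_coord (T := T) (Φ := Φ) (Φ' := Φ) hy hχ isOpen_univ hloc hpres
    (y.map_target hz) (mem_univ _) (by rw [id, hys z hz]; exact χ.map_target (hψ z hz)) rfl
  rw [y.right_inv hz, hT z hz, hTev.fderiv_eq] at hcoord
  ext v w
  refine (hcoord hΦ ?_ v w).symm
  filter_upwards [y.open_target.mem_nhds hz] with q hq
  simp only [Function.comp, hT q hq, hys q hq]

theorem contDiffOn_covariantHess {χ : OpenPartialHomeomorph M (𝔼 n)}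
    {C : TorsionFreeConnection n M} {Φ : M → ℝ} (hχ : χ ∈ IsManifold.maximalAtlas (𝓡 n) ∞ M)
    {B : Set (𝔼 n)} (hB : IsOpen B) (hBχ : B ⊆ χ.target) (hΦ : ContDiffOn ℝ ∞ (Φ ∘ χ.symm) B) :
    ContDiffOn ℝ ∞ (covariantHess C Φ χ) B :=
  contDiff_jetHessian.comp_contDiffOn
    (hΦ.phaseJet hB ((contDiffOn_connectionForm C hχ).mono hBχ))

/-- With V = H⁻¹du in the chart χ, the identity Dψ(z)z = V(ψ(z)) pulls back to H(ψ(z))(V(ψ(z)), Dψ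
w) = du(ψ(z))(Dψ w). This is the Euler relation in the chart y. -/
theorem isFlatModel_of_linearization {χ y : OpenPartialHomeomorph M (𝔼 n)}
    {C : TorsionFreeConnection n M} {Φ : M → ℝ} (hχ : χ ∈ IsManifold.maximalAtlas (𝓡 n) ∞ M)
    (hy : y ∈ IsManifold.maximalAtlas (𝓡 n) ∞ M) {B : Set (𝔼 n)} (hB : IsOpen B)
    (hBχ : B ⊆ χ.target) (hΦ : ContDiffOn ℝ ∞ (Φ ∘ χ.symm) B)
    (hi : ∀ x ∈ B, (covariantHess C Φ χ x).IsInvertible) {ψ : 𝔼 n → 𝔼 n}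
    (hψ : ContDiffOn ℝ ∞ ψ y.target) (hψm : MapsTo ψ y.target B)
    (hys : ∀ z ∈ y.target, y.symm z = χ.symm (ψ z)) (h0 : (0 : 𝔼 n) ∈ y.target)
    (hstar : StarConvex ℝ 0 y.target) (hψi : ∀ z ∈ y.target, (fderiv ℝ ψ z).IsInvertible)
    (heuler : ∀ z ∈ y.target, fderiv ℝ ψ z z
      = (covariantHess C Φ χ (ψ z)).inverse (fderiv ℝ (Φ ∘ χ.symm) (ψ z))) :
    IsFlatModel y.target (Φ ∘ y.symm) (covariantHess C Φ y) := by
  have hψχ : ∀ z ∈ y.target, ψ z ∈ χ.target := fun z hz => hBχ (hψm hz)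
  have hΦat : ∀ z ∈ y.target, ContDiffAt ℝ ∞ (Φ ∘ χ.symm) (ψ z) := fun z hz =>
    hΦ.contDiffAt (hB.mem_nhds (hψm hz))
  have hH : ∀ z ∈ y.target, covariantHess C Φ y z
      = pullbackForm (covariantHess C Φ χ (ψ z)) (fderiv ℝ ψ z) := fun z hz =>
    covariantHess_comp hχ hy hz hψχ hys (hΦat z hz)
  have hu : EqOn (Φ ∘ y.symm) ((Φ ∘ χ.symm) ∘ ψ) y.target := fun z hz => by
    simp only [Function.comp, hys z hz]
  have hHχ := contDiffOn_covariantHess (C := C) hχ hB hBχ hΦ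
  refine ⟨y.open_target, h0, hstar, (hΦ.comp hψ hψm).congr hu, ?_, fun z hz => ?_, fun z hz => ?_⟩
  · exact ((hHχ.comp hψ hψm).pullbackForm (hψ.fderiv_of_isOpen y.open_target le_rfl)).congr hH
  · rw [hH z hz]
    exact isInvertible_pullbackForm (hi _ (hψm hz)) (hψi z hz)
  · have hψd : DifferentiableAt ℝ ψ z :=
      (hψ.contDiffAt (y.open_target.mem_nhds hz)).differentiableAt (by simp)
    rw [hH z hz, (hu.eventuallyEq_of_mem (y.open_target.mem_nhds hz)).fderiv_eq,
      fderiv_comp _ ((hΦat z hz).differentiableAt (by simp)) hψd]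
    ext w
    have hinv : covariantHess C Φ χ (ψ z)
        ((covariantHess C Φ χ (ψ z)).inverse (fderiv ℝ (Φ ∘ χ.symm) (ψ z)))
        = fderiv ℝ (Φ ∘ χ.symm) (ψ z) := (hi _ (hψm hz)).self_apply_inverse _
    rw [pullbackForm_apply, heuler z hz, hinv]
    rfl

end Charts

/-! ### From closeness of phase and connection coefficients to closeness of jets. -/

section Closeness

theorem norm_iteratedFDeriv_add_le {X Y : Type*} [NormedAddCommGroup X] [NormedSpace ℝ X]
    [NormedAddCommGroup Y] [NormedSpace ℝ Y] {f g : X → Y} {x : X} (hf : ContDiffAt ℝ ∞ f x)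
    (hg : ContDiffAt ℝ ∞ g x) (j : ℕ) :
    ‖iteratedFDeriv ℝ j (fun q => f q + g q) x‖
      ≤ ‖iteratedFDeriv ℝ j f x‖ + ‖iteratedFDeriv ℝ j g x‖ := by
  have := iteratedFDeriv_add_apply (i := j) (hf.of_le (by exact_mod_cast le_top))
    (hg.of_le (by exact_mod_cast le_top))
  exact (congrArg norm this).trans_le (norm_add_le _ _)

theorem norm_iteratedFDeriv_clm_le {X Y Z : Type*} [NormedAddCommGroup X] [NormedSpace ℝ X]
    [NormedAddCommGroup Y] [NormedSpace ℝ Y] [NormedAddCommGroup Z] [NormedSpace ℝ Z]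
    (L : Y →L[ℝ] Z) {f : X → Y} {x : X} (hf : ContDiffAt ℝ ∞ f x) {j : ℕ} {ε : ℝ}
    (h : ‖iteratedFDeriv ℝ j f x‖ ≤ ε) :
    ‖iteratedFDeriv ℝ j (fun q => L (f q)) x‖ ≤ ‖L‖ * ε :=
  (L.norm_iteratedFDeriv_comp_left hf (by exact_mod_cast le_top)).trans (by gcongr)

theorem norm_iteratedFDeriv_clm_sum_le {X Y Z ι : Type*} [NormedAddCommGroup X] [NormedSpace ℝ X]
    [NormedAddCommGroup Y] [NormedSpace ℝ Y] [NormedAddCommGroup Z] [NormedSpace ℝ Z]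
    (s : Finset ι) (L : ι → Y →L[ℝ] Z) {f : ι → X → Y} {x : X}
    (hf : ∀ i, ContDiffAt ℝ ∞ (f i) x) {j : ℕ} {ε : ℝ}
    (h : ∀ i, ‖iteratedFDeriv ℝ j (f i) x‖ ≤ ε) :
    ‖iteratedFDeriv ℝ j (fun q => ∑ i ∈ s, L i (f i q)) x‖ ≤ (∑ i ∈ s, ‖L i‖) * ε := by
  classical
  induction s using Finset.induction_on with
  | empty =>
    simp only [Finset.sum_empty, zero_mul]
    have : iteratedFDeriv ℝ j (fun _ : X => (0 : Z)) x = 0 := by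
      simp
    rw [this, norm_zero]
  | insert a s ha ih =>
    simp only [Finset.sum_insert ha, add_mul]
    refine (norm_iteratedFDeriv_add_le ((L a).contDiff.contDiffAt.comp x (hf a))
      (ContDiffAt.sum fun i _ => (L i).contDiff.contDiffAt.comp x (hf i)) j).trans ?_
    exact add_le_add (norm_iteratedFDeriv_clm_le (L a) (hf a) (h a)) ih

theorem norm_iteratedFDeriv_prodMk_le {X Y Z : Type*} [NormedAddCommGroup X] [NormedSpace ℝ X]
    [NormedAddCommGroup Y] [NormedSpace ℝ Y] [NormedAddCommGroup Z] [NormedSpace ℝ Z]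
    {f : X → Y} {g : X → Z} {x : X} (hf : ContDiffAt ℝ ∞ f x) (hg : ContDiffAt ℝ ∞ g x) {j : ℕ}
    {a b : ℝ} (ha : ‖iteratedFDeriv ℝ j f x‖ ≤ a) (hb : ‖iteratedFDeriv ℝ j g x‖ ≤ b) :
    ‖iteratedFDeriv ℝ j (fun q => (f q, g q)) x‖ ≤ a + b := by
  have h1 : (fun q => (f q, g q)) = fun q => ContinuousLinearMap.inl ℝ Y Z (f q)
      + ContinuousLinearMap.inr ℝ Y Z (g q) := by
    funext q
    simp
  rw [h1]
  have h2 := norm_iteratedFDeriv_clm_le (ContinuousLinearMap.inl ℝ Y Z) hf ha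
  have h3 := norm_iteratedFDeriv_clm_le (ContinuousLinearMap.inr ℝ Y Z) hg hb
  refine (norm_iteratedFDeriv_add_le
    ((ContinuousLinearMap.inl ℝ Y Z).contDiff.contDiffAt.comp x hf)
    ((ContinuousLinearMap.inr ℝ Y Z).contDiff.contDiffAt.comp x hg) j).trans (add_le_add ?_ ?_)
  · exact h2.trans (mul_le_of_le_one_left ((norm_nonneg _).trans ha)
      (ContinuousLinearMap.norm_inl_le_one ℝ Y Z))
  · exact h3.trans (mul_le_of_le_one_left ((norm_nonneg _).trans hb)
      (ContinuousLinearMap.norm_inr_le_one ℝ Y Z))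

theorem exists_norm_iteratedFDeriv_clm_sum_le (X : Type*) {Y Z ι : Type*} [NormedAddCommGroup X]
    [NormedSpace ℝ X] [NormedAddCommGroup Y] [NormedSpace ℝ Y] [NormedAddCommGroup Z]
    [NormedSpace ℝ Z] (s : Finset ι) (L : ι → Y →L[ℝ] Z) :
    ∃ Λ : ℝ, 0 ≤ Λ ∧ ∀ (f : ι → X → Y) (x : X), (∀ i, ContDiffAt ℝ ∞ (f i) x) →
      ContDiffAt ℝ ∞ (fun q => ∑ i ∈ s, L i (f i q)) x ∧
      ∀ (j : ℕ) (ε : ℝ), (∀ i, ‖iteratedFDeriv ℝ j (f i) x‖ ≤ ε) →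
        ‖iteratedFDeriv ℝ j (fun q => ∑ i ∈ s, L i (f i q)) x‖ ≤ Λ * ε :=
  ⟨∑ i ∈ s, ‖L i‖, by positivity, fun _ x hf =>
    ⟨ContDiffAt.sum fun i _ => (L i).contDiff.contDiffAt.comp x (hf i),
      fun _ _ h => norm_iteratedFDeriv_clm_sum_le s L hf h⟩⟩

theorem sum_clm_sub {Y Z ι : Type*} [NormedAddCommGroup Y] [NormedSpace ℝ Y]
    [NormedAddCommGroup Z] [NormedSpace ℝ Z] (s : Finset ι) (L : ι → Y →L[ℝ] Z) (f g : ι → Y) :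
    ∑ i ∈ s, L i (f i - g i) = ∑ i ∈ s, L i (f i) - ∑ i ∈ s, L i (g i) := by
  simp

/-- The embedding of vectors into bilinear maps given by two linear forms. -/
def smulRightTwo {E : Type*} [NormedAddCommGroup E] [NormedSpace ℝ E] (ξ η : E →L[ℝ] ℝ) :
    E →L[ℝ] E →L[ℝ] E →L[ℝ] E :=
  (ContinuousLinearMap.smulRightL ℝ E (E →L[ℝ] E) ξ).comp
    (ContinuousLinearMap.smulRightL ℝ E E η)

theorem exists_norm_iteratedFDeriv_smulRightTwo_sum_le {X E ι : Type*} [NormedAddCommGroup X]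
    [NormedSpace ℝ X] [NormedAddCommGroup E] [NormedSpace ℝ E] (s : Finset ι)
    (ξ η : ι → E →L[ℝ] ℝ) :
    ∃ Λ : ℝ, 0 ≤ Λ ∧ ∀ (f : ι → X → E) (x : X), (∀ i, ContDiffAt ℝ ∞ (f i) x) →
      ContDiffAt ℝ ∞ (fun q => ∑ i ∈ s, smulRightTwo (ξ i) (η i) (f i q)) x ∧
      ∀ (j : ℕ) (ε : ℝ), (∀ i, ‖iteratedFDeriv ℝ j (f i) x‖ ≤ ε) →
        ‖iteratedFDeriv ℝ j (fun q => ∑ i ∈ s, smulRightTwo (ξ i) (η i) (f i q)) x‖ ≤ Λ * ε :=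
  exists_norm_iteratedFDeriv_clm_sum_le X (Y := E) (Z := E →L[ℝ] E →L[ℝ] E) s
    fun i => smulRightTwo (ξ i) (η i)

theorem smulRightTwo_sum_sub {E ι : Type*} [NormedAddCommGroup E] [NormedSpace ℝ E] (s : Finset ι)
    (ξ η : ι → E →L[ℝ] ℝ) (f g : ι → E) :
    ∑ i ∈ s, smulRightTwo (ξ i) (η i) (f i - g i)
      = ∑ i ∈ s, smulRightTwo (ξ i) (η i) (f i) - ∑ i ∈ s, smulRightTwo (ξ i) (η i) (g i) :=
  sum_clm_sub (Y := E) (Z := E →L[ℝ] E →L[ℝ] E) s (fun i => smulRightTwo (ξ i) (η i)) f g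

end Closeness

section JetCloseness

variable {n : ℕ} {M : Type u} [TopologicalSpace M] [T2Space M]
  [ChartedSpace (EuclideanSpace ℝ (Fin n)) M] [IsManifold (𝓡 n) ∞ M]

theorem connectionForm_eq_sum (C : TorsionFreeConnection n M)
    (y : OpenPartialHomeomorph M (𝔼 n)) (z : 𝔼 n) :
    connectionForm C y z = ∑ i : Fin n × Fin n, smulRightTwo
      (EuclideanSpace.proj i.1) (EuclideanSpace.proj i.2)
      (christoffel C y (EuclideanSpace.single i.1 1) (EuclideanSpace.single i.2 1) z) := by
  rw [Fintype.sum_prod_type]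
  rfl

/-- The jet already contains second derivatives of the phase, so two derivatives of the jet require
four of the phase. The constant adds the contributions of the three components of the jet and
depends only on n. -/
theorem exists_norm_iteratedFDeriv_phaseJet_sub_le (n : ℕ) : ∃ Λ : ℝ, 0 ≤ Λ ∧
    ∀ (M : Type u) [TopologicalSpace M] [T2Space M]
      [ChartedSpace (EuclideanSpace ℝ (Fin n)) M] [IsManifold (𝓡 n) ∞ M]
      (χ : OpenPartialHomeomorph M (𝔼 n)) (C C' : TorsionFreeConnection n M) (φ φ' : 𝔼 n → ℝ)
      (B : Set (𝔼 n)) (x : 𝔼 n) (ε : ℝ), χ ∈ IsManifold.maximalAtlas (𝓡 n) ∞ M → IsOpen B →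
      B ⊆ χ.target → ContDiffOn ℝ ∞ φ B → ContDiffOn ℝ ∞ φ' B → x ∈ B →
      (∀ j ≤ 4, ‖iteratedFDeriv ℝ j (fun y => φ' y - φ y) x‖ ≤ ε ∧ ∀ a b : Fin n,
        ‖iteratedFDeriv ℝ j (fun y =>
          christoffel C' χ (EuclideanSpace.single a 1) (EuclideanSpace.single b 1) y
            - christoffel C χ (EuclideanSpace.single a 1) (EuclideanSpace.single b 1) y) x‖ ≤ ε) →
      ∀ j ≤ 2, ‖iteratedFDeriv ℝ j
        (phaseJet φ' (connectionForm C' χ) - phaseJet φ (connectionForm C χ)) x‖ ≤ Λ * ε := by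
  obtain ⟨Λ, hΛ, H⟩ := exists_norm_iteratedFDeriv_smulRightTwo_sum_le (X := 𝔼 n) (E := 𝔼 n)
    Finset.univ (fun i : Fin n × Fin n => EuclideanSpace.proj i.1) (fun i => EuclideanSpace.proj i.2)
  refine ⟨1 + (1 + Λ), by positivity, ?_⟩
  intro M _ _ _ _ χ C C' φ φ' B x ε hχ hB hBχ hφ hφ' hx h j hj
  have hBx := hB.mem_nhds hx
  let w : 𝔼 n → ℝ := fun y => φ' y - φ y
  let d : Fin n × Fin n → 𝔼 n → 𝔼 n := fun i y =>
    christoffel C' χ (EuclideanSpace.single i.1 1) (EuclideanSpace.single i.2 1) y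
      - christoffel C χ (EuclideanSpace.single i.1 1) (EuclideanSpace.single i.2 1) y
  have hw : ContDiffOn ℝ ∞ w B := hφ'.sub hφ
  have hw1 : ContDiffOn ℝ ∞ (fderiv ℝ w) B := hw.fderiv_of_isOpen hB le_rfl
  have hw2 : ContDiffOn ℝ ∞ (fderiv ℝ (fderiv ℝ w)) B := hw1.fderiv_of_isOpen hB le_rfl
  have hd : ∀ i, ContDiffOn ℝ ∞ (d i) B := fun i =>
    ((contDiffOn_christoffel C' hχ _ _).sub (contDiffOn_christoffel C hχ _ _)).mono hBχ
  have hφd : ∀ f : 𝔼 n → ℝ, ContDiffOn ℝ ∞ f B → ∀ q ∈ B, DifferentiableAt ℝ f q ∧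
      DifferentiableAt ℝ (fderiv ℝ f) q := fun f hf q hq =>
    ⟨(hf.contDiffAt (hB.mem_nhds hq)).differentiableAt (by simp),
      ((hf.fderiv_of_isOpen hB le_rfl : ContDiffOn ℝ ∞ _ B).contDiffAt
        (hB.mem_nhds hq)).differentiableAt (by simp)⟩
  have hf1 : EqOn (fderiv ℝ w) (fderiv ℝ φ' - fderiv ℝ φ) B := fun q hq =>
    fderiv_fun_sub (hφd φ' hφ' q hq).1 (hφd φ hφ q hq).1
  have hf2 : EqOn (fderiv ℝ (fderiv ℝ w)) (fderiv ℝ (fderiv ℝ φ') - fderiv ℝ (fderiv ℝ φ)) B := by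
    intro q hq
    rw [(hf1.eventuallyEq_of_mem (hB.mem_nhds hq)).fderiv_eq,
      fderiv_sub (hφd φ' hφ' q hq).2 (hφd φ hφ q hq).2]
    rfl
  have hsum : ∀ q, ∑ i, smulRightTwo
      (EuclideanSpace.proj i.1) (EuclideanSpace.proj i.2) (d i q)
      = connectionForm C' χ q - connectionForm C χ q := by
    intro q
    rw [connectionForm_eq_sum, connectionForm_eq_sum]
    exact smulRightTwo_sum_sub Finset.univ (fun i : Fin n × Fin n => EuclideanSpace.proj i.1)
      (fun i => EuclideanSpace.proj i.2) _ _
  have heq : EqOn (phaseJet φ' (connectionForm C' χ) - phaseJet φ (connectionForm C χ))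
      (fun q => (fderiv ℝ w q, fderiv ℝ (fderiv ℝ w) q, ∑ i, smulRightTwo
      (EuclideanSpace.proj i.1) (EuclideanSpace.proj i.2) (d i q))) B := by
    intro q hq
    simp only [hsum, hf1 hq, hf2 hq]
    rfl
  rw [((heq.eventuallyEq_of_mem hBx).iteratedFDeriv ℝ j).self_of_nhds]
  have h1 : ‖iteratedFDeriv ℝ j (fderiv ℝ w) x‖ ≤ ε := by
    rw [norm_iteratedFDeriv_fderiv]
    exact (h (j + 1) (by omega)).1
  have h2 : ‖iteratedFDeriv ℝ j (fderiv ℝ (fderiv ℝ w)) x‖ ≤ ε := by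
    rw [norm_iteratedFDeriv_fderiv, norm_iteratedFDeriv_fderiv]
    exact (h (j + 1 + 1) (by omega)).1
  have h3 : ∀ i, ‖iteratedFDeriv ℝ j (d i) x‖ ≤ ε := fun i => (h j (by omega)).2 i.1 i.2
  obtain ⟨s3, h4⟩ := H d x fun i => (hd i).contDiffAt hBx
  rw [add_mul, add_mul, one_mul]
  exact norm_iteratedFDeriv_prodMk_le (hw1.contDiffAt hBx) ((hw2.contDiffAt hBx).prodMk s3) h1
    (norm_iteratedFDeriv_prodMk_le (hw2.contDiffAt hBx) s3 h2
      (h4 j ε h3))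

end JetCloseness

/-! ### Smooth families of gradient fields and of linearizing charts. -/

section GradientFamilies

theorem ContDiffOn.phaseJet_family {P : Type*} {E : Type} [NormedAddCommGroup P]
    [NormedSpace ℝ P] [NormedAddCommGroup E] [NormedSpace ℝ E] {φ : P × E → ℝ} {Γ : P × E → E →L[ℝ] E →L[ℝ] E}
    {O : Set (P × E)} (hO : IsOpen O) (hφ : ContDiffOn ℝ ∞ φ O) (hΓ : ContDiffOn ℝ ∞ Γ O) :
    ContDiffOn ℝ ∞
      (fun q : P × E => _root_.phaseJet (fun x => φ (q.1, x)) (fun x => Γ (q.1, x)) q.2) O :=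
  (hφ.partial_fderiv hO).prodMk (((hφ.partial_fderiv hO).partial_fderiv hO).prodMk hΓ)

/-- A smooth family of phases and connections, with uniform control of the gradient fields, gives a
family of vector fields with nearly constant linear part. -/
theorem exists_isEulerFamily {P E : Type} [NormedAddCommGroup P] [NormedSpace ℝ P] [CompleteSpace P]
    [NormedAddCommGroup E] [InnerProductSpace ℝ E] [FiniteDimensional ℝ E] {S : Set P} (hS : IsOpen S)
    {φ : P × E → ℝ} {Γ : P × E → E →L[ℝ] E →L[ℝ] E} {x₀ : E} {r R A : ℝ} (hr : 0 < r)
    (hrR : 9 * r ≤ R) (hA : 0 ≤ A) (hAr : 32 * A * r ≤ 1)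
    (hφ : ContDiffOn ℝ ∞ φ (S ×ˢ Metric.ball x₀ R))
    (hΓ : ContDiffOn ℝ ∞ Γ (S ×ˢ Metric.ball x₀ R))
    (hi : ∀ s ∈ S, ∀ x ∈ Metric.ball x₀ R,
      (jetHessian (phaseJet (fun x => φ (s, x)) (fun x => Γ (s, x)) x)).IsInvertible)
    (hd : ∀ s ∈ S, ∀ x ∈ Metric.ball x₀ R,
      (fderiv ℝ (fderiv ℝ fun x => φ (s, x)) x).IsInvertible)
    (hc : ∀ s ∈ S, ∃ c : E, ‖c - x₀‖ ≤ r / 8 ∧ fderiv ℝ (fun x => φ (s, x)) c = 0 ∧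
      (∀ x ∈ Metric.ball x₀ R, fderiv ℝ (fun x => φ (s, x)) x = 0 → x = c) ∧
      ∀ x ∈ Metric.ball x₀ R,
        ‖fderiv ℝ (jetGradient ∘ phaseJet (fun x => φ (s, x)) (fun x => Γ (s, x))) x
          - ContinuousLinearMap.id ℝ E‖ ≤ A * ‖x - c‖) :
    ∃ c : P → E, IsEulerFamily S
      (fun q => jetGradient (phaseJet (fun x => φ (q.1, x)) (fun x => Γ (q.1, x)) q.2))
      c x₀ r R A := by
  have : CompleteSpace E := FiniteDimensional.complete ℝ E
  choose! c hcn hc0 hcu hcA using hc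
  have hO : IsOpen (S ×ˢ Metric.ball x₀ R) := hS.prod Metric.isOpen_ball
  have hcR : ∀ s ∈ S, c s ∈ Metric.ball x₀ R := fun s hs => by
    rw [mem_ball_iff_norm]
    linarith [hcn s hs]
  have hF := hφ.partial_fderiv hO
  refine ⟨c, hS, hr, hrR, hA, hAr, ?_, ?_, hcn, fun s hs => ?_, hcA⟩
  · exact contDiffOn_jetGradient.comp (hφ.phaseJet_family hO hΓ) fun q hq => hi q.1 hq.1 q.2 hq.2
  -- The critical point is the only zero of the differential in the ball and the Hessian there is
  -- invertible, so it depends smoothly on s.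
  · refine contDiffOn_of_unique_solution hS hO hF (w := c) (fun s hs => ⟨⟨hs, hcR s hs⟩, hc0 s hs⟩)
      (fun s hs => ?_) fun s hs x hx h0 => hcu s hs x hx.2 h0
    rw [← fderiv_partial_snd ((hF.contDiffAt (hO.mem_nhds ⟨hs, hcR s hs⟩)).differentiableAt
      (by simp))]
    exact hd s hs _ (hcR s hs)
  · simp [jetGradient, phaseJet, hc0 s hs]

end GradientFamilies

section ChartFamilies

variable {n k : ℕ} {M : Type u} [TopologicalSpace M] [T2Space M]
  [ChartedSpace (EuclideanSpace ℝ (Fin n)) M] [IsManifold (𝓡 n) ∞ M]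

theorem IsSmoothFamilyOfConnections.contDiffOn_connectionForm {S : Set (𝔼 k)}
    {C : 𝔼 k → TorsionFreeConnection n M} (hC : IsSmoothFamilyOfConnections S C)
    {χ : OpenPartialHomeomorph M (𝔼 n)} (hχ : χ ∈ IsManifold.maximalAtlas (𝓡 n) ∞ M) :
    ContDiffOn ℝ ∞ (fun q : 𝔼 k × 𝔼 n => connectionForm (C q.1) χ q.2) (S ×ˢ χ.target) := by
  refine ContDiffOn.sum fun a _ => ContDiffOn.sum fun b _ => ?_
  exact contDiffOn_const.smulRight (contDiffOn_const.smulRight (hC χ hχ _ _))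

/-- The charts are ζ(s, ·) ∘ χ. All have the same source, the coordinate ball of radius r; only the
image {z | ψ(s, z) in the ball} varies with s, and these images together form an open set because ψ
is jointly continuous. -/
theorem exists_isSmoothFlatChartFamily_of_isLinearization {S : Set (𝔼 k)}
    {C : 𝔼 k → TorsionFreeConnection n M} {Φ : 𝔼 k → M → ℝ}
    {χ : OpenPartialHomeomorph M (𝔼 n)} (hχ : χ ∈ IsManifold.maximalAtlas (𝓡 n) ∞ M)
    {x₀ : 𝔼 n} {r : ℝ} (hr : 0 < r) (hBχ : Metric.ball x₀ r ⊆ χ.target)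
    (hC : IsSmoothFamilyOfConnections S C)
    (hΦ : ContDiffOn ℝ ∞ (fun q : 𝔼 k × 𝔼 n => Φ q.1 (χ.symm q.2)) (S ×ˢ Metric.ball x₀ r))
    (hi : ∀ s ∈ S, ∀ x ∈ Metric.ball x₀ r, (covariantHess (C s) (Φ s) χ x).IsInvertible)
    {ψ ζ : 𝔼 k × 𝔼 n → 𝔼 n}
    (h : IsLinearization S (fun q => (covariantHess (C q.1) (Φ q.1) χ q.2).inverse
      (fderiv ℝ (Φ q.1 ∘ χ.symm) q.2)) x₀ r ψ ζ) :
    ∃ y, IsSmoothFlatChartFamily S C Φ (χ.source ∩ χ ⁻¹' Metric.ball x₀ r) y := by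
  have hS := h.isOpen
  have hB : IsOpen (Metric.ball x₀ r) := Metric.isOpen_ball
  let D : 𝔼 k → Set (𝔼 n) := fun s =>
    {z ∈ Metric.ball (0 : 𝔼 n) (2 * r) | ψ (s, z) ∈ Metric.ball x₀ r}
  have hψs : ∀ s ∈ S, ContDiffOn ℝ ∞ (fun z => ψ (s, z)) (Metric.ball 0 (2 * r)) := fun s hs =>
    h.smooth.slice fun z hz => ⟨hs, hz⟩
  have hζs : ∀ s ∈ S, ContDiffOn ℝ ∞ (fun z => ζ (s, z)) (Metric.ball x₀ r) := fun s hs =>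
    h.smooth_inv.slice fun z hz => ⟨hs, hz⟩
  have hy : ∀ s ∈ S, ∃ y ∈ IsManifold.maximalAtlas (𝓡 n) ∞ M,
      y.source = χ.source ∩ χ ⁻¹' Metric.ball x₀ r ∧ y.target = D s ∧
      (∀ x, y x = ζ (s, χ x)) ∧ ∀ z, y.symm z = χ.symm (ψ (s, z)) := fun s hs =>
    exists_chart_comp hχ hB ((hψs s hs).continuousOn.isOpen_inter_preimage Metric.isOpen_ball hB)
      hBχ ((hψs s hs).mono fun z hz => hz.1) (hζs s hs) (fun z hz => hz.2)
      (fun x hx => ⟨h.inv_mem s hs x hx, by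
        change ψ (s, ζ (s, x)) ∈ Metric.ball x₀ r
        rwa [h.apply_inv s hs x hx]⟩)
      (fun x hx => h.apply_inv s hs x hx) fun z hz => h.inv_apply s hs z hz.1 hz.2
  have : Nonempty (OpenPartialHomeomorph M (𝔼 n)) := ⟨χ⟩
  choose! y hymem hysource hytarget hyapply hysymm using hy
  let D' : Set (𝔼 k × 𝔼 n) := (S ×ˢ Metric.ball 0 (2 * r)) ∩ ψ ⁻¹' Metric.ball x₀ r
  have hD' : IsOpen D' :=
    h.smooth.continuousOn.isOpen_inter_preimage (hS.prod Metric.isOpen_ball) hB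
  have hDD : chartFamilyTarget S y = D' := by
    ext ⟨s, z⟩
    constructor
    · rintro ⟨hs, hz⟩
      have hz' : z ∈ D s := hytarget s hs ▸ hz
      exact ⟨⟨hs, hz'.1⟩, hz'.2⟩
    · rintro ⟨⟨hs, hz⟩, hz'⟩
      refine ⟨hs, ?_⟩
      change z ∈ (y s).target
      rw [hytarget s hs]
      exact ⟨hz, hz'⟩
  have hψD : ContDiffOn ℝ ∞ ψ D' := h.smooth.mono inter_subset_left
  have hpair : ContDiffOn ℝ ∞ (fun q : 𝔼 k × 𝔼 n => (q.1, ψ q)) D' := contDiffOn_fst.prodMk hψD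
  have hpairm : MapsTo (fun q : 𝔼 k × 𝔼 n => (q.1, ψ q)) D' (S ×ˢ Metric.ball x₀ r) := fun q hq =>
    ⟨hq.1.1, hq.2⟩
  have hΓ : ContDiffOn ℝ ∞ (fun q : 𝔼 k × 𝔼 n => connectionForm (C q.1) χ q.2)
      (S ×ˢ Metric.ball x₀ r) :=
    (hC.contDiffOn_connectionForm hχ).mono (prod_mono subset_rfl hBχ)
  have hH : ContDiffOn ℝ ∞ (fun q : 𝔼 k × 𝔼 n => covariantHess (C q.1) (Φ q.1) χ q.2)
      (S ×ˢ Metric.ball x₀ r) :=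
    contDiff_jetHessian.comp_contDiffOn (hΦ.phaseJet_family (hS.prod hB) hΓ)
  have hΦs : ∀ s ∈ S, ContDiffOn ℝ ∞ (Φ s ∘ χ.symm) (Metric.ball x₀ r) := fun s hs =>
    hΦ.slice fun x hx => ⟨hs, hx⟩
  have hmem : ∀ s ∈ S, ∀ z ∈ (y s).target, z ∈ D s := fun s hs z hz => hytarget s hs ▸ hz
  have hmodel : ∀ s ∈ S, IsFlatModel (y s).target (Φ s ∘ (y s).symm)
      (covariantHess (C s) (Φ s) (y s)) := by
    intro s hs
    refine isFlatModel_of_linearization hχ (hymem s hs) hB hBχ (hΦs s hs) (hi s hs)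
      (ψ := fun z => ψ (s, z)) ((hψs s hs).mono fun z hz => (hmem s hs z hz).1)
      (fun z hz => (hmem s hs z hz).2) (fun z _ => hysymm s hs z) ?_ ?_
      (fun z hz => h.isInvertible s hs z (hmem s hs z hz).1)
      fun z hz => h.euler s hs z (hmem s hs z hz).1
    · rw [hytarget s hs]
      exact ⟨Metric.mem_ball_self (by positivity), h.apply_zero_mem s hs⟩
    · rw [hytarget s hs]
      exact h.starConvex s hs
  have hsymm : ∀ q ∈ D', (y q.1).symm q.2 = χ.symm (ψ q) := fun q hq => hysymm q.1 hq.1.1 q.2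
  refine ⟨y, fun s hs => ⟨hymem s hs, hysource s hs, hmodel s hs⟩, ?_, ?_, ?_⟩
  · rw [hDD]
    refine ⟨hD', fun s z hz t ht => ?_, ?_, ?_, fun q hq => ?_⟩
    · rw [← hDD] at hz ⊢
      exact ⟨hz.1, (hmodel s hz.1).smul_mem hz.2 ht⟩
    · refine (hΦ.comp hpair hpairm).congr fun q hq => ?_
      simp only [Function.comp, hsymm q hq]
    · have h1 := (hH.comp hpair hpairm).pullbackForm (hψD.partial_fderiv hD')
      refine h1.congr fun q hq => ?_
      have hq' : q.2 ∈ (y q.1).target := ((hDD ▸ hq : q ∈ chartFamilyTarget S y)).2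
      exact covariantHess_comp (ψ := fun z => ψ (q.1, z)) hχ (hymem _ hq.1.1) hq'
        (fun z hz => hBχ (hmem _ hq.1.1 z hz).2) (fun z _ => hysymm _ hq.1.1 z)
        ((hΦs _ hq.1.1).contDiffAt (hB.mem_nhds hq.2))
    · have hq' : q ∈ chartFamilyTarget S y := hDD ▸ hq
      exact (hmodel q.1 hq'.1).isInvertible q.2 hq'.2
  · have h1 : ContMDiffOn ((𝓡 k).prod (𝓡 n)) 𝓘(ℝ, 𝔼 k × 𝔼 n) ∞ (fun q : 𝔼 k × M => (q.1, χ q.2))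
        (S ×ˢ (χ.source ∩ χ ⁻¹' Metric.ball x₀ r)) :=
      contMDiffOn_fst.prodMk_space
        ((contMDiffOn_of_mem_maximalAtlas hχ).comp contMDiffOn_snd fun q hq => hq.2.1)
    refine (h.smooth_inv.contMDiffOn.comp h1 fun q hq => ⟨hq.1, hq.2.2⟩).congr fun q hq => ?_
    exact hyapply q.1 hq.1 q.2
  · rw [hDD]
    exact ((contMDiffOn_symm_of_mem_maximalAtlas hχ).comp hψD.contMDiffOn
      fun q hq => hBχ hq.2).congr hsymm

end ChartFamilies

theorem isInvertible_of_nondegenerate {E : Type*} [NormedAddCommGroup E] [NormedSpace ℝ E]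
    [FiniteDimensional ℝ E] {A : E →L[ℝ] E →L[ℝ] ℝ} (h : ∀ v, (∀ w, A v w = 0) → v = 0) :
    A.IsInvertible := by
  have hinj : Function.Injective (A : E →ₗ[ℝ] E →L[ℝ] ℝ) :=
    (injective_iff_map_eq_zero _).2 fun v hv => h v fun w => by
      have : A v = 0 := hv
      simp [this]
  have hdim : Module.finrank ℝ E = Module.finrank ℝ (E →L[ℝ] ℝ) :=
    (Subspace.dual_finrank_eq (K := ℝ) (V := E)).symm.trans
      (LinearMap.toContinuousLinearMap (𝕜 := ℝ) (E := E) (F' := ℝ)).finrank_eq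
  have : FiniteDimensional ℝ (E →L[ℝ] ℝ) :=
    (LinearMap.toContinuousLinearMap (𝕜 := ℝ) (E := E) (F' := ℝ)).finiteDimensional
  refine ⟨(LinearMap.linearEquivOfInjective (A : E →ₗ[ℝ] E →L[ℝ] ℝ) hinj
    hdim).toContinuousLinearEquiv, ?_⟩
  ext v : 1
  rfl

/-! ### A domain stable under perturbations, and the main theorem. -/

section StableDomains

variable {n : ℕ} {M : Type u} [TopologicalSpace M] [T2Space M]
  [ChartedSpace (EuclideanSpace ℝ (Fin n)) M] [IsManifold (𝓡 n) ∞ M]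

/-- A nondegenerate critical point has a neighbourhood on which all small perturbations of the phase
and the connection have linearizing charts, depending smoothly on parameters. -/
theorem IsNondegenerateCriticalPoint.exists_stable_domain {C : TorsionFreeConnection n M} {U : Set M}
    {Φ : M → ℝ} {p : M} (hU : IsOpen U) (hΦ : ContMDiffOn (𝓡 n) 𝓘(ℝ, ℝ) ∞ Φ U) (hp : p ∈ U)
    (hcrit : IsNondegenerateCriticalPoint (n := n) Φ p) {N : Set M} (hN : N ∈ 𝓝 p) :
    ∃ Ω : Set M, IsOpen Ω ∧ p ∈ Ω ∧ Ω ⊆ N ∩ U ∧ ∃ (K : Set M) (m : ℕ) (ε : ℝ), IsCompact K ∧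
      K ⊆ (chartAt (𝔼 n) p).source ∩ U ∧ 0 < ε ∧
      ∀ (k : ℕ) (S : Set (𝔼 k)) (C' : 𝔼 k → TorsionFreeConnection n M) (Φ' : 𝔼 k → M → ℝ),
        IsOpen S → IsSmoothFamilyOfConnections S C' →
        ContMDiffOn ((𝓡 k).prod (𝓡 n)) 𝓘(ℝ, ℝ) ∞ (fun z : 𝔼 k × M => Φ' z.1 z.2) (S ×ˢ U) →
        (∀ s ∈ S, IsCloseOn (chartAt (𝔼 n) p) K m ε C Φ (C' s) (Φ' s)) →
        ∃ y, IsSmoothFlatChartFamily S C' Φ' Ω y := by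
  set χ := chartAt (𝔼 n) p with hχdef
  have hχ : χ ∈ IsManifold.maximalAtlas (𝓡 n) ∞ M := IsManifold.chart_mem_maximalAtlas p
  have hps : p ∈ χ.source := mem_chart_source _ p
  set x₀ := χ p
  let W := χ.target ∩ χ.symm ⁻¹' (U ∩ interior N)
  have hW : IsOpen W := χ.symm.isOpen_inter_preimage (hU.inter isOpen_interior)
  have hx₀ : x₀ ∈ W := ⟨χ.map_source hps, by
    rw [mem_preimage, χ.left_inv hps]
    exact ⟨hp, mem_interior_iff_mem_nhds.2 hN⟩⟩
  obtain ⟨R₀, hR₀, hball⟩ := Metric.isOpen_iff.1 hW x₀ hx₀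
  have hB₀ : IsOpen (Metric.ball x₀ R₀) := Metric.isOpen_ball
  have hB₀χ : Metric.ball x₀ R₀ ⊆ χ.target := fun x hx => (hball hx).1
  have hsmooth : ∀ Ψ : M → ℝ, ContMDiffOn (𝓡 n) 𝓘(ℝ, ℝ) ∞ Ψ U →
      ContDiffOn ℝ ∞ (Ψ ∘ χ.symm) (Metric.ball x₀ R₀) := fun Ψ hΨ =>
    contMDiffOn_iff_contDiffOn.1 (hΨ.comp
      ((contMDiffOn_symm_of_mem_maximalAtlas hχ).mono hB₀χ) fun x hx => (hball hx).2.1)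
  have hφ := hsmooth Φ hΦ
  have hd0 : fderiv ℝ (Φ ∘ χ.symm) x₀ = 0 :=
    (mfderiv_eq_zero_iff_fderiv_coord hχ hps ((hφ.contDiffAt
      (hB₀.mem_nhds (Metric.mem_ball_self hR₀))).differentiableAt (by simp))).1 hcrit.1
  obtain ⟨r, R, A, ε₀, hr, hrR, hRR₀, hA, hAr, hε₀, H⟩ := exists_uniform_radius hR₀ hφ
    ((contDiffOn_connectionForm C hχ).mono hB₀χ) hd0 (isInvertible_of_nondegenerate hcrit.2)
  obtain ⟨Λ, hΛ, hclose⟩ := exists_norm_iteratedFDeriv_phaseJet_sub_le.{u} n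
  have hRB : Metric.closedBall x₀ R ⊆ Metric.ball x₀ R₀ := Metric.closedBall_subset_ball hRR₀
  have hrB : Metric.ball x₀ r ⊆ Metric.ball x₀ R := Metric.ball_subset_ball (by linarith)
  have hRR : Metric.ball x₀ R ⊆ Metric.ball x₀ R₀ := Metric.ball_subset_ball hRR₀.le
  -- The domain is the coordinate ball of radius r, but closeness is required on the larger closed
  -- ball of radius R, where the gradient field enters the integral equation. Order 4 controls two
  -- derivatives of the jet. Dividing ε₀ by Λ + 1 absorbs the constant of the jet comparison.
  refine ⟨χ.source ∩ χ ⁻¹' Metric.ball x₀ r, χ.isOpen_inter_preimage Metric.isOpen_ball,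
    ⟨hps, Metric.mem_ball_self hr⟩, fun x hx => ?_, χ.symm '' Metric.closedBall x₀ R, 4,
    ε₀ / (Λ + 1), ?_, ?_, by positivity, ?_⟩
  · have h1 := (hball (hRR (hrB hx.2))).2
    rw [mem_preimage, χ.left_inv hx.1] at h1
    exact ⟨interior_subset h1.2, h1.1⟩
  · exact (isCompact_closedBall x₀ R).image_of_continuousOn
      (χ.continuousOn_symm.mono (hRB.trans hB₀χ))
  · rintro _ ⟨x, hx, rfl⟩
    exact ⟨χ.map_target (hB₀χ (hRB hx)), (hball (hRB hx)).2.1⟩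
  intro k S C' Φ' hS hC' hΦ' hnear
  have hfam : ContDiffOn ℝ ∞ (fun q : 𝔼 k × 𝔼 n => Φ' q.1 (χ.symm q.2))
      (S ×ˢ Metric.ball x₀ R₀) := by
    have h1 : ContMDiffOn 𝓘(ℝ, 𝔼 k × 𝔼 n) ((𝓡 k).prod (𝓡 n)) ∞
        (fun q : 𝔼 k × 𝔼 n => (q.1, χ.symm q.2)) (S ×ˢ Metric.ball x₀ R₀) :=
      contDiffOn_fst.contMDiffOn.prodMk ((contMDiffOn_symm_of_mem_maximalAtlas hχ).comp
        contDiffOn_snd.contMDiffOn fun q hq => hB₀χ hq.2)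
    exact contMDiffOn_iff_contDiffOn.1 (hΦ'.comp h1 fun q hq => ⟨hq.1, (hball hq.2).2.1⟩)
  have hΓ := (hC'.contDiffOn_connectionForm hχ).mono (prod_mono subset_rfl hB₀χ)
  have hφs : ∀ s ∈ S, ContDiffOn ℝ ∞ (Φ' s ∘ χ.symm) (Metric.ball x₀ R₀) := fun s hs =>
    hfam.slice fun x hx => ⟨hs, hx⟩
  have key := fun s hs => H (Φ' s ∘ χ.symm) (connectionForm (C' s) χ) (hφs s hs)
    ((contDiffOn_connectionForm (C' s) hχ).mono hB₀χ) fun x hx j hj => by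
      have h1 := hclose M χ C (C' s) (Φ ∘ χ.symm) (Φ' s ∘ χ.symm) (Metric.ball x₀ R₀) x
        (ε₀ / (Λ + 1)) hχ hB₀ hB₀χ hφ (hφs s hs) (hRB hx) (fun i hi => by
          have h2 := hnear s hs (χ.symm x) (mem_image_of_mem _ hx) i hi
          rw [χ.right_inv (hB₀χ (hRB hx))] at h2
          exact ⟨h2.1.le, fun a b => (h2.2 a b).le⟩) j hj
      refine h1.trans ?_
      rw [mul_div_assoc', div_le_iff₀ (by positivity)]
      nlinarith
  have hsub : S ×ˢ Metric.ball x₀ R ⊆ S ×ˢ Metric.ball x₀ R₀ := prod_mono subset_rfl hRR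
  obtain ⟨c, hc⟩ := exists_isEulerFamily hS (φ := fun q => Φ' q.1 (χ.symm q.2))
    (Γ := fun q => connectionForm (C' q.1) χ q.2) hr hrR hA hAr (hfam.mono hsub) (hΓ.mono hsub)
    (fun s hs => (key s hs).1) (fun s hs => (key s hs).2.1) fun s hs => (key s hs).2.2
  obtain ⟨ψ, ζ, hψ⟩ := hc.exists_isLinearization
  exact exists_isSmoothFlatChartFamily_of_isLinearization hχ hr ((hrB.trans hRR).trans hB₀χ) hC'
    (hfam.mono (prod_mono subset_rfl (hrB.trans hRR)))
    (fun s hs x hx => (key s hs).1 x (hrB hx)) hψ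

theorem isSmoothFamilyOfConnections_const (k : ℕ) (C : TorsionFreeConnection n M) (S : Set (𝔼 k)) :
    IsSmoothFamilyOfConnections S fun _ => C := fun _ hφ v w =>
  (contDiffOn_christoffel C hφ v w).comp contDiffOn_snd fun _ hz => hz.2

/-- The operators of a smooth family are smooth. -/
theorem IsSmoothFamilyOfSecondOrderOperatorsOn.isSmoothSecondOrderOperatorOn {k : ℕ} {S : Set (𝔼 k)}
    {Ω : Set M} {L : 𝔼 k → (M → ℂ) → M → ℂ}
    (h : IsSmoothFamilyOfSecondOrderOperatorsOn (n := n) S Ω L) {s : 𝔼 k} (hs : s ∈ S) :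
    IsSmoothSecondOrderOperatorOn (n := n) Ω (L s) := by
  intro φ hφ
  obtain ⟨a, b, c, ha, hb, hc, hL⟩ := h φ hφ
  have hmap : ContMDiffOn (𝓡 n) ((𝓡 k).prod (𝓡 n)) ∞ (fun x : M => (s, x)) (Ω ∩ φ.source) :=
    contMDiffOn_const.prodMk contMDiffOn_id
  have hm : MapsTo (fun x : M => (s, x)) (Ω ∩ φ.source) (S ×ˢ (Ω ∩ φ.source)) := fun x hx =>
    ⟨hs, hx⟩
  exact ⟨fun x => a (s, x), fun x => b (s, x), fun x => c (s, x), ha.comp hmap hm,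
    hb.comp hmap hm, hc.comp hmap hm, hL s hs⟩

end StableDomains

end

theorem lemma2 (n : ℕ) :
    ∃ (Adm : AdmissibilityRule.{u} n) (Box : OperatorRule.{u} n),
      IsIntrinsic Adm Box ∧
      ∀ (M : Type u) [TopologicalSpace M] [T2Space M]
        [ChartedSpace (EuclideanSpace ℝ (Fin n)) M] [IsManifold (𝓡 n) ∞ M]
        (C : TorsionFreeConnection n M) (U : Set M) (Φ : M → ℝ) (p : M),
        IsOpen U → ContMDiffOn (𝓡 n) 𝓘(ℝ, ℝ) ∞ Φ U → p ∈ U →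
        IsNondegenerateCriticalPoint (n := n) Φ p →
        ∀ N ∈ 𝓝 p, ∃ Ω : Set M, IsOpen Ω ∧ p ∈ Ω ∧ Ω ⊆ N ∩ U ∧
          ∃ (K : Set M) (m : ℕ) (ε : ℝ), IsCompact K ∧
            K ⊆ (chartAt (EuclideanSpace ℝ (Fin n)) p).source ∩ U ∧ 0 < ε ∧
            -- the operator on `Ω`, for `(C, Φ)` itself and for all small perturbations
            (∀ (C' : TorsionFreeConnection n M) (Φ' : M → ℝ),
              ContMDiffOn (𝓡 n) 𝓘(ℝ, ℝ) ∞ Φ' U →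
              IsCloseOn (chartAt (EuclideanSpace ℝ (Fin n)) p) K m ε C Φ C' Φ' →
              Adm M C' Φ' Ω ∧
              IsSmoothSecondOrderOperatorOn (n := n) Ω (Box M C' Φ' Ω) ∧
              ∃ p' ∈ Ω, IsNondegenerateCriticalPoint (n := n) Φ' p' ∧
                (∀ q ∈ Ω, mfderiv (𝓡 n) 𝓘(ℝ, ℝ) Φ' q = 0 → q = p') ∧
                SolvesSchrodingerOn n Φ' p' Ω (Box M C' Φ' Ω)) ∧
            -- smooth dependence on the phase and the connection
            (∀ (k : ℕ) (S : Set (EuclideanSpace ℝ (Fin k)))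
              (C' : EuclideanSpace ℝ (Fin k) → TorsionFreeConnection n M)
              (Φ' : EuclideanSpace ℝ (Fin k) → M → ℝ),
              IsOpen S → IsSmoothFamilyOfConnections S C' →
              ContMDiffOn ((𝓡 k).prod (𝓡 n)) 𝓘(ℝ, ℝ) ∞
                (fun z : EuclideanSpace ℝ (Fin k) × M => Φ' z.1 z.2) (S ×ˢ U) →
              (∀ s ∈ S,
                IsCloseOn (chartAt (EuclideanSpace ℝ (Fin n)) p) K m ε C Φ (C' s) (Φ' s)) →
              IsSmoothFamilyOfSecondOrderOperatorsOn (n := n) S Ω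
                (fun s => Box M (C' s) (Φ' s) Ω)) := by
  refine ⟨flatAdmissibility n, flatOperator n, isIntrinsic_flat n, ?_⟩
  intro M _ _ _ _ C U Φ p hU hΦ hp hcrit N hN
  obtain ⟨Ω, hΩ, hpΩ, hΩU, K, m, ε, hK, hKU, hε, H⟩ :=
    hcrit.exists_stable_domain (C := C) hU hΦ hp hN
  refine ⟨Ω, hΩ, hpΩ, hΩU, K, m, ε, hK, hKU, hε, fun C' Φ' hΦ' hnear => ?_,
    fun k S C' Φ' hS hC' hΦ' hnear => ?_⟩
  -- A single phase and connection form a constant family over the one-point space of parameters, k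
  -- = 0.
  · obtain ⟨y, hy⟩ := H 0 univ (fun _ => C') (fun _ => Φ') isOpen_univ
      (isSmoothFamilyOfConnections_const 0 C' univ)
      (hΦ'.comp contMDiffOn_snd fun _ hz => hz.2) fun _ _ => hnear
    have hchart := hy.chart 0 (mem_univ _)
    exact ⟨⟨y 0, hchart⟩,
      hy.isSmoothFamilyOfSecondOrderOperatorsOn.isSmoothSecondOrderOperatorOn (mem_univ 0),
      hchart.exists_criticalPoint⟩
  · obtain ⟨y, hy⟩ := H k S C' Φ' hS hC' hΦ' hnear
    exact hy.isSmoothFamilyOfSecondOrderOperatorsOn
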